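/- Setting. Let $d\in\{2,3\}$, let $\Omega\subset\mathbb R^d$ be a nonempty bounded open convex set (for instance a convex polytope), let $s\in(0,1)$, $\alpha=1-2s$, $d_s=2^{1-2s}\Gamma(1-s)/\Gamma(s)$, $\rho>0$ and $\bar q>0$. Let $A\in L^\infty(\Omega;\mathbb R^{d\times d})$ be symmetric with $A(x)\xi\cdot\xi\ge a_0|\xi|^2$ for all $\xi\in\mathbb R^d$ and a.e. $x\in\Omega$, where $a_0>0$, and let $\mathcal Q=\{q\in L^\infty(\Omega): 0\le q\le\bar q \text{ a.e.}\}$. For $q\in\mathcal Q$ let $(\lambda_k,\varphi_k)_k$ be the eigenpairs of $\mathcal L=-\operatorname{div}(A\nabla\cdot)+q$ with homogeneous Dirichlet conditions, $(\varphi_k)$ orthonormal in $L^2(\Omega)$; let $\mathbb H^s(\Omega)$ be the space of all $w\in L^2(\Omega)$ with $\|w\|_{\mathbb H^s(\Omega)}^2=\sum_k\lambda_k^s(w,\varphi_k)_{L^2(\Omega)}^2<\infty$, and $\mathbb H^{-s}(\Omega)$ its dual, with the dual norm; as sets these spaces do not depend on $q$ and $A$. On $\mathcal C=\Omega\times(0,\infty)$,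 with points $(x',y)$, let $H$ be the space of all $w\in H^1(y^\alpha,\mathcal C)$ that vanish on $\partial\Omega\times(0,\infty)$, let $\operatorname{tr}$ be the trace on $\Omega\times\{0\}$, and put $$a(w,\phi)(q)=\int_{\mathcal C}y^\alpha\bigl(\operatorname{diag}(A,1)\nabla w\cdot\nabla\phi+q\,w\,\phi\bigr)\,dx'\,dy .$$ Let $f\in\mathbb H^{-s}(\Omega)$ and $z_\delta,q^*\in L^2(\Omega)$. For $q\in\mathcal Q$ let $E(q),\mathscr P(q)\in H$ be the weak solutions of $$a(E(q),\phi)(q)=d_s\langle f,\operatorname{tr}\phi\rangle,\qquad a(\phi,\mathscr P(q))(q)=d_s(\operatorname{tr}E(q)-z_\delta,\operatorname{tr}\phi)_{L^2(\Omega)}\qquad\text{for all }\phi\in H,$$ and put, for a.e. $x'\in\Omega$, $$\mathtt e(q)(x')=\int_0^\infty y^\alpha E(q)(x',y)^2\,dy,\quad \mathtt p(q)(x')=\int_0^\infty y^\alpha\mathscr P(q)(x',y)^2\,dy,\quad \mathfrak p(q)(x')=-\frac1{d_s}\int_0^\infty y^\alpha E(q)(x',y)\mathscr P(q)(x',y)\,dy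 .$$ A coefficient $q_{\delta,\rho}\in\mathcal Q$ is a local solution of the extended identification problem if there is $\epsilon>0$ such that $q_{\delta,\rho}$ minimizes $$\mathcal J_{\delta,\rho}(q)=\tfrac12\|\operatorname{tr}E(q)-z_\delta\|_{L^2(\Omega)}^2+\tfrac\rho2\|q-q^*\|_{L^2(\Omega)}^2$$ over all $q\in\mathcal Q$ with $\|q-q_{\delta,\rho}\|_{L^2(\Omega)}<\epsilon$. Theorem. Let $q_{\delta,\rho}$ be a local solution with $\|\mathtt e(q_{\delta,\rho})\|_{L^\infty(\Omega)}<\infty$ and $\|\mathtt p(q_{\delta,\rho})\|_{L^\infty(\Omega)}<\infty$. If $q^*\in H^1(\Omega)$, then $q_{\delta,\rho}\in H^1(\Omega)$ and $\mathfrak p(q_{\delta,\rho})\in H^1(\Omega)$, and $$\|\nabla q_{\delta,\rho}\|_{L^2(\Omega)}+\|\nabla\mathfrak p(q_{\delta,\rho})\|_{L^2(\Omega)}\le C\Bigl(\|\nabla q^*\|_{L^2(\Omega)}+\|f\|_{\mathbb H^{-s}(\Omega)}\|\mathtt p(q_{\delta,\rho})\|_{L^\infty(\Omega)}^{1/2}+\bigl(\|f\|_{\mathbb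 H^{-s}(\Omega)}+\|z_\delta\|_{\mathbb H^{-s}(\Omega)}\bigr)\|\mathtt e(q_{\delta,\rho})\|_{L^\infty(\Omega)}^{1/2}\Bigr),$$ where the $\mathbb H^{-s}(\Omega)$ norms are those of the operator $\mathcal L$ with $q=q_{\delta,\rho}$, and $C$ depends only on $d$, $\Omega$, $s$, $a_0$ and the regularization parameter $\rho$; in particular it does not depend on $q_{\delta,\rho}$, $f$, $z_\delta$, $q^*$, $\bar q$, nor otherwise on $A$. -/

import Mathlib

open MeasureTheory Set
open scoped ENNReal NNReal ContDiff

noncomputable section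

namespace FracIdent

/-- The Euclidean space `ℝ^d`. -/
abbrev Rd (d : ℕ) : Type := EuclideanSpace ℝ (Fin d)

/-- Vectors of `ℝ^{d+1} = ℝ^d × ℝ`, with the Euclidean norm. -/
abbrev ExtVec (d : ℕ) : Type := WithLp 2 (Rd d × ℝ)

variable {d : ℕ}

/-! ## Function spaces on `Ω` -/

/-- `L²(Ω)`. -/
abbrev L2 (Ω : Set (Rd d)) : Type := Lp ℝ 2 (volume.restrict Ω)

/-- The ambient Hilbert space of pairs `(u, ∇u)` in `L²(Ω) × L²(Ω)^d`, with the norm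
`(‖u‖² + ‖∇u‖²)^{1/2}`. -/
abbrev Jet (Ω : Set (Rd d)) : Type := WithLp 2 (L2 Ω × Lp (Rd d) 2 (volume.restrict Ω))

/-- `C_c^∞(Ω)`. -/
def IsTest (Ω : Set (Rd d)) (φ : Rd d → ℝ) : Prop :=
  ContDiff ℝ ∞ φ ∧ HasCompactSupport φ ∧ tsupport φ ⊆ Ω

/-- `u ∈ H¹(Ω)` with distributional gradient `g`. -/
def IsH1 (Ω : Set (Rd d)) (u : Rd d → ℝ) (g : Rd d → Rd d) : Prop :=
  MemLp u 2 (volume.restrict Ω) ∧ MemLp g 2 (volume.restrict Ω) ∧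
    ∀ φ : Rd d → ℝ, IsTest Ω φ → ∀ i : Fin d,
      ∫ x in Ω, u x * (gradient φ x) i = - ∫ x in Ω, (g x) i * φ x

/-- `H₀¹(Ω)`: the closure of `C_c^∞(Ω)` in the `H¹(Ω)` norm; an element is the pair `(u, ∇u)`. -/
def H01 (Ω : Set (Rd d)) : Submodule ℝ (Jet Ω) :=
  (Submodule.span ℝ {U : Jet Ω | ∃ φ : Rd d → ℝ, IsTest Ω φ ∧
    (U.fst =ᵐ[volume.restrict Ω] φ) ∧
    (U.snd =ᵐ[volume.restrict Ω] gradient φ)}).topologicalClosure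

/-! ## The elliptic operator and the spectral spaces -/

/-- `A ξ · η`. -/
def matForm (M : Matrix (Fin d) (Fin d) ℝ) (ξ η : Rd d) : ℝ :=
  ∑ i, ∑ j, M i j * ξ j * η i

/-- `A ∈ L^∞(Ω)` is symmetric and uniformly positive definite with constant `a₀`. -/
structure IsDiffusion (Ω : Set (Rd d)) (a₀ : ℝ) (A : Rd d → Matrix (Fin d) (Fin d) ℝ) : Prop where
  memLp : ∀ i j, MemLp (fun x => A x i j) ⊤ (volume.restrict Ω)
  symm : ∀ᵐ x ∂(volume.restrict Ω), (A x).IsSymm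
  elliptic : ∀ᵐ x ∂(volume.restrict Ω), ∀ ξ : Rd d, a₀ * ‖ξ‖ ^ 2 ≤ matForm (A x) ξ ξ

/-- `a_Ω(U, V) = ∫_Ω (A ∇U · ∇V + q U V)`. -/
def aOmega (Ω : Set (Rd d)) (A : Rd d → Matrix (Fin d) (Fin d) ℝ) (q : L2 Ω) (U V : Jet Ω) : ℝ :=
  ∫ x in Ω, (matForm (A x) (U.snd x) (V.snd x) + q x * U.fst x * V.fst x)

/-- `(lam, φ)` is an eigenpair of `ℒ = -div(A∇ ·) + q` with homogeneous Dirichlet conditions. -/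
def IsEigenpair (Ω : Set (Rd d)) (A : Rd d → Matrix (Fin d) (Fin d) ℝ) (q : L2 Ω)
    (lam : ℝ) (φ : L2 Ω) : Prop :=
  φ ≠ 0 ∧ ∃ U ∈ H01 Ω, U.fst = φ ∧
    ∀ V ∈ H01 Ω, aOmega Ω A q U V = lam * inner ℝ U.fst V.fst

/-- `‖w‖²_{ℍ^s(Ω)}`, in `[0, ∞]`: the supremum of `∑ λ_i^s (w, φ_i)²` over the finite
`L²`-orthonormal families of eigenfunctions of `ℒ`. For every orthonormal basis of eigenfunctions
`(λ_k, φ_k)` this is `∑_k λ_k^s (w, φ_k)²`, by orthogonality of distinct eigenspaces and Bessel's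
inequality in each of them; in this form no basis has to be chosen. -/
def hsEnergy (Ω : Set (Rd d)) (A : Rd d → Matrix (Fin d) (Fin d) ℝ) (q : L2 Ω) (s : ℝ)
    (w : L2 Ω) : ℝ≥0∞ :=
  ⨆ (n : ℕ) (lam : Fin n → ℝ) (φ : Fin n → L2 Ω)
    (_ : Orthonormal ℝ φ ∧ ∀ i, IsEigenpair Ω A q (lam i) (φ i)),
    ∑ i, ENNReal.ofReal (lam i ^ s) * ENNReal.ofReal ((inner ℝ (φ i) w : ℝ) ^ 2)

lemma hsEnergy_add (Ω : Set (Rd d)) (A : Rd d → Matrix (Fin d) (Fin d) ℝ) (q : L2 Ω) (s : ℝ)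
    (v w : L2 Ω) :
    hsEnergy Ω A q s (v + w) ≤ 2 * hsEnergy Ω A q s v + 2 * hsEnergy Ω A q s w := by
  refine iSup_le fun n => iSup_le fun lam => iSup_le fun φ => iSup_le fun h => ?_
  have hle : ∀ u : L2 Ω, ∑ i, ENNReal.ofReal (lam i ^ s) *
      ENNReal.ofReal ((inner ℝ (φ i) u : ℝ) ^ 2) ≤ hsEnergy Ω A q s u := fun u =>
    le_iSup_of_le n (le_iSup_of_le lam (le_iSup_of_le φ (le_iSup_of_le h le_rfl)))
  calc _ ≤ 2 * (∑ i, ENNReal.ofReal (lam i ^ s) * ENNReal.ofReal ((inner ℝ (φ i) v : ℝ) ^ 2)) +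
        2 * (∑ i, ENNReal.ofReal (lam i ^ s) * ENNReal.ofReal ((inner ℝ (φ i) w : ℝ) ^ 2)) := by
        rw [Finset.mul_sum, Finset.mul_sum, ← Finset.sum_add_distrib]
        refine Finset.sum_le_sum fun i _ => ?_
        have e : ENNReal.ofReal ((inner ℝ (φ i) (v + w) : ℝ) ^ 2) ≤
            2 * ENNReal.ofReal ((inner ℝ (φ i) v : ℝ) ^ 2) +
            2 * ENNReal.ofReal ((inner ℝ (φ i) w : ℝ) ^ 2) := by
          have h2 : ∀ a : ℝ, 2 * ENNReal.ofReal a = ENNReal.ofReal (2 * a) := fun a => by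
            rw [ENNReal.ofReal_mul (by norm_num)]; simp
          rw [h2, h2, ← ENNReal.ofReal_add (by positivity) (by positivity)]
          refine ENNReal.ofReal_le_ofReal ?_
          rw [inner_add_right]
          nlinarith [sq_nonneg ((inner ℝ (φ i) v : ℝ) - inner ℝ (φ i) w)]
        calc _ ≤ ENNReal.ofReal (lam i ^ s) * _ := mul_le_mul_right e _
          _ = _ := by ring
    _ ≤ _ := by gcongr <;> exact hle _

lemma hsEnergy_smul (Ω : Set (Rd d)) (A : Rd d → Matrix (Fin d) (Fin d) ℝ) (q : L2 Ω) (s : ℝ)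
    (c : ℝ) (w : L2 Ω) :
    hsEnergy Ω A q s (c • w) ≤ ENNReal.ofReal (c ^ 2) * hsEnergy Ω A q s w := by
  refine iSup_le fun n => iSup_le fun lam => iSup_le fun φ => iSup_le fun h => ?_
  calc _ = ENNReal.ofReal (c ^ 2) * ∑ i, ENNReal.ofReal (lam i ^ s) *
        ENNReal.ofReal ((inner ℝ (φ i) w : ℝ) ^ 2) := by
        rw [Finset.mul_sum]
        refine Finset.sum_congr rfl fun i _ => ?_
        rw [inner_smul_right, mul_pow, ENNReal.ofReal_mul (by positivity)]
        ring
    _ ≤ _ := by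
        gcongr
        exact le_iSup_of_le n (le_iSup_of_le lam (le_iSup_of_le φ (le_iSup_of_le h le_rfl)))

/-- The space `ℍ^s(Ω)` of the operator `ℒ` with coefficients `A` and `q`. -/
def Hs (Ω : Set (Rd d)) (A : Rd d → Matrix (Fin d) (Fin d) ℝ) (q : L2 Ω) (s : ℝ) :
    Submodule ℝ (L2 Ω) where
  carrier := {w | hsEnergy Ω A q s w < ⊤}
  zero_mem' := by
    have h := hsEnergy_smul Ω A q s 0 0
    simp only [zero_smul] at h
    refine lt_of_le_of_lt h ?_
    simp
  add_mem' {v w} hv hw := lt_of_le_of_lt (hsEnergy_add Ω A q s v w)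
    (ENNReal.add_lt_top.2 ⟨ENNReal.mul_lt_top (by simp) hv, ENNReal.mul_lt_top (by simp) hw⟩)
  smul_mem' c w hw := lt_of_le_of_lt (hsEnergy_smul Ω A q s c w)
    (ENNReal.mul_lt_top ENNReal.ofReal_lt_top hw)

/-- The reference space `𝓗^s(Ω)` of the Dirichlet Laplacian (`A = I`, `q = 0`). As a set it is
`ℍ^s(Ω)` for every admissible `A` and `q`. -/
abbrev HsRef (Ω : Set (Rd d)) (s : ℝ) : Submodule ℝ (L2 Ω) := Hs Ω (fun _ => 1) 0 s

/-- The norm `‖f‖_{ℍ^{-s}(Ω)}`, dual to the norm of `ℍ^s(Ω)` (coefficients `A` and `q`). -/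
def negNorm (Ω : Set (Rd d)) (A : Rd d → Matrix (Fin d) (Fin d) ℝ) (q : L2 Ω) (s : ℝ)
    (f : HsRef Ω s →ₗ[ℝ] ℝ) : ℝ≥0∞ :=
  ⨆ (w : HsRef Ω s) (_ : hsEnergy Ω A q s w ≤ 1), ENNReal.ofReal |f w|

/-- `z ∈ L²(Ω)` as the functional `w ↦ (z, w)_{L²(Ω)}`. -/
def l2Functional (Ω : Set (Rd d)) (s : ℝ) (z : L2 Ω) : HsRef Ω s →ₗ[ℝ] ℝ :=
  (innerₛₗ ℝ z).comp (HsRef Ω s).subtype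

open Classical in
/-- The duality pairing `⟨f, t⟩` (zero outside of `𝓗^s(Ω)`, which contains all traces). -/
def pairing (Ω : Set (Rd d)) (s : ℝ) (f : HsRef Ω s →ₗ[ℝ] ℝ) (t : L2 Ω) : ℝ :=
  if h : t ∈ HsRef Ω s then f ⟨t, h⟩ else 0

/-! ## Weighted spaces on the cylinder `𝒞 = Ω × (0, ∞)`, with `α = 1 - 2s` -/

/-- The measure `y^α dx' dy` on `𝒞`. -/
def cylMeasure (Ω : Set (Rd d)) (s : ℝ) : Measure (Rd d × ℝ) :=
  (volume.restrict Ω).prod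
    ((volume.restrict (Ioi (0 : ℝ))).withDensity fun y => ENNReal.ofReal (y ^ (1 - 2 * s)))

/-- The ambient Hilbert space of pairs `(w, ∇w)` in `L²(y^α, 𝒞) × L²(y^α, 𝒞)^{d+1}`, with the norm
of `H¹(y^α, 𝒞)`. -/
abbrev CylJet (Ω : Set (Rd d)) (s : ℝ) : Type :=
  WithLp 2 (Lp ℝ 2 (cylMeasure Ω s) × Lp (ExtVec d) 2 (cylMeasure Ω s))

/-- Smooth functions of compact support that vanish near the lateral boundary; no condition is
imposed at `y = 0`. -/
def IsCylTest (Ω : Set (Rd d)) (ψ : Rd d × ℝ → ℝ) : Prop :=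
  ContDiff ℝ ∞ ψ ∧ HasCompactSupport ψ ∧ tsupport ψ ⊆ Ω ×ˢ univ

/-- The gradient `(∇_{x'} ψ, ∂_y ψ)`. -/
def extGrad (ψ : Rd d × ℝ → ℝ) (p : Rd d × ℝ) : ExtVec d :=
  WithLp.toLp 2 (gradient (fun x => ψ (x, p.2)) p.1, deriv (fun y => ψ (p.1, y)) p.2)

/-- `W` is the pair `(ψ, ∇ψ)`. -/
def IsJetOf (Ω : Set (Rd d)) (s : ℝ) (W : CylJet Ω s) (ψ : Rd d × ℝ → ℝ) : Prop :=
  (W.fst =ᵐ[cylMeasure Ω s] ψ) ∧ (W.snd =ᵐ[cylMeasure Ω s] extGrad ψ)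

/-- The functions in `H¹(y^α, 𝒞)` that vanish on the lateral boundary `∂Ω × (0, ∞)`: the closure of
the smooth functions that vanish near it; an element is the pair `(w, ∇w)`. -/
def HL (Ω : Set (Rd d)) (s : ℝ) : Submodule ℝ (CylJet Ω s) :=
  (Submodule.span ℝ {W : CylJet Ω s | ∃ ψ, IsCylTest Ω ψ ∧ IsJetOf Ω s W ψ}).topologicalClosure

/-- `t ∈ L²(Ω)` is the trace of `W` on `Ω × {0}`: the closure of the graph of
`ψ ↦ ψ(·, 0)` on smooth functions. -/
def IsTrace (Ω : Set (Rd d)) (s : ℝ) (W : CylJet Ω s) (t : L2 Ω) : Prop :=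
  (W, t) ∈ closure {p : CylJet Ω s × L2 Ω | ∃ ψ, IsCylTest Ω ψ ∧ IsJetOf Ω s p.1 ψ ∧
    (p.2 =ᵐ[volume.restrict Ω] fun x => ψ (x, 0))}

/-- The trace operator `tr`. -/
def tr (Ω : Set (Rd d)) (s : ℝ) (W : HL Ω s) : L2 Ω :=
  Classical.epsilon (IsTrace Ω s (W : CylJet Ω s))

/-- The function `w` of an element `(w, ∇w)`. -/
def fn {Ω : Set (Rd d)} {s : ℝ} (W : HL Ω s) : Rd d × ℝ → ℝ := (W : CylJet Ω s).fst

/-- The gradient `∇w` of an element `(w, ∇w)`. -/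
def grad {Ω : Set (Rd d)} {s : ℝ} (W : HL Ω s) : Rd d × ℝ → ExtVec d := (W : CylJet Ω s).snd

/-! ## The extended identification problem -/

/-- `d_s = 2^{1-2s} Γ(1-s) / Γ(s)`. -/
def ds (s : ℝ) : ℝ := 2 ^ (1 - 2 * s) * Real.Gamma (1 - s) / Real.Gamma s

/-- `a_𝒞(W, Φ)(q) = ∫_𝒞 y^α (𝐀 ∇W · ∇Φ + q W Φ)` with `𝐀 = diag(A, 1)`. -/
def aCyl (Ω : Set (Rd d)) (s : ℝ) (A : Rd d → Matrix (Fin d) (Fin d) ℝ) (q : L2 Ω)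
    (W Φ : HL Ω s) : ℝ :=
  ∫ p, (matForm (A p.1) (grad W p).fst (grad Φ p).fst + (grad W p).snd * (grad Φ p).snd
    + q p.1 * fn W p * fn Φ p) ∂(cylMeasure Ω s)

/-- The admissible coefficients `𝒬`. -/
def Adm (Ω : Set (Rd d)) (qbar : ℝ) : Set (L2 Ω) :=
  {q | ∀ᵐ x ∂(volume.restrict Ω), 0 ≤ q x ∧ q x ≤ qbar}

/-- The extended coefficient-to-solution operator: `E(q)` is the weak solution of
`a_𝒞(E(q), Φ)(q) = d_s ⟨f, tr Φ⟩` for all `Φ`. -/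
def E (Ω : Set (Rd d)) (s : ℝ) (A : Rd d → Matrix (Fin d) (Fin d) ℝ)
    (f : HsRef Ω s →ₗ[ℝ] ℝ) (q : L2 Ω) : HL Ω s :=
  Classical.epsilon fun U : HL Ω s =>
    ∀ Φ : HL Ω s, aCyl Ω s A q U Φ = ds s * pairing Ω s f (tr Ω s Φ)

/-- The adjoint state `𝒫(q)`: `a_𝒞(W, 𝒫(q))(q) = d_s (tr E(q) - z, tr W)` for all `W`. -/
def adj (Ω : Set (Rd d)) (s : ℝ) (A : Rd d → Matrix (Fin d) (Fin d) ℝ)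
    (f : HsRef Ω s →ₗ[ℝ] ℝ) (z q : L2 Ω) : HL Ω s :=
  Classical.epsilon fun P : HL Ω s =>
    ∀ W : HL Ω s, aCyl Ω s A q W P = ds s * inner ℝ (tr Ω s (E Ω s A f q) - z) (tr Ω s W)

/-- The cost functional `½ ‖tr E(q) - z‖² + (ρ/2) ‖q - q*‖²`. -/
def cost (Ω : Set (Rd d)) (s : ℝ) (A : Rd d → Matrix (Fin d) (Fin d) ℝ)
    (f : HsRef Ω s →ₗ[ℝ] ℝ) (z qstar : L2 Ω) (ρ : ℝ) (q : L2 Ω) : ℝ :=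
  1 / 2 * ‖tr Ω s (E Ω s A f q) - z‖ ^ 2 + ρ / 2 * ‖q - qstar‖ ^ 2

/-- Local solutions of the extended identification problem (locality in `L²(Ω)`). -/
def IsLocalSolution (Ω : Set (Rd d)) (s : ℝ) (A : Rd d → Matrix (Fin d) (Fin d) ℝ)
    (f : HsRef Ω s →ₗ[ℝ] ℝ) (z qstar : L2 Ω) (ρ qbar : ℝ) (q : L2 Ω) : Prop :=
  q ∈ Adm Ω qbar ∧ ∃ ε > 0, ∀ q' ∈ Adm Ω qbar, ‖q' - q‖ < ε →
    cost Ω s A f z qstar ρ q ≤ cost Ω s A f z qstar ρ q'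

/-- `𝚎(q)(x') = ∫_0^∞ y^α E(q)(x', y)² dy`. -/
def eFun (Ω : Set (Rd d)) (s : ℝ) (A : Rd d → Matrix (Fin d) (Fin d) ℝ)
    (f : HsRef Ω s →ₗ[ℝ] ℝ) (q : L2 Ω) (x : Rd d) : ℝ :=
  ∫ y in Ioi (0 : ℝ), y ^ (1 - 2 * s) * fn (E Ω s A f q) (x, y) ^ 2

/-- `𝚙(q)(x') = ∫_0^∞ y^α 𝒫(q)(x', y)² dy`. -/
def pFun (Ω : Set (Rd d)) (s : ℝ) (A : Rd d → Matrix (Fin d) (Fin d) ℝ)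
    (f : HsRef Ω s →ₗ[ℝ] ℝ) (z q : L2 Ω) (x : Rd d) : ℝ :=
  ∫ y in Ioi (0 : ℝ), y ^ (1 - 2 * s) * fn (adj Ω s A f z q) (x, y) ^ 2

/-- `𝔭(q)(x') = -(1/d_s) ∫_0^∞ y^α E(q)(x', y) 𝒫(q)(x', y) dy`. -/
def frakP (Ω : Set (Rd d)) (s : ℝ) (A : Rd d → Matrix (Fin d) (Fin d) ℝ)
    (f : HsRef Ω s →ₗ[ℝ] ℝ) (z q : L2 Ω) (x : Rd d) : ℝ :=
  -(1 / ds s) * ∫ y in Ioi (0 : ℝ),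
    y ^ (1 - 2 * s) * fn (E Ω s A f q) (x, y) * fn (adj Ω s A f z q) (x, y)

end FracIdent

end

/-!
The theorem is a bootstrap from the first-order optimality condition.

**States.** Functions of the energy space `HL` have a trace in `L²(Ω)`: along every vertical line
this is the one-dimensional weighted inequality `trace_half_line`, and its refinement for the
coefficients of `w(·, y)` in an orthonormal family of eigenfunctions gives
`‖tr W‖²_{ℍ^s} ≤ (4 + 1/s) a(W, W)` (`hsEnergy_trL_le`), so that traces can be paired with elements
of `ℍ^{-s}(Ω)`. Together with the Poincaré inequality (`HL_poincare`), the energy form is coercive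
with a constant that depends only on `a₀` and a radius of a ball containing `Ω`. Lax–Milgram then
identifies `E(q)` and `𝒫(q)` (defined through `Classical.epsilon`) with the weak solutions, and
testing with the solutions themselves bounds their norms by the `ℍ^{-s}(Ω)` norms of the data
(`energy_E_le`, `energy_adj_le`).

**The averages.** For `W, V` in the energy space, `x' ↦ ∫ y^α W V dy` has the distributional
gradient `∫ y^α (∇W V + W ∇V) dy`; by the Cauchy–Schwarz inequality in `y` its `L²` norm is at most `d` times
`‖∇W‖ ‖∫ y^α V²‖_∞^{1/2} + ‖∇V‖ ‖∫ y^α W²‖_∞^{1/2}` (`isH1_fiber`, `eLpNorm_fiberGrad_le`). Applied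
to `E(q)` and `𝒫(q)` this is the bound of `∇𝔭`.

**Optimality.** Perturbing a local solution `q` inside the convex set of admissible coefficients
gives `∫ (𝔭 + ρ (q - q*)) (h - q) ≥ 0` for every admissible `h` (`variational_inequality`), which
says that `q` is the pointwise projection of `q* - 𝔭 / ρ` onto `[0, q̄]` (`localSolution_eq_clip`).
The projection is a contraction that fixes `0`, and contractions act on `H¹(Ω)` without increasing
the norms of the partial derivatives (`IsH1.comp_contraction`). The latter is proved with
difference quotients: `H¹` regularity is equivalent to an `L²` bound `O(|t|)` of translations by
`t e_i` on compact subsets of `Ω`, and this bound is inherited by contractions.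
-/

noncomputable section

namespace FracIdent

/-! ### Products and weighted pairings of square-integrable functions -/

section

variable {d : ℕ}

section L2Tools

variable {X : Type*} [MeasurableSpace X] {m : Measure X}

/-- The bounded bilinear form `(u, v) ↦ ∫ a u v` on `L²` with a bounded weight `a`. -/
def mulForm (a : X → ℝ) (ha : MemLp a ⊤ m) : Lp ℝ 2 m →L[ℝ] Lp ℝ 2 m →L[ℝ] ℝ :=
  ((ContinuousLinearMap.mul ℝ ℝ).lpPairing m 2 2).comp
    ((ContinuousLinearMap.mul ℝ ℝ).holderL m ⊤ 2 2 (ha.toLp a))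

lemma mulForm_apply (a : X → ℝ) (ha : MemLp a ⊤ m) (u v : Lp ℝ 2 m) :
    mulForm a ha u v = ∫ x, a x * u x * v x ∂m := by
  simp only [mulForm, ContinuousLinearMap.comp_apply, ContinuousLinearMap.lpPairing_eq_integral]
  refine integral_congr_ae ?_
  have h := (ContinuousLinearMap.mul ℝ ℝ).coeFn_holder (r := 2) (ha.toLp a) u
  filter_upwards [h, ha.coeFn_toLp] with x hx h2
  change (ContinuousLinearMap.mul ℝ ℝ)
    (((ContinuousLinearMap.mul ℝ ℝ).holder 2 (ha.toLp a) u : Lp ℝ 2 m) x) (v x) = _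
  rw [hx, h2]; simp

lemma integrable_mul_mul {a u v : X → ℝ} (ha : MemLp a ⊤ m) (hu : MemLp u 2 m)
    (hv : MemLp v 2 m) : Integrable (fun x => a x * u x * v x) m := by
  have h : MemLp (fun x => a x * u x) 2 m := hu.mul' ha
  exact h.integrable_mul hv

lemma inner_L2_eq (u v : Lp ℝ 2 m) : inner ℝ u v = ∫ x, u x * v x ∂m := by
  rw [L2.inner_def]
  refine integral_congr_ae (Filter.Eventually.of_forall fun x => ?_)
  simp [mul_comm]

lemma norm_sq_L2_eq (u : Lp ℝ 2 m) : ‖u‖ ^ 2 = ∫ x, u x ^ 2 ∂m := by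
  rw [← real_inner_self_eq_norm_sq, inner_L2_eq]; simp [sq]

lemma norm_sq_Lp {F : Type*} [NormedAddCommGroup F] [InnerProductSpace ℝ F] (u : Lp F 2 m) :
    ‖u‖ ^ 2 = ∫ x, ‖u x‖ ^ 2 ∂m := by
  rw [← real_inner_self_eq_norm_sq, L2.inner_def]
  simp only [real_inner_self_eq_norm_sq]

lemma integrable_norm_sq_Lp {F : Type*} [NormedAddCommGroup F] (u : Lp F 2 m) :
    Integrable (fun x => ‖u x‖ ^ 2) m :=
  (memLp_two_iff_integrable_sq_norm (Lp.memLp u).1).1 (Lp.memLp u)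

lemma inner_toLp {u v : X → ℝ} (hu : MemLp u 2 m) (hv : MemLp v 2 m) :
    inner ℝ (hu.toLp u) (hv.toLp v) = ∫ x, u x * v x ∂m := by
  rw [inner_L2_eq]
  refine integral_congr_ae ?_
  filter_upwards [hu.coeFn_toLp, hv.coeFn_toLp] with x h1 h2
  rw [h1, h2]

lemma integral_mul_sq_le {u v : X → ℝ} (hu : MemLp u 2 m) (hv : MemLp v 2 m) :
    (∫ x, u x * v x ∂m) ^ 2 ≤ (∫ x, u x ^ 2 ∂m) * ∫ x, v x ^ 2 ∂m := by
  have h := real_inner_mul_inner_self_le (hu.toLp u) (hv.toLp v)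
  simp only [inner_toLp] at h
  simpa [sq] using h

/-- A linear family of square-integrable functions, as a linear map into `L²`. -/
def toL2 {V F : Type*} [AddCommGroup V] [Module ℝ V] [NormedAddCommGroup F] [NormedSpace ℝ F]
    (g : V →ₗ[ℝ] (X → F)) (h : ∀ v, MemLp (g v) 2 m) : V →ₗ[ℝ] Lp F 2 m where
  toFun v := (h v).toLp (g v)
  map_add' u v := by
    rw [← MemLp.toLp_add]
    exact MemLp.toLp_congr _ _ (Filter.EventuallyEq.of_eq (map_add g u v))
  map_smul' c u := by
    rw [RingHom.id_apply, ← MemLp.toLp_const_smul]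
    exact MemLp.toLp_congr _ _ (Filter.EventuallyEq.of_eq (map_smul g c u))

lemma coeFn_toL2 {V F : Type*} [AddCommGroup V] [Module ℝ V] [NormedAddCommGroup F]
    [NormedSpace ℝ F] (g : V →ₗ[ℝ] (X → F)) (h : ∀ v, MemLp (g v) 2 m) (v : V) :
    toL2 g h v =ᵐ[m] g v := (h v).coeFn_toLp

end L2Tools

/-! ### Partial integrals over the fibres of a product -/

section Fiber

variable {X Y : Type*} [MeasurableSpace X] [MeasurableSpace Y] {μ : Measure X} {ν : Measure Y}

lemma memLp_top_comp_fst [SFinite ν] {b : X → ℝ} (hb : MemLp b ⊤ μ) :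
    MemLp (fun p : X × Y => b p.1) ⊤ (μ.prod ν) := by
  refine memLp_top_of_bound (hb.1.comp_quasiMeasurePreserving Measure.quasiMeasurePreserving_fst)
    (eLpNorm b ⊤ μ).toReal ?_
  refine Measure.quasiMeasurePreserving_fst.ae (p := fun x => ‖b x‖ ≤ (eLpNorm b ⊤ μ).toReal) ?_
  filter_upwards [enorm_ae_le_eLpNormEssSup b μ] with x hx
  rw [← eLpNorm_exponent_top] at hx
  rw [← toReal_enorm]
  exact ENNReal.toReal_mono hb.2.ne hx

/-- The partial integral `x ↦ ∫ U(x, y) V(x, y) dν(y)`. -/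
def fiber (ν : Measure Y) (U V : X × Y → ℝ) (x : X) : ℝ := ∫ y, U (x, y) * V (x, y) ∂ν

lemma fiber_self_nonneg {X : Type*} (U : X × Y → ℝ) (x : X) : 0 ≤ fiber ν U U x :=
  integral_nonneg fun _ => mul_self_nonneg _

variable [SFinite ν]

lemma fiber_integrable {U V : X × Y → ℝ} (hU : MemLp U 2 (μ.prod ν)) (hV : MemLp V 2 (μ.prod ν)) :
    Integrable (fiber ν U V) μ :=
  (hU.integrable_mul hV).integral_prod_left

variable [SFinite μ]

lemma integral_mul_fiber {b : X → ℝ} (hb : MemLp b ⊤ μ) (U V : Lp ℝ 2 (μ.prod ν)) :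
    ∫ x, b x * fiber ν U V x ∂μ = mulForm (fun p : X × Y => b p.1) (memLp_top_comp_fst hb) U V := by
  rw [mulForm_apply, integral_prod _
    (integrable_mul_mul (memLp_top_comp_fst hb) (Lp.memLp U) (Lp.memLp V))]
  refine integral_congr_ae (Filter.Eventually.of_forall fun x => ?_)
  simp only [fiber, ← integral_const_mul, mul_assoc]

lemma integral_fiber_self (U : Lp ℝ 2 (μ.prod ν)) : ∫ x, fiber ν U U x ∂μ = ‖U‖ ^ 2 := by
  rw [norm_sq_L2_eq, integral_prod _ (Lp.memLp U).integrable_sq]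
  simp only [fiber, sq]

lemma ae_memLp_slice {U : X × Y → ℝ} (hU : MemLp U 2 (μ.prod ν)) :
    ∀ᵐ x ∂μ, MemLp (fun y => U (x, y)) 2 ν := by
  filter_upwards [hU.integrable_sq.prod_right_ae, hU.1.prodMk_left] with x h1 h2
  exact (memLp_two_iff_integrable_sq h2).2 h1

lemma fiber_sq_le {U V : X × Y → ℝ} (hU : MemLp U 2 (μ.prod ν)) (hV : MemLp V 2 (μ.prod ν)) :
    ∀ᵐ x ∂μ, fiber ν U V x ^ 2 ≤ fiber ν U U x * fiber ν V V x := by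
  filter_upwards [ae_memLp_slice hU, ae_memLp_slice hV] with x h1 h2
  simpa only [fiber, sq] using integral_mul_sq_le h1 h2

/-- The Cauchy–Schwarz inequality in each fibre bounds the partial integral of a product. -/
lemma eLpNorm_fiber_le (U V : Lp ℝ 2 (μ.prod ν)) :
    eLpNorm (fiber ν U V) 2 μ ≤ ‖U‖ₑ * eLpNorm (fiber ν V V) ⊤ μ ^ (1 / 2 : ℝ) := by
  set N := eLpNorm (fiber ν V V) ⊤ μ with hN
  have h1 : ∀ᵐ x ∂μ, ‖fiber ν U V x‖ₑ ^ (2 : ℝ) ≤ ENNReal.ofReal (fiber ν U U x) * N := by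
    filter_upwards [fiber_sq_le (Lp.memLp U) (Lp.memLp V),
      enorm_ae_le_eLpNormEssSup (fiber ν V V) μ] with x h2 h3
    rw [← eLpNorm_exponent_top, ← hN] at h3
    refine le_trans ?_ (mul_le_mul_right h3 _)
    rw [← ofReal_norm, ← ofReal_norm, ENNReal.rpow_two,
      ← ENNReal.ofReal_pow (norm_nonneg _), ← ENNReal.ofReal_mul (fiber_self_nonneg _ _)]
    refine ENNReal.ofReal_le_ofReal ?_
    rw [Real.norm_of_nonneg (fiber_self_nonneg _ _), Real.norm_eq_abs, sq_abs]
    exact h2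
  have h2 : ∫⁻ x, ENNReal.ofReal (fiber ν U U x) ∂μ = ‖U‖ₑ ^ (2 : ℝ) := by
    rw [← ofReal_integral_eq_lintegral_ofReal (fiber_integrable (Lp.memLp U) (Lp.memLp U))
      (Filter.Eventually.of_forall (fiber_self_nonneg _)), integral_fiber_self,
      ENNReal.rpow_two, ← ofReal_norm, ENNReal.ofReal_pow (norm_nonneg _)]
  rw [eLpNorm_eq_lintegral_rpow_enorm_toReal (by norm_num) (by norm_num)]
  calc (∫⁻ x, ‖fiber ν U V x‖ₑ ^ (2 : ℝ≥0∞).toReal ∂μ) ^ (1 / (2 : ℝ≥0∞).toReal)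
      ≤ (∫⁻ x, ENNReal.ofReal (fiber ν U U x) * N ∂μ) ^ (1 / 2 : ℝ) := by
        simp only [ENNReal.toReal_ofNat]
        gcongr ?_ ^ _
        exact lintegral_mono_ae h1
    _ = (‖U‖ₑ ^ (2 : ℝ) * N) ^ (1 / 2 : ℝ) := by
        rw [lintegral_mul_const'' _
          (fiber_integrable (Lp.memLp U) (Lp.memLp U)).1.aemeasurable.ennreal_ofReal, h2]
    _ = _ := by
        rw [ENNReal.mul_rpow_of_nonneg _ _ (by norm_num), ← ENNReal.rpow_mul]
        norm_num

end Fiber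

end

/-! ### The weight `y^α` on the half-line -/

section

variable {d : ℕ}

/-- The measure `y^{1-2s} dy` on `(0, ∞)`. -/
def wt (s : ℝ) : Measure ℝ :=
  (volume.restrict (Ioi (0 : ℝ))).withDensity fun y => ENNReal.ofReal (y ^ (1 - 2 * s))

instance (s : ℝ) : SFinite (wt s) := by unfold wt; infer_instance

lemma cylMeasure_eq (Ω : Set (Rd d)) (s : ℝ) :
    cylMeasure Ω s = (volume.restrict Ω).prod (wt s) := rfl

lemma measurable_wt_density (s : ℝ) : Measurable fun y : ℝ => ENNReal.ofReal (y ^ (1 - 2 * s)) := by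
  fun_prop

lemma integral_wt (s : ℝ) (f : ℝ → ℝ) :
    ∫ y, f y ∂(wt s) = ∫ y in Ioi (0 : ℝ), y ^ (1 - 2 * s) * f y := by
  rw [wt, integral_withDensity_eq_integral_toReal_smul (measurable_wt_density s) (by simp)]
  refine setIntegral_congr_fun measurableSet_Ioi fun y hy => ?_
  rw [mem_Ioi] at hy
  simp only [smul_eq_mul]
  rw [ENNReal.toReal_ofReal (by positivity)]

/-- The weighted measure of `(0, R]`. -/
lemma wt_Ioc {s : ℝ} (hs : s < 1) {R : ℝ} (hR : 0 < R) :
    wt s (Ioc 0 R) = ENNReal.ofReal (R ^ (2 - 2 * s) / (2 - 2 * s)) := by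
  have hint : IntegrableOn (fun y : ℝ => y ^ (1 - 2 * s)) (Ioc 0 R) := by
    have := intervalIntegral.intervalIntegrable_rpow' (a := 0) (b := R) (r := 1 - 2 * s)
      (by linarith)
    rwa [intervalIntegrable_iff_integrableOn_Ioc_of_le hR.le] at this
  rw [wt, withDensity_apply _ measurableSet_Ioc, Measure.restrict_restrict measurableSet_Ioc,
    inter_eq_left.2 Ioc_subset_Ioi_self, ← ofReal_integral_eq_lintegral_ofReal hint,
    ← intervalIntegral.integral_of_le hR.le, integral_rpow (Or.inl (by linarith)),
    Real.zero_rpow (by linarith)]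
  · congr 1
    rw [show 1 - 2 * s + 1 = 2 - 2 * s by ring]; ring
  · refine (ae_restrict_mem measurableSet_Ioc).mono fun y hy => ?_
    have := hy.1
    positivity

instance (s : ℝ) [hs : Fact (s ∈ Ioo (0 : ℝ) 1)] : IsFiniteMeasureOnCompacts (wt s) where
  lt_top_of_isCompact K hK := by
    obtain ⟨R, hR⟩ := hK.isBounded.subset_closedBall 0
    have h0 : wt s (Iic 0) = 0 := by
      rw [wt, withDensity_apply _ measurableSet_Iic, Measure.restrict_restrict measurableSet_Iic,
        show Iic (0 : ℝ) ∩ Ioi 0 = ∅ by ext x; simp]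
      simp
    have hsub : K ⊆ Iic 0 ∪ Ioc 0 (|R| + 1) := fun x hx => by
      have h1 := hR hx
      rw [Metric.mem_closedBall, Real.dist_eq, sub_zero] at h1
      rcases le_or_gt x 0 with h | h
      · exact Or.inl h
      · exact Or.inr ⟨h, by linarith [le_abs_self x, le_abs_self R]⟩
    calc wt s K ≤ wt s (Iic 0 ∪ Ioc 0 (|R| + 1)) := measure_mono hsub
      _ ≤ wt s (Iic 0) + wt s (Ioc 0 (|R| + 1)) := measure_union_le _ _
      _ < ⊤ := by rw [h0, zero_add, wt_Ioc hs.out.2 (by positivity)]; exact ENNReal.ofReal_lt_top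

instance (Ω : Set (Rd d)) (s : ℝ) : SFinite (cylMeasure Ω s) := by
  rw [cylMeasure_eq]; infer_instance

instance (Ω : Set (Rd d)) (s : ℝ) [Fact (s ∈ Ioo (0 : ℝ) 1)] :
    IsFiniteMeasureOnCompacts (cylMeasure Ω s) := by
  rw [cylMeasure_eq]; infer_instance

/-! ### Smooth functions on the cylinder and their jets -/

/-- The `i`-th unit vector of `ℝ^d`. -/
abbrev ei (i : Fin d) : Rd d := EuclideanSpace.single i (1 : ℝ)

lemma gradient_apply (u : Rd d → ℝ) (x : Rd d) (i : Fin d) :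
    gradient u x i = fderiv ℝ u x (ei i) := by
  have h : inner ℝ (gradient u x) (ei i) = fderiv ℝ u x (ei i) := by
    rw [gradient, InnerProductSpace.toDual_symm_apply]
  rw [← h, EuclideanSpace.inner_single_right]
  simp

lemma extGrad_fst {ψ : Rd d × ℝ → ℝ} (hψ : Differentiable ℝ ψ) (p : Rd d × ℝ) (i : Fin d) :
    (extGrad ψ p).fst i = fderiv ℝ ψ p (ei i, 0) := by
  change gradient (fun x => ψ (x, p.2)) p.1 i = _
  rw [gradient_apply]
  have h1 : HasFDerivAt (fun x : Rd d => (x, p.2)) (ContinuousLinearMap.inl ℝ (Rd d) ℝ) p.1 :=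
    hasFDerivAt_prodMk_left p.1 p.2
  have h2 := (hψ p).hasFDerivAt.comp p.1 h1
  have h3 : fderiv ℝ (fun x => ψ (x, p.2)) p.1 = _ := h2.fderiv
  rw [h3]; simp

lemma extGrad_snd {ψ : Rd d × ℝ → ℝ} (hψ : Differentiable ℝ ψ) (p : Rd d × ℝ) :
    (extGrad ψ p).snd = fderiv ℝ ψ p (0, 1) := by
  change deriv (fun y => ψ (p.1, y)) p.2 = _
  have h1 : HasFDerivAt (fun y : ℝ => (p.1, y)) (ContinuousLinearMap.inr ℝ (Rd d) ℝ) p.2 :=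
    hasFDerivAt_prodMk_right p.1 p.2
  have h2 := (hψ p).hasFDerivAt.comp p.2 h1
  have h3 : fderiv ℝ (fun y => ψ (p.1, y)) p.2 = _ := h2.fderiv
  rw [← fderiv_apply_one_eq_deriv, h3]; simp

/-- The linear map that reads off the gradient of a function on `ℝ^d × ℝ` from its derivative. -/
def gradOfDeriv : ((Rd d × ℝ) →L[ℝ] ℝ) →L[ℝ] ExtVec d :=
  ((WithLp.prodContinuousLinearEquiv 2 ℝ (Rd d) ℝ).symm : Rd d × ℝ →L[ℝ] ExtVec d).comp
    ((((EuclideanSpace.equiv (Fin d) ℝ).symm : (Fin d → ℝ) →L[ℝ] Rd d).comp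
      (ContinuousLinearMap.pi fun i => ContinuousLinearMap.apply ℝ ℝ ((ei i, 0) : Rd d × ℝ))).prod
      (ContinuousLinearMap.apply ℝ ℝ ((0, 1) : Rd d × ℝ)))

lemma extGrad_eq {ψ : Rd d × ℝ → ℝ} (hψ : Differentiable ℝ ψ) :
    extGrad ψ = fun p => gradOfDeriv (fderiv ℝ ψ p) := by
  funext p
  refine (WithLp.equiv 2 _).injective (Prod.ext ?_ ?_)
  · ext i; exact extGrad_fst hψ p i
  · exact extGrad_snd hψ p

lemma gradient_eq_of {u : Rd d → ℝ} :
    gradient u = fun x => (InnerProductSpace.toDual ℝ (Rd d)).symm (fderiv ℝ u x) := rfl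

/-- The space `C_c^∞(Ω)`. -/
def Tests (Ω : Set (Rd d)) : Submodule ℝ (Rd d → ℝ) where
  carrier := {φ | IsTest Ω φ}
  zero_mem' := ⟨contDiff_const, HasCompactSupport.zero, by simp [tsupport]⟩
  add_mem' {u v} hu hv := ⟨hu.1.add hv.1, hu.2.1.add hv.2.1,
    (tsupport_add u v).trans (union_subset hu.2.2 hv.2.2)⟩
  smul_mem' c u hu := ⟨hu.1.const_smul c, hu.2.1.smul_left (f := fun _ => c),
    (tsupport_smul_subset_right (fun _ => c) u).trans hu.2.2⟩

/-- Smooth compactly supported functions that vanish near the lateral boundary of the cylinder. -/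
def CylTests (Ω : Set (Rd d)) : Submodule ℝ (Rd d × ℝ → ℝ) where
  carrier := {φ | IsCylTest Ω φ}
  zero_mem' := ⟨contDiff_const, HasCompactSupport.zero, by simp [tsupport]⟩
  add_mem' {u v} hu hv := ⟨hu.1.add hv.1, hu.2.1.add hv.2.1,
    (tsupport_add u v).trans (union_subset hu.2.2 hv.2.2)⟩
  smul_mem' c u hu := ⟨hu.1.const_smul c, hu.2.1.smul_left (f := fun _ => c),
    (tsupport_smul_subset_right (fun _ => c) u).trans hu.2.2⟩

variable {Ω : Set (Rd d)} {s : ℝ}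

lemma IsTest.diff {φ : Rd d → ℝ} (hφ : IsTest Ω φ) : Differentiable ℝ φ :=
  hφ.1.differentiable (by simp)

lemma IsCylTest.diff {ψ : Rd d × ℝ → ℝ} (hψ : IsCylTest Ω ψ) : Differentiable ℝ ψ :=
  hψ.1.differentiable (by simp)

lemma IsTest.continuous_fderiv {φ : Rd d → ℝ} (hφ : IsTest Ω φ) : Continuous (fderiv ℝ φ) :=
  hφ.1.continuous_fderiv (by simp)

lemma IsCylTest.continuous_fderiv {ψ : Rd d × ℝ → ℝ} (hψ : IsCylTest Ω ψ) :
    Continuous (fderiv ℝ ψ) :=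
  hψ.1.continuous_fderiv (by simp)

lemma IsTest.memLp {φ : Rd d → ℝ} (hφ : IsTest Ω φ) (p : ℝ≥0∞) (m : Measure (Rd d))
    [IsFiniteMeasureOnCompacts m] :
    MemLp φ p m :=
  hφ.diff.continuous.memLp_of_hasCompactSupport hφ.2.1

lemma IsTest.memLp_gradient {φ : Rd d → ℝ} (hφ : IsTest Ω φ) (p : ℝ≥0∞) (m : Measure (Rd d))
    [IsFiniteMeasureOnCompacts m] : MemLp (gradient φ) p m := by
  refine Continuous.memLp_of_hasCompactSupport ?_ ?_
  · exact (LinearIsometryEquiv.continuous _).comp hφ.continuous_fderiv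
  · exact (hφ.2.1.fderiv ℝ).comp_left (map_zero _)

lemma IsTest.memLp_deriv {φ : Rd d → ℝ} (hφ : IsTest Ω φ) (v : Rd d) (p : ℝ≥0∞) (m : Measure (Rd d))
    [IsFiniteMeasureOnCompacts m] : MemLp (fun x => fderiv ℝ φ x v) p m :=
  Continuous.memLp_of_hasCompactSupport (hφ.continuous_fderiv.clm_apply continuous_const)
    ((hφ.2.1.fderiv ℝ).comp_left (g := fun l : Rd d →L[ℝ] ℝ => l v) rfl)

lemma IsCylTest.memLp {ψ : Rd d × ℝ → ℝ} (hψ : IsCylTest Ω ψ) (p : ℝ≥0∞) (m : Measure (Rd d × ℝ))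
    [IsFiniteMeasureOnCompacts m] : MemLp ψ p m :=
  hψ.diff.continuous.memLp_of_hasCompactSupport hψ.2.1

lemma IsCylTest.memLp_deriv {ψ : Rd d × ℝ → ℝ} (hψ : IsCylTest Ω ψ) (v : Rd d × ℝ) (p : ℝ≥0∞)
    (m : Measure (Rd d × ℝ)) [IsFiniteMeasureOnCompacts m] : MemLp (fun x => fderiv ℝ ψ x v) p m :=
  Continuous.memLp_of_hasCompactSupport (hψ.continuous_fderiv.clm_apply continuous_const)
    ((hψ.2.1.fderiv ℝ).comp_left (g := fun l : Rd d × ℝ →L[ℝ] ℝ => l v) rfl)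

lemma IsCylTest.memLp_extGrad {ψ : Rd d × ℝ → ℝ} (hψ : IsCylTest Ω ψ) (p : ℝ≥0∞)
    (m : Measure (Rd d × ℝ)) [IsFiniteMeasureOnCompacts m] : MemLp (extGrad ψ) p m := by
  rw [extGrad_eq hψ.diff]
  exact Continuous.memLp_of_hasCompactSupport
    (gradOfDeriv.continuous.comp hψ.continuous_fderiv)
    ((hψ.2.1.fderiv ℝ).comp_left (map_zero gradOfDeriv))

lemma hasCompactSupport_slice {ψ : Rd d × ℝ → ℝ} (h : HasCompactSupport ψ) (y : ℝ) :
    HasCompactSupport fun x => ψ (x, y) :=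
  HasCompactSupport.of_support_subset_isCompact (h.image continuous_fst) fun x hx =>
    ⟨(x, y), subset_tsupport _ hx, rfl⟩

lemma hasCompactSupport_slice' {ψ : Rd d × ℝ → ℝ} (h : HasCompactSupport ψ) (x : Rd d) :
    HasCompactSupport fun y => ψ (x, y) :=
  HasCompactSupport.of_support_subset_isCompact (h.image continuous_snd) fun y hy =>
    ⟨(x, y), subset_tsupport _ hy, rfl⟩

/-- The horizontal slice `ψ(·, y)` of a test function on the cylinder is a test function on `Ω`. -/
def CylTests.slice (ψ : CylTests Ω) (y : ℝ) : Tests Ω :=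
  ⟨fun x => ψ.1 (x, y), ψ.2.1.comp (contDiff_id.prodMk contDiff_const),
    hasCompactSupport_slice ψ.2.2.1 y, by
      have hsub : tsupport (fun x => ψ.1 (x, y)) ⊆ (fun x => (x, y)) ⁻¹' tsupport ψ.1 :=
        closure_minimal (fun x hx => subset_tsupport _ hx)
          ((isClosed_tsupport _).preimage (by fun_prop))
      exact fun x hx => (ψ.2.2.2 (hsub hx)).1⟩

/-- The gradient, as a linear map on test functions. -/
def gradLin (Ω : Set (Rd d)) : Tests Ω →ₗ[ℝ] (Rd d → Rd d) where
  toFun φ := gradient φ.1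
  map_add' u v := by
    funext x
    simp only [gradient_eq_of, Pi.add_apply, Submodule.coe_add]
    rw [fderiv_add (IsTest.diff u.2 x) (IsTest.diff v.2 x), map_add]
  map_smul' c u := by
    funext x
    simp only [gradient_eq_of, Pi.smul_apply, Submodule.coe_smul]
    rw [fderiv_const_smul (IsTest.diff u.2 x), map_smulₛₗ]
    rfl

/-- The gradient in `ℝ^{d+1}`, as a linear map on test functions. -/
def extGradLin (Ω : Set (Rd d)) : CylTests Ω →ₗ[ℝ] (Rd d × ℝ → ExtVec d) where
  toFun ψ := extGrad ψ.1
  map_add' u v := by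
    rw [extGrad_eq (IsCylTest.diff (u + v).2), extGrad_eq (IsCylTest.diff u.2),
      extGrad_eq (IsCylTest.diff v.2)]
    funext x
    simp only [Pi.add_apply, Submodule.coe_add]
    rw [fderiv_add (IsCylTest.diff u.2 x) (IsCylTest.diff v.2 x), map_add]
  map_smul' c u := by
    rw [extGrad_eq (IsCylTest.diff (c • u).2), extGrad_eq (IsCylTest.diff u.2)]
    funext x
    simp only [Pi.smul_apply, Submodule.coe_smul]
    rw [fderiv_const_smul (IsCylTest.diff u.2 x), map_smul]
    rfl

/-- The pair `(φ, ∇φ)`. -/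
def jet (Ω : Set (Rd d)) : Tests Ω →ₗ[ℝ] Jet Ω :=
  (WithLp.linearEquiv 2 ℝ (L2 Ω × Lp (Rd d) 2 (volume.restrict Ω))).symm.toLinearMap ∘ₗ
    (toL2 (Tests Ω).subtype fun φ => IsTest.memLp φ.2 2 _).prod
      (toL2 (gradLin Ω) fun φ => IsTest.memLp_gradient φ.2 2 _)

lemma jet_fst (φ : Tests Ω) : (jet Ω φ).fst =ᵐ[volume.restrict Ω] φ.1 := coeFn_toL2 _ _ φ

lemma jet_snd (φ : Tests Ω) : (jet Ω φ).snd =ᵐ[volume.restrict Ω] gradient φ.1 :=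
  coeFn_toL2 _ _ φ

variable [hs : Fact (s ∈ Ioo (0 : ℝ) 1)]

/-- The pair `(ψ, ∇ψ)`. -/
def cylJet (Ω : Set (Rd d)) (s : ℝ) [hs : Fact (s ∈ Ioo (0 : ℝ) 1)] :
    CylTests Ω →ₗ[ℝ] CylJet Ω s :=
  (WithLp.linearEquiv 2 ℝ
    (Lp ℝ 2 (cylMeasure Ω s) × Lp (ExtVec d) 2 (cylMeasure Ω s))).symm.toLinearMap ∘ₗ
    (toL2 (CylTests Ω).subtype fun φ => IsCylTest.memLp φ.2 2 _).prod
      (toL2 (extGradLin Ω) fun φ => IsCylTest.memLp_extGrad φ.2 2 _)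

lemma isJetOf_cylJet (ψ : CylTests Ω) : IsJetOf Ω s (cylJet Ω s ψ) ψ.1 :=
  ⟨coeFn_toL2 _ _ ψ, coeFn_toL2 _ _ ψ⟩

lemma eq_cylJet {W : CylJet Ω s} {ψ : CylTests Ω} (h : IsJetOf Ω s W ψ.1) : W = cylJet Ω s ψ :=
  (WithLp.equiv 2 _).injective (Prod.ext
    (Lp.ext (h.1.trans (isJetOf_cylJet ψ).1.symm)) (Lp.ext (h.2.trans (isJetOf_cylJet ψ).2.symm)))

lemma eq_jet {U : Jet Ω} {φ : Tests Ω} (h1 : U.fst =ᵐ[volume.restrict Ω] φ.1)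
    (h2 : U.snd =ᵐ[volume.restrict Ω] gradient φ.1) : U = jet Ω φ :=
  (WithLp.equiv 2 _).injective (Prod.ext
    (Lp.ext (h1.trans (jet_fst φ).symm)) (Lp.ext (h2.trans (jet_snd φ).symm)))

lemma H01_eq : H01 Ω = (LinearMap.range (jet Ω)).topologicalClosure := by
  rw [H01]
  congr 1
  refine le_antisymm (Submodule.span_le.2 ?_) ?_
  · rintro U ⟨φ, hφ, h1, h2⟩
    exact ⟨⟨φ, hφ⟩, (eq_jet (φ := ⟨φ, hφ⟩) h1 h2).symm⟩
  · rintro _ ⟨φ, rfl⟩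
    exact Submodule.subset_span ⟨φ.1, φ.2, jet_fst φ, jet_snd φ⟩

lemma HL_eq : HL Ω s = (LinearMap.range (cylJet Ω s)).topologicalClosure := by
  rw [HL]
  congr 1
  refine le_antisymm (Submodule.span_le.2 ?_) ?_
  · rintro U ⟨φ, hφ, h⟩
    exact ⟨⟨φ, hφ⟩, (eq_cylJet (ψ := ⟨φ, hφ⟩) h).symm⟩
  · rintro _ ⟨φ, rfl⟩
    exact Submodule.subset_span ⟨φ.1, φ.2, isJetOf_cylJet φ⟩

lemma jet_mem (φ : Tests Ω) : jet Ω φ ∈ H01 Ω := by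
  rw [H01_eq]
  exact Submodule.le_topologicalClosure _ ⟨φ, rfl⟩

lemma cylJet_mem (ψ : CylTests Ω) : cylJet Ω s ψ ∈ HL Ω s := by
  rw [HL_eq]
  exact Submodule.le_topologicalClosure _ ⟨ψ, rfl⟩

/-- The pair `(ψ, ∇ψ)` as an element of the energy space. -/
def hlJet (Ω : Set (Rd d)) (s : ℝ) [hs : Fact (s ∈ Ioo (0 : ℝ) 1)] :
    CylTests Ω →ₗ[ℝ] HL Ω s :=
  (cylJet Ω s).codRestrict _ cylJet_mem

lemma denseRange_hlJet : DenseRange (hlJet Ω s) := by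
  rintro ⟨W, hWL⟩
  have hW : W ∈ closure (LinearMap.range (cylJet Ω s) : Set (CylJet Ω s)) := by
    have := hWL
    rw [HL_eq] at this
    exact this
  rw [closure_subtype]
  refine closure_mono ?_ hW
  rintro _ ⟨ψ, rfl⟩
  exact ⟨hlJet Ω s ψ, ⟨ψ, rfl⟩, rfl⟩

instance : CompleteSpace (HL Ω s) := by
  rw [HL]; infer_instance

/-- A closed condition on `H₀¹(Ω)` need only be checked on test functions. -/
lemma H01_induction {P : Jet Ω → Prop} (hP : IsClosed {U | P U}) (h : ∀ φ, P (jet Ω φ))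
    {U : Jet Ω} (hU : U ∈ H01 Ω) : P U := by
  rw [H01_eq] at hU
  refine closure_minimal (t := {U | P U}) ?_ hP hU
  rintro _ ⟨φ, rfl⟩
  exact h φ

end

/-! ### The energy forms as bounded bilinear forms -/

section

variable {d : ℕ} {Ω : Set (Rd d)} {s : ℝ}

/-- The function of an element `(u, ∇u)`. -/
def jFn (Ω : Set (Rd d)) : Jet Ω →L[ℝ] L2 Ω := WithLp.fstL 2 ℝ _ _

/-- The partial derivative `∂_i u` of an element `(u, ∇u)`. -/
def jDx (Ω : Set (Rd d)) (i : Fin d) : Jet Ω →L[ℝ] L2 Ω :=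
  ((EuclideanSpace.proj i : Rd d →L[ℝ] ℝ).compLpL 2 (volume.restrict Ω)).comp (WithLp.sndL 2 ℝ _ _)

/-- The function of an element `(w, ∇w)` on the cylinder. -/
def cFn (Ω : Set (Rd d)) (s : ℝ) : CylJet Ω s →L[ℝ] Lp ℝ 2 (cylMeasure Ω s) :=
  WithLp.fstL 2 ℝ _ _

/-- The horizontal partial derivative `∂_i w` of an element `(w, ∇w)` on the cylinder. -/
def cDx (Ω : Set (Rd d)) (s : ℝ) (i : Fin d) : CylJet Ω s →L[ℝ] Lp ℝ 2 (cylMeasure Ω s) :=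
  (((EuclideanSpace.proj i : Rd d →L[ℝ] ℝ).comp (WithLp.fstL 2 ℝ (Rd d) ℝ)).compLpL 2
    (cylMeasure Ω s)).comp (WithLp.sndL 2 ℝ _ _)

/-- The vertical derivative `∂_y w` of an element `(w, ∇w)` on the cylinder. -/
def cDy (Ω : Set (Rd d)) (s : ℝ) : CylJet Ω s →L[ℝ] Lp ℝ 2 (cylMeasure Ω s) :=
  ((WithLp.sndL 2 ℝ (Rd d) ℝ).compLpL 2 (cylMeasure Ω s)).comp (WithLp.sndL 2 ℝ _ _)

lemma coeFn_jDx (i : Fin d) (U : Jet Ω) :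
    jDx Ω i U =ᵐ[volume.restrict Ω] fun x => U.snd x i :=
  ContinuousLinearMap.coeFn_compLpL _ _

lemma coeFn_cDx (i : Fin d) (W : CylJet Ω s) :
    cDx Ω s i W =ᵐ[cylMeasure Ω s] fun p => (W.snd p).fst i :=
  ContinuousLinearMap.coeFn_compLpL _ _

lemma coeFn_cDy (W : CylJet Ω s) : cDy Ω s W =ᵐ[cylMeasure Ω s] fun p => (W.snd p).snd :=
  ContinuousLinearMap.coeFn_compLpL _ _

lemma memLp_one {X : Type*} [MeasurableSpace X] (m : Measure X) :
    MemLp (fun _ : X => (1 : ℝ)) ⊤ m := memLp_top_const 1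

lemma ae_cyl {p : Rd d → Prop} (h : ∀ᵐ x ∂(volume.restrict Ω), p x) :
    ∀ᵐ x ∂(cylMeasure Ω s), p x.1 := Measure.quasiMeasurePreserving_fst.ae h

lemma memLp_top_cyl {b : Rd d → ℝ} (hb : MemLp b ⊤ (volume.restrict Ω)) :
    MemLp (fun p : Rd d × ℝ => b p.1) ⊤ (cylMeasure Ω s) := memLp_top_comp_fst hb

/-- The Dirichlet form of `-div(A∇·) + q` on `Ω`, as a bounded bilinear form. -/
def omForm {A : Rd d → Matrix (Fin d) (Fin d) ℝ} {a₀ : ℝ} (hA : IsDiffusion Ω a₀ A)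
    {q : L2 Ω} (hq : MemLp q ⊤ (volume.restrict Ω)) : Jet Ω →L[ℝ] Jet Ω →L[ℝ] ℝ :=
  (∑ i, ∑ j, (mulForm _ (hA.memLp i j)).bilinearComp (jDx Ω j) (jDx Ω i)) +
    (mulForm q hq).bilinearComp (jFn Ω) (jFn Ω)

/-- The energy form on the cylinder, as a bounded bilinear form. -/
def cylForm (s : ℝ) {A : Rd d → Matrix (Fin d) (Fin d) ℝ} {a₀ : ℝ} (hA : IsDiffusion Ω a₀ A)
    {q : L2 Ω} (hq : MemLp q ⊤ (volume.restrict Ω)) : CylJet Ω s →L[ℝ] CylJet Ω s →L[ℝ] ℝ :=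
  (∑ i, ∑ j, (mulForm _ (memLp_top_cyl (hA.memLp i j))).bilinearComp (cDx Ω s j) (cDx Ω s i)) +
    (mulForm _ (memLp_one _)).bilinearComp (cDy Ω s) (cDy Ω s) +
    (mulForm _ (memLp_top_cyl hq)).bilinearComp (cFn Ω s) (cFn Ω s)

section

variable {A : Rd d → Matrix (Fin d) (Fin d) ℝ} {a₀ : ℝ} (hA : IsDiffusion Ω a₀ A)
    {q : L2 Ω} (hq : MemLp q ⊤ (volume.restrict Ω))

include hA in
lemma integrable_mul_jDx (U V : Jet Ω) (i j : Fin d) :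
    Integrable (fun x => A x i j * U.snd x j * V.snd x i) (volume.restrict Ω) := by
  refine (integrable_mul_mul (hA.memLp i j) (Lp.memLp (jDx Ω j U)) (Lp.memLp (jDx Ω i V))).congr ?_
  filter_upwards [coeFn_jDx j U, coeFn_jDx i V] with x h1 h2
  rw [h1, h2]

include hA in
lemma integrable_mul_cDx (U V : CylJet Ω s) (i j : Fin d) :
    Integrable (fun p => A p.1 i j * (U.snd p).fst j * (V.snd p).fst i) (cylMeasure Ω s) := by
  refine (integrable_mul_mul (memLp_top_cyl (hA.memLp i j)) (Lp.memLp (cDx Ω s j U))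
    (Lp.memLp (cDx Ω s i V))).congr ?_
  filter_upwards [coeFn_cDx j U, coeFn_cDx i V] with x h1 h2
  rw [h1, h2]

include hA in
lemma integrable_matForm (U V : Jet Ω) :
    Integrable (fun x => matForm (A x) (U.snd x) (V.snd x)) (volume.restrict Ω) :=
  integrable_finsetSum _ fun i _ => integrable_finsetSum _ fun j _ => integrable_mul_jDx hA U V i j

include hA in
lemma integrable_matForm_cyl (U V : CylJet Ω s) :
    Integrable (fun p => matForm (A p.1) (U.snd p).fst (V.snd p).fst) (cylMeasure Ω s) :=
  integrable_finsetSum _ fun i _ => integrable_finsetSum _ fun j _ => integrable_mul_cDx hA U V i j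

lemma integrable_dy_cyl (U V : CylJet Ω s) :
    Integrable (fun p => (U.snd p).snd * (V.snd p).snd) (cylMeasure Ω s) := by
  refine ((Lp.memLp (cDy Ω s U)).integrable_mul (Lp.memLp (cDy Ω s V))).congr ?_
  filter_upwards [coeFn_cDy U, coeFn_cDy V] with x h1 h2
  simp only [Pi.mul_apply, h1, h2]

lemma omForm_apply (U V : Jet Ω) : omForm hA hq U V = aOmega Ω A q U V := by
  have h0 : Integrable (fun x => q x * U.fst x * V.fst x) (volume.restrict Ω) :=
    integrable_mul_mul hq (Lp.memLp U.fst) (Lp.memLp V.fst)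
  rw [aOmega, integral_add (integrable_matForm hA U V) h0]
  simp only [omForm, add_apply, sum_apply,
    ContinuousLinearMap.bilinearComp_apply, mulForm_apply]
  congr 1
  unfold matForm
  rw [integral_finsetSum _ fun i _ => integrable_finsetSum _ fun j _ => integrable_mul_jDx hA U V i j]
  refine Finset.sum_congr rfl fun i _ => ?_
  rw [integral_finsetSum _ fun j _ => integrable_mul_jDx hA U V i j]
  refine Finset.sum_congr rfl fun j _ => integral_congr_ae ?_
  filter_upwards [coeFn_jDx j U, coeFn_jDx i V] with x h1 h2
  rw [h1, h2]

lemma cylForm_eq (U V : CylJet Ω s) : cylForm s hA hq U V =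
    ∫ p, (matForm (A p.1) (U.snd p).fst (V.snd p).fst + (U.snd p).snd * (V.snd p).snd
      + q p.1 * U.fst p * V.fst p) ∂(cylMeasure Ω s) := by
  have h0 : Integrable (fun p => q p.1 * U.fst p * V.fst p) (cylMeasure Ω s) :=
    integrable_mul_mul (memLp_top_cyl hq) (Lp.memLp U.fst) (Lp.memLp V.fst)
  rw [integral_add (by exact (integrable_matForm_cyl hA U V).add (integrable_dy_cyl U V)) h0,
    integral_add (integrable_matForm_cyl hA U V) (integrable_dy_cyl U V)]
  simp only [cylForm, add_apply, sum_apply,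
    ContinuousLinearMap.bilinearComp_apply, mulForm_apply]
  congr 1
  congr 1
  · unfold matForm
    rw [integral_finsetSum _ fun i _ =>
      integrable_finsetSum _ fun j _ => integrable_mul_cDx hA U V i j]
    refine Finset.sum_congr rfl fun i _ => ?_
    rw [integral_finsetSum _ fun j _ => integrable_mul_cDx hA U V i j]
    refine Finset.sum_congr rfl fun j _ => integral_congr_ae ?_
    filter_upwards [coeFn_cDx j U, coeFn_cDx i V] with x h1 h2
    rw [h1, h2]
  · refine integral_congr_ae ?_
    filter_upwards [coeFn_cDy U, coeFn_cDy V] with x h1 h2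
    rw [h1, h2, one_mul]

lemma cylForm_apply (U V : HL Ω s) : cylForm s hA hq (U : CylJet Ω s) V = aCyl Ω s A q U V :=
  cylForm_eq hA hq _ _

lemma matForm_comm {M : Matrix (Fin d) (Fin d) ℝ} (hM : M.IsSymm) (ξ η : Rd d) :
    matForm M ξ η = matForm M η ξ := by
  unfold matForm
  rw [Finset.sum_comm]
  refine Finset.sum_congr rfl fun i _ => Finset.sum_congr rfl fun j _ => ?_
  rw [hM.apply i j]; ring

lemma omForm_comm (U V : Jet Ω) : omForm hA hq U V = omForm hA hq V U := by
  rw [omForm_apply, omForm_apply, aOmega, aOmega]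
  refine integral_congr_ae ?_
  filter_upwards [hA.symm] with x hx
  rw [matForm_comm hx]; ring

lemma omForm_ge (hq0 : ∀ᵐ x ∂(volume.restrict Ω), 0 ≤ q x) (U : Jet Ω) :
    a₀ * ‖U.snd‖ ^ 2 ≤ omForm hA hq U U := by
  have h0 : Integrable (fun x => q x * U.fst x * U.fst x) (volume.restrict Ω) :=
    integrable_mul_mul hq (Lp.memLp U.fst) (Lp.memLp U.fst)
  rw [omForm_apply, aOmega, norm_sq_Lp, ← integral_const_mul]
  refine integral_mono_ae ((integrable_norm_sq_Lp _).const_mul _)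
    ((integrable_matForm hA U U).add h0) ?_
  filter_upwards [hA.elliptic, hq0] with x hx h2
  have := hx (U.snd x)
  have h3 : 0 ≤ q x * U.fst x * U.fst x := by
    rw [mul_assoc]; exact mul_nonneg h2 (mul_self_nonneg _)
  linarith

lemma cylForm_ge (hq0 : ∀ᵐ x ∂(volume.restrict Ω), 0 ≤ q x) (U : CylJet Ω s) :
    min a₀ 1 * ‖U.snd‖ ^ 2 ≤ cylForm s hA hq U U := by
  have h0 : Integrable (fun p => q p.1 * U.fst p * U.fst p) (cylMeasure Ω s) :=
    integrable_mul_mul (memLp_top_cyl hq) (Lp.memLp U.fst) (Lp.memLp U.fst)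
  rw [cylForm_eq, norm_sq_Lp, ← integral_const_mul]
  refine integral_mono_ae ((integrable_norm_sq_Lp _).const_mul _)
    (((integrable_matForm_cyl hA U U).add (integrable_dy_cyl U U)).add h0) ?_
  filter_upwards [ae_cyl hA.elliptic, ae_cyl hq0] with p hx h2
  have h1 := hx (U.snd p).fst
  have h3 : 0 ≤ q p.1 * U.fst p * U.fst p := by
    rw [mul_assoc]; exact mul_nonneg h2 (mul_self_nonneg _)
  have h4 : ‖U.snd p‖ ^ 2 = ‖(U.snd p).fst‖ ^ 2 + (U.snd p).snd ^ 2 := by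
    rw [WithLp.prod_norm_sq_eq_of_L2, Real.norm_eq_abs, sq_abs]
  have h5 : min a₀ 1 * ‖(U.snd p).fst‖ ^ 2 ≤ a₀ * ‖(U.snd p).fst‖ ^ 2 :=
    mul_le_mul_of_nonneg_right (min_le_left _ _) (sq_nonneg _)
  have h6 : min a₀ 1 * (U.snd p).snd ^ 2 ≤ 1 * (U.snd p).snd ^ 2 :=
    mul_le_mul_of_nonneg_right (min_le_right _ _) (sq_nonneg _)
  rw [h4]; nlinarith

end

end

/-! ### Poincaré inequalities -/

section

variable {d : ℕ} {Ω : Set (Rd d)} {s : ℝ}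

lemma IsTest.sq {φ : Rd d → ℝ} (hφ : IsTest Ω φ) : IsTest Ω (fun x => φ x ^ 2) :=
  ⟨hφ.1.pow 2, hφ.2.1.comp_left (g := fun t : ℝ => t ^ 2) (by simp),
    (closure_mono (s := Function.support fun x => φ x ^ 2) (t := Function.support φ)
      fun x hx h => hx (by simp [h])).trans hφ.2.2⟩

lemma IsTest.eq_zero {φ : Rd d → ℝ} (hφ : IsTest Ω φ) {x : Rd d} (hx : x ∉ Ω) : φ x = 0 :=
  image_eq_zero_of_notMem_tsupport fun h => hx (hφ.2.2 h)

lemma IsTest.fderiv_eq_zero {φ : Rd d → ℝ} (hφ : IsTest Ω φ) {x : Rd d} (hx : x ∉ Ω) :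
    fderiv ℝ φ x = 0 :=
  image_eq_zero_of_notMem_tsupport fun h => hx (hφ.2.2 (tsupport_fderiv_subset ℝ h))

/-- The divergence theorem for test functions. -/
lemma IsTest.integral_fderiv {φ : Rd d → ℝ} (hφ : IsTest Ω φ) (v : Rd d) :
    ∫ x in Ω, fderiv ℝ φ x v = 0 := by
  rw [setIntegral_eq_integral_of_forall_compl_eq_zero fun x hx => by simp [hφ.fderiv_eq_zero hx]]
  have h1 := memLp_one_iff_integrable.1 (hφ.memLp_deriv v 1 (volume : Measure (Rd d)))
  have h2 := memLp_one_iff_integrable.1 (hφ.memLp 1 (volume : Measure (Rd d)))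
  have h := integral_mul_fderiv_eq_neg_fderiv_mul_of_integrable (μ := (volume : Measure (Rd d)))
    (f := fun _ => (1 : ℝ)) (g := φ) (v := v) (by simp) (by simpa using h1) (by simpa using h2)
    (fun _ _ => differentiableAt_const _) (fun x _ => hφ.diff x)
  simpa using h

/-- Poincaré's inequality: integrate `∂_i (x_i φ²)` over a domain contained in a ball. -/
lemma IsTest.poincare {φ : Rd d → ℝ} (hφ : IsTest Ω φ) {R : ℝ}
    (hR : Ω ⊆ Metric.closedBall 0 R) (i : Fin d) :
    ∫ x in Ω, φ x ^ 2 ≤ 4 * R ^ 2 * ∫ x in Ω, fderiv ℝ φ x (ei i) ^ 2 := by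
  have hm1 := hφ.memLp 2 (volume : Measure (Rd d))
  have hm2 := hφ.memLp_deriv (ei i) 2 (volume : Measure (Rd d))
  have hprod : Continuous fun x => φ x * fderiv ℝ φ x (ei i) :=
    hφ.1.continuous.mul (hφ.continuous_fderiv.clm_apply continuous_const)
  have hd : ∀ x, fderiv ℝ (fun x => φ x ^ 2) x (ei i) = 2 * (φ x * fderiv ℝ φ x (ei i)) := by
    intro x
    rw [fderiv_fun_pow 2 (hφ.diff x)]
    simp; ring
  have hcs : HasCompactSupport fun x => φ x * fderiv ℝ φ x (ei i) := hφ.2.1.mul_right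
  have hx : Integrable (fun x : Rd d => x i * fderiv ℝ (fun x => φ x ^ 2) x (ei i)) := by
    simp only [hd]
    refine Continuous.integrable_of_hasCompactSupport (by fun_prop) ?_
    exact (hcs.mul_left (f := fun _ => (2 : ℝ))).mul_left
  have hx2 : Integrable (fun x : Rd d => x i * φ x ^ 2) :=
    Continuous.integrable_of_hasCompactSupport
      ((by fun_prop : Continuous fun x : Rd d => x i).mul (hφ.1.continuous.pow 2)) hφ.sq.2.1.mul_left
  have hpi : ∀ x : Rd d, fderiv ℝ (fun x : Rd d => x i) x (ei i) = 1 := by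
    intro x
    have : fderiv ℝ (fun x : Rd d => x i) x = EuclideanSpace.proj i :=
      (EuclideanSpace.proj i : Rd d →L[ℝ] ℝ).fderiv
    rw [this]; simp
  have key := integral_mul_fderiv_eq_neg_fderiv_mul_of_integrable (μ := (volume : Measure (Rd d)))
    (f := fun x : Rd d => x i) (g := fun x => φ x ^ 2) (v := ei i)
    (by simpa only [hpi, one_mul] using hm1.integrable_sq) hx hx2
    (fun x _ => (EuclideanSpace.proj i : Rd d →L[ℝ] ℝ).differentiableAt)
    (fun x _ => hφ.sq.diff x)
  simp only [hpi, one_mul] at key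
  rw [setIntegral_eq_integral_of_forall_compl_eq_zero fun x hx => by simp [hφ.eq_zero hx],
    setIntegral_eq_integral_of_forall_compl_eq_zero fun x hx => by simp [hφ.fderiv_eq_zero hx]]
  have hle : -∫ x : Rd d, x i * fderiv ℝ (fun x => φ x ^ 2) x (ei i) ≤
      ∫ x : Rd d, (1 / 2 * φ x ^ 2 + 2 * R ^ 2 * fderiv ℝ φ x (ei i) ^ 2) := by
    rw [← integral_neg]
    refine integral_mono hx.neg ((hm1.integrable_sq.const_mul _).add
      (hm2.integrable_sq.const_mul _)) fun x => ?_
    simp only [hd]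
    by_cases hxΩ : x ∈ Ω
    · have h1 : |x i| ≤ R := by
        have := hR hxΩ
        rw [mem_closedBall_zero_iff] at this
        exact (by simpa using PiLp.norm_apply_le x i : |x i| ≤ ‖x‖).trans this
      have h2 : (x i) ^ 2 ≤ R ^ 2 := sq_le_sq' (by linarith [neg_abs_le (x i)])
        ((le_abs_self _).trans h1)
      have h3 := mul_le_mul_of_nonneg_right h2 (sq_nonneg (fderiv ℝ φ x (ei i)))
      nlinarith [sq_nonneg (φ x + 2 * x i * fderiv ℝ φ x (ei i))]
    · simp [hφ.eq_zero hxΩ, hφ.fderiv_eq_zero hxΩ]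
  rw [integral_add (hm1.integrable_sq.const_mul _) (hm2.integrable_sq.const_mul _),
    integral_const_mul, integral_const_mul] at hle
  linarith

lemma norm_jDx_le (i : Fin d) (U : Jet Ω) : ‖jDx Ω i U‖ ≤ ‖U.snd‖ := by
  refine Lp.norm_le_norm_of_ae_le ?_
  filter_upwards [coeFn_jDx i U] with x hx
  rw [hx]
  exact PiLp.norm_apply_le _ _

lemma norm_cDx_le (i : Fin d) (U : CylJet Ω s) : ‖cDx Ω s i U‖ ≤ ‖U.snd‖ := by
  refine Lp.norm_le_norm_of_ae_le ?_
  filter_upwards [coeFn_cDx i U] with x hx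
  rw [hx]
  exact (PiLp.norm_apply_le _ _).trans (WithLp.norm_fst_le _ _)

lemma coeFn_jDx_jet (φ : Tests Ω) (i : Fin d) :
    jDx Ω i (jet Ω φ) =ᵐ[volume.restrict Ω] fun x => fderiv ℝ φ.1 x (ei i) := by
  filter_upwards [coeFn_jDx i (jet Ω φ), jet_snd φ] with x h1 h2
  rw [h1, h2, gradient_apply]

lemma H01_poincare {R : ℝ} (hR0 : 0 ≤ R) (hR : Ω ⊆ Metric.closedBall 0 R) (i : Fin d) {U : Jet Ω}
    (hU : U ∈ H01 Ω) : ‖U.fst‖ ≤ 2 * R * ‖U.snd‖ := by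
  refine (?_ : ‖jFn Ω U‖ ≤ 2 * R * ‖jDx Ω i U‖).trans
    (mul_le_mul_of_nonneg_left (norm_jDx_le i U) (by positivity))
  refine H01_induction (P := fun U => ‖jFn Ω U‖ ≤ 2 * R * ‖jDx Ω i U‖)
    (isClosed_le (by fun_prop) (by fun_prop)) (fun φ => ?_) hU
  refine le_of_sq_le_sq ?_ (by positivity)
  rw [mul_pow, norm_sq_L2_eq, norm_sq_L2_eq]
  have h1 : ∫ x in Ω, (jFn Ω (jet Ω φ)) x ^ 2 = ∫ x in Ω, φ.1 x ^ 2 :=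
    integral_congr_ae ((jet_fst φ).fun_comp (fun t => t ^ 2))
  have h2 : ∫ x in Ω, (jDx Ω i (jet Ω φ)) x ^ 2 = ∫ x in Ω, fderiv ℝ φ.1 x (ei i) ^ 2 :=
    integral_congr_ae ((coeFn_jDx_jet φ i).fun_comp (fun t => t ^ 2))
  rw [h1, h2]
  refine (IsTest.poincare φ.2 hR i).trans (le_of_eq ?_)
  ring

variable [hs : Fact (s ∈ Ioo (0 : ℝ) 1)]

lemma coeFn_cDx_jet (ψ : CylTests Ω) (i : Fin d) :
    cDx Ω s i (cylJet Ω s ψ) =ᵐ[cylMeasure Ω s] fun p => fderiv ℝ ψ.1 p (ei i, 0) := by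
  filter_upwards [coeFn_cDx i (cylJet Ω s ψ), (isJetOf_cylJet ψ).2] with x h1 h2
  rw [h1, h2, extGrad_fst (IsCylTest.diff ψ.2)]

lemma coeFn_cDy_jet (ψ : CylTests Ω) :
    cDy Ω s (cylJet Ω s ψ) =ᵐ[cylMeasure Ω s] fun p => fderiv ℝ ψ.1 p (0, 1) := by
  filter_upwards [coeFn_cDy (cylJet Ω s ψ), (isJetOf_cylJet ψ).2] with x h1 h2
  rw [h1, h2, extGrad_snd (IsCylTest.diff ψ.2)]

lemma coeFn_cFn_jet (ψ : CylTests Ω) : cFn Ω s (cylJet Ω s ψ) =ᵐ[cylMeasure Ω s] ψ.1 :=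
  (isJetOf_cylJet ψ).1

lemma fderiv_slice {ψ : CylTests Ω} (x : Rd d) (y : ℝ) (v : Rd d) :
    fderiv ℝ (CylTests.slice ψ y).1 x v = fderiv ℝ ψ.1 (x, y) (v, 0) := by
  have h1 : HasFDerivAt (fun x : Rd d => (x, y)) (ContinuousLinearMap.inl ℝ (Rd d) ℝ) x :=
    hasFDerivAt_prodMk_left x y
  have h2 := (IsCylTest.diff ψ.2 (x, y)).hasFDerivAt.comp x h1
  have h3 : fderiv ℝ (CylTests.slice ψ y).1 x = _ := h2.fderiv
  rw [h3]; simp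

lemma HL_poincare {R : ℝ} (hR0 : 0 ≤ R) (hR : Ω ⊆ Metric.closedBall 0 R) (i : Fin d)
    (W : HL Ω s) : ‖(W : CylJet Ω s).fst‖ ≤ 2 * R * ‖(W : CylJet Ω s).snd‖ := by
  refine (?_ : ‖cFn Ω s W‖ ≤ 2 * R * ‖cDx Ω s i W‖).trans
    (mul_le_mul_of_nonneg_left (norm_cDx_le i _) (by positivity))
  refine denseRange_hlJet.induction_on (p := fun W : HL Ω s =>
    ‖cFn Ω s W‖ ≤ 2 * R * ‖cDx Ω s i W‖) W (isClosed_le (by fun_prop) (by fun_prop)) fun ψ => ?_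
  change ‖cFn Ω s (cylJet Ω s ψ)‖ ≤ 2 * R * ‖cDx Ω s i (cylJet Ω s ψ)‖
  refine le_of_sq_le_sq ?_ (by positivity)
  rw [mul_pow, norm_sq_L2_eq, norm_sq_L2_eq]
  have h1 : ∫ p, (cFn Ω s (cylJet Ω s ψ)) p ^ 2 ∂(cylMeasure Ω s) =
      ∫ y, (∫ x in Ω, ψ.1 (x, y) ^ 2) ∂(wt s) :=
    (integral_congr_ae ((coeFn_cFn_jet (s := s) ψ).fun_comp (fun t => t ^ 2))).trans
      (integral_prod_symm _ (IsCylTest.memLp ψ.2 2 (cylMeasure Ω s)).integrable_sq)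
  have hint := (IsCylTest.memLp_deriv ψ.2 (ei i, 0) 2 (cylMeasure Ω s)).integrable_sq
  have h2 : ∫ p, (cDx Ω s i (cylJet Ω s ψ)) p ^ 2 ∂(cylMeasure Ω s) =
      ∫ y, (∫ x in Ω, fderiv ℝ ψ.1 (x, y) (ei i, 0) ^ 2) ∂(wt s) :=
    (integral_congr_ae ((coeFn_cDx_jet (s := s) ψ i).fun_comp (fun t => t ^ 2))).trans
      (integral_prod_symm _ hint)
  rw [h1, h2, ← integral_const_mul]
  refine integral_mono
    (IsCylTest.memLp ψ.2 2 (cylMeasure Ω s)).integrable_sq.integral_prod_right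
    (hint.integral_prod_right.const_mul _) fun y => ?_
  have := IsTest.poincare (CylTests.slice ψ y).2 hR i
  simp only [fderiv_slice] at this
  refine this.trans (le_of_eq ?_)
  ring

end

/-! ### The weighted trace inequality on the half-line -/

section

variable {d : ℕ} {Ω : Set (Rd d)} {s : ℝ}

lemma integrableOn_rpow_Ioc {r R : ℝ} (hr : -1 < r) (hR : 0 ≤ R) :
    IntegrableOn (fun y : ℝ => y ^ r) (Ioc 0 R) := by
  rw [← intervalIntegrable_iff_integrableOn_Ioc_of_le hR]
  exact intervalIntegral.intervalIntegrable_rpow' hr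

lemma integral_wt_Ioc_le {g : ℝ → ℝ} (hg : Integrable g (wt s))
    (hg0 : ∀ y, 0 ≤ g y) (t : ℝ) :
    ∫ y in Ioc 0 t, y ^ (1 - 2 * s) * g y ≤ ∫ y, g y ∂(wt s) := by
  rw [integral_wt]
  have hint : IntegrableOn (fun y : ℝ => y ^ (1 - 2 * s) * g y) (Ioi 0) := by
    rw [wt, integrable_withDensity_iff_integrable_smul' (measurable_wt_density s) (by simp)] at hg
    refine hg.congr ((ae_restrict_mem measurableSet_Ioi).mono fun y hy => ?_)
    rw [mem_Ioi] at hy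
    simp only [smul_eq_mul]
    rw [ENNReal.toReal_ofReal (by positivity)]
  refine setIntegral_mono_set hint ?_ Ioc_subset_Ioi_self.eventuallyLE
  refine (ae_restrict_mem measurableSet_Ioi).mono fun y hy => ?_
  rw [mem_Ioi] at hy
  exact mul_nonneg (by positivity) (hg0 y)

/-- The Cauchy–Schwarz inequality for `∫_0^t v'`, with the weight `y^{1-2s}`. -/
lemma sub_sq_le_wt [hs : Fact (s ∈ Ioo (0 : ℝ) 1)] {v v' : ℝ → ℝ} (hv : ∀ y, HasDerivAt v (v' y) y)
    (hc : Continuous v') (hcs : HasCompactSupport v') {t : ℝ} (ht : 0 < t) :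
    (v t - v 0) ^ 2 ≤ t ^ (2 * s) / (2 * s) * ∫ y, v' y ^ 2 ∂(wt s) := by
  obtain ⟨hs0, hs1⟩ := hs.out
  have hFTC : ∫ y in Ioc 0 t, v' y = v t - v 0 := by
    rw [← intervalIntegral.integral_of_le ht.le]
    exact intervalIntegral.integral_eq_sub_of_hasDerivAt (fun y _ => hv y)
      (hc.intervalIntegrable _ _)
  set α := 1 - 2 * s with hα
  have hsq : ∀ r : ℝ, ∀ y ∈ Ioc 0 t, (y ^ (r / 2)) ^ 2 = y ^ r := fun r y hy => by
    rw [← Real.rpow_natCast, ← Real.rpow_mul hy.1.le]; norm_num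
  have hm : ∀ r : ℝ, AEStronglyMeasurable (fun y : ℝ => y ^ (r / 2)) (volume.restrict (Ioc 0 t)) :=
    fun r => (by fun_prop : Measurable fun y : ℝ => y ^ (r / 2)).aestronglyMeasurable
  have hu : MemLp (fun y : ℝ => y ^ (-α / 2)) 2 (volume.restrict (Ioc 0 t)) := by
    rw [memLp_two_iff_integrable_sq (hm _)]
    exact (integrableOn_rpow_Ioc (r := -α) (by linarith) ht.le).congr
      ((ae_restrict_mem measurableSet_Ioc).mono fun y hy => (hsq _ y hy).symm)
  have hw0 : MemLp (fun y : ℝ => y ^ (α / 2)) 2 (volume.restrict (Ioc 0 t)) := by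
    rw [memLp_two_iff_integrable_sq (hm _)]
    exact (integrableOn_rpow_Ioc (r := α) (by linarith) ht.le).congr
      ((ae_restrict_mem measurableSet_Ioc).mono fun y hy => (hsq _ y hy).symm)
  have hw : MemLp (fun y : ℝ => v' y * y ^ (α / 2)) 2 (volume.restrict (Ioc 0 t)) :=
    hw0.mul' (hc.memLp_top_of_hasCompactSupport hcs _)
  have key := integral_mul_sq_le hu hw
  have e1 : ∫ y in Ioc 0 t, y ^ (-α / 2) * (v' y * y ^ (α / 2)) = v t - v 0 := by
    rw [← hFTC]
    refine setIntegral_congr_fun measurableSet_Ioc fun y hy => ?_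
    rw [mul_left_comm, ← Real.rpow_add hy.1]
    simp [neg_div]
  have e2 : ∫ y in Ioc 0 t, (y ^ (-α / 2)) ^ 2 = t ^ (2 * s) / (2 * s) := by
    rw [setIntegral_congr_fun measurableSet_Ioc (hsq (-α)), ← intervalIntegral.integral_of_le ht.le,
      integral_rpow (Or.inl (by linarith)), Real.zero_rpow (by linarith)]
    rw [show -α + 1 = 2 * s by rw [hα]; ring, sub_zero]
  have e3 : ∫ y in Ioc 0 t, (v' y * y ^ (α / 2)) ^ 2 ≤ ∫ y, v' y ^ 2 ∂(wt s) := by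
    refine le_trans (le_of_eq ?_) (integral_wt_Ioc_le (t := t) ?_ fun y => sq_nonneg (v' y))
    · refine setIntegral_congr_fun measurableSet_Ioc fun y hy => ?_
      change (v' y * y ^ (α / 2)) ^ 2 = y ^ α * v' y ^ 2
      rw [mul_pow, hsq α y hy, mul_comm]
    · exact (hc.memLp_of_hasCompactSupport (p := 2) hcs).integrable_sq
  rw [e1, e2] at key
  exact key.trans (mul_le_mul_of_nonneg_left e3 (by positivity))

/-- The trace inequality `λ^s v(0)² ≤ C_s ∫_0^∞ y^{1-2s} (v'² + λ v²)`: the powers of `λ` come from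
averaging `v(0)² ≤ 2 v(t)² + 2 (v(t) - v(0))²` over `0 < t ≤ λ^{-1/2}`. -/
lemma trace_half_line [hs : Fact (s ∈ Ioo (0 : ℝ) 1)] {v v' : ℝ → ℝ}
    (hv : ∀ y, HasDerivAt v (v' y) y) (hc : Continuous v') (hcs : HasCompactSupport v)
    {lam : ℝ} (hlam : 0 < lam) :
    lam ^ s * v 0 ^ 2 ≤ (4 + 1 / s) * ∫ y, (v' y ^ 2 + lam * v y ^ 2) ∂(wt s) := by
  obtain ⟨hs0, hs1⟩ := hs.out
  have hvc : Continuous v := continuous_iff_continuousAt.2 fun y => (hv y).continuousAt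
  have hcs' : HasCompactSupport v' := by
    have : v' = deriv v := funext fun y => (hv y).deriv.symm
    rw [this]; exact hcs.deriv
  have hI : Integrable (fun y => v' y ^ 2) (wt s) :=
    (hc.memLp_of_hasCompactSupport (p := 2) hcs').integrable_sq
  have hJ : Integrable (fun y => v y ^ 2) (wt s) :=
    (hvc.memLp_of_hasCompactSupport (p := 2) hcs).integrable_sq
  set I := ∫ y, v' y ^ 2 ∂(wt s) with hIdef
  set J := ∫ y, v y ^ 2 ∂(wt s) with hJdef
  have hI0 : 0 ≤ I := integral_nonneg fun y => sq_nonneg _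
  have hJ0 : 0 ≤ J := integral_nonneg fun y => sq_nonneg _
  set R := lam ^ (-(1 / 2) : ℝ) with hRdef
  have hR : 0 < R := by positivity
  have hR1 : R ^ (2 * s) = lam ^ (-s) := by
    rw [hRdef, ← Real.rpow_mul hlam.le]; congr 1; ring
  have hR2 : R ^ (2 - 2 * s) = lam ^ (s - 1) := by
    rw [hRdef, ← Real.rpow_mul hlam.le]; congr 1; ring
  set m := lam ^ (s - 1) / (2 - 2 * s) with hm
  have hmeas : (wt s).real (Ioc 0 R) = m := by
    rw [Measure.real, wt_Ioc hs1 hR, hR2, ENNReal.toReal_ofReal]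
    exact div_nonneg (by positivity) (by linarith)
  have hfin : IsFiniteMeasure ((wt s).restrict (Ioc 0 R)) :=
    ⟨by rw [Measure.restrict_apply_univ, wt_Ioc hs1 hR]; exact ENNReal.ofReal_lt_top⟩
  have hle : ∫ _ in Ioc 0 R, v 0 ^ 2 ∂(wt s) ≤
      ∫ t in Ioc 0 R, (2 * v t ^ 2 + lam ^ (-s) / s * I) ∂(wt s) := by
    refine setIntegral_mono_on (integrable_const _)
      ((hJ.integrableOn.const_mul _).add (integrable_const _)) measurableSet_Ioc fun t ht => ?_
    have h1 := sub_sq_le_wt (s := s) hv hc hcs' ht.1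
    have h2 : t ^ (2 * s) ≤ lam ^ (-s) := by
      rw [← hR1]; exact Real.rpow_le_rpow ht.1.le ht.2 (by linarith)
    have h3 : t ^ (2 * s) / (2 * s) * I ≤ lam ^ (-s) / (2 * s) * I := by gcongr
    have h4 : lam ^ (-s) / s * I = 2 * (lam ^ (-s) / (2 * s) * I) := by field_simp
    rw [h4]
    nlinarith [sq_nonneg (2 * v t - v 0)]
  rw [integral_add (hJ.integrableOn.const_mul _) (integrable_const _), integral_const_mul,
    setIntegral_const, setIntegral_const, hmeas, smul_eq_mul, smul_eq_mul] at hle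
  have hJle : ∫ t in Ioc 0 R, v t ^ 2 ∂(wt s) ≤ J :=
    setIntegral_le_integral hJ (Filter.Eventually.of_forall fun y => sq_nonneg _)
  rw [integral_add hI (hJ.const_mul _), integral_const_mul]
  have hmpos : 0 < m := div_pos (by positivity) (by linarith)
  -- multiply the averaged inequality by `λ^s / m`
  have h5 : v 0 ^ 2 ≤ 2 / m * J + lam ^ (-s) / s * I := by
    have : m * v 0 ^ 2 ≤ m * (2 / m * J + lam ^ (-s) / s * I) := by
      have : m * (2 / m * J + lam ^ (-s) / s * I) = 2 * J + m * (lam ^ (-s) / s * I) := by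
        field_simp
      linarith
    exact le_of_mul_le_mul_left this hmpos
  have h6 : lam ^ s * (2 / m) = 4 * (1 - s) * lam := by
    have e : lam ^ (s - 1) = lam ^ s / lam := Real.rpow_sub_one hlam.ne' s
    have h8 : 0 < lam ^ s := by positivity
    rw [hm, e]; field_simp; ring
  have h7 : lam ^ s * lam ^ (-s) = 1 := by
    rw [← Real.rpow_add hlam]; simp
  calc lam ^ s * v 0 ^ 2 ≤ lam ^ s * (2 / m * J + lam ^ (-s) / s * I) := by gcongr
    _ = 4 * (1 - s) * (lam * J) + 1 / s * I := by
        rw [mul_add, ← mul_assoc, h6, div_mul_eq_mul_div, ← mul_div_assoc, ← mul_assoc, h7]; ring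
    _ ≤ (4 + 1 / s) * (I + lam * J) := by
        have h9 : 0 ≤ lam * J := by positivity
        have h10 : 0 < 1 / s := by positivity
        nlinarith [mul_nonneg h10.le h9, mul_nonneg hs0.le h9]

end

/-! ### The trace operator -/

section

variable {d : ℕ} {Ω : Set (Rd d)} {s : ℝ} [hs : Fact (s ∈ Ioo (0 : ℝ) 1)]

/-- The restriction `ψ ↦ ψ(·, 0)` of test functions. -/
def restrictLin (Ω : Set (Rd d)) : CylTests Ω →ₗ[ℝ] L2 Ω :=
  toL2 { toFun := fun ψ x => ψ.1 (x, 0), map_add' := fun _ _ => rfl, map_smul' := fun _ _ => rfl }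
    fun ψ => IsTest.memLp (CylTests.slice ψ 0).2 2 _

lemma coeFn_restrictLin (ψ : CylTests Ω) :
    restrictLin Ω ψ =ᵐ[volume.restrict Ω] fun x => ψ.1 (x, 0) := coeFn_toL2 _ _ ψ

lemma hasDerivAt_vertical {ψ : Rd d × ℝ → ℝ} (hψ : IsCylTest Ω ψ) (x : Rd d) (y : ℝ) :
    HasDerivAt (fun y => ψ (x, y)) (fderiv ℝ ψ (x, y) (0, 1)) y := by
  have h1 : HasFDerivAt (fun y : ℝ => (x, y)) (ContinuousLinearMap.inr ℝ (Rd d) ℝ) y :=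
    hasFDerivAt_prodMk_right x y
  have h2 := ((hψ.diff (x, y)).hasFDerivAt.comp y h1).hasDerivAt
  exact h2.congr_deriv (by simp)

lemma norm_restrictLin_sq_le (ψ : CylTests Ω) :
    ‖restrictLin Ω ψ‖ ^ 2 ≤ (4 + 1 / s) * ‖cylJet Ω s ψ‖ ^ 2 := by
  have i1 := (IsCylTest.memLp_deriv ψ.2 (0, 1) 2 (cylMeasure Ω s)).integrable_sq
  have i2 := (IsCylTest.memLp ψ.2 2 (cylMeasure Ω s)).integrable_sq
  have h1 : ∫ p, (fderiv ℝ ψ.1 p (0, 1) ^ 2 + ψ.1 p ^ 2) ∂(cylMeasure Ω s) ≤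
      ‖cylJet Ω s ψ‖ ^ 2 := by
    have e1 : ∫ p, fderiv ℝ ψ.1 p (0, 1) ^ 2 ∂(cylMeasure Ω s) = ‖cDy Ω s (cylJet Ω s ψ)‖ ^ 2 := by
      rw [norm_sq_L2_eq]
      exact integral_congr_ae ((coeFn_cDy_jet (s := s) ψ).fun_comp (fun t => t ^ 2)).symm
    have e2 : ∫ p, ψ.1 p ^ 2 ∂(cylMeasure Ω s) = ‖(cylJet Ω s ψ).fst‖ ^ 2 := by
      rw [norm_sq_L2_eq]
      exact integral_congr_ae ((coeFn_cFn_jet (s := s) ψ).fun_comp (fun t => t ^ 2)).symm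
    have e3 : ‖cDy Ω s (cylJet Ω s ψ)‖ ≤ ‖(cylJet Ω s ψ).snd‖ := by
      refine Lp.norm_le_norm_of_ae_le ?_
      filter_upwards [coeFn_cDy (cylJet Ω s ψ)] with x hx
      rw [hx]
      exact WithLp.norm_snd_le _ _
    rw [integral_add i1 i2, e1, e2, WithLp.prod_norm_sq_eq_of_L2, add_comm]
    gcongr
  refine le_trans ?_ (mul_le_mul_of_nonneg_left h1 (by have := hs.out.1; positivity))
  have h2 : ∫ p, (fderiv ℝ ψ.1 p (0, 1) ^ 2 + ψ.1 p ^ 2) ∂(cylMeasure Ω s) =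
      ∫ x in Ω, ∫ y, (fderiv ℝ ψ.1 (x, y) (0, 1) ^ 2 + ψ.1 (x, y) ^ 2) ∂(wt s) :=
    integral_prod _ (i1.add i2)
  have h3 : ∫ x in Ω, (restrictLin Ω ψ) x ^ 2 = ∫ x in Ω, ψ.1 (x, 0) ^ 2 :=
    integral_congr_ae ((coeFn_restrictLin ψ).fun_comp (fun t => t ^ 2))
  rw [h2, norm_sq_L2_eq, h3, ← integral_const_mul]
  refine integral_mono (IsTest.memLp (CylTests.slice ψ 0).2 2 _).integrable_sq
    ((i1.add i2).integral_prod_left.const_mul _) fun x => ?_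
  have := trace_half_line (s := s) (hasDerivAt_vertical ψ.2 x)
    ((IsCylTest.continuous_fderiv ψ.2).comp (by fun_prop : Continuous fun y : ℝ => (x, y))
      |>.clm_apply continuous_const) (hasCompactSupport_slice' ψ.2.2.1 x) one_pos
  simpa using this

/-- The trace operator, as the bounded extension of `ψ ↦ ψ(·, 0)`. -/
def trL (Ω : Set (Rd d)) (s : ℝ) [hs : Fact (s ∈ Ioo (0 : ℝ) 1)] : HL Ω s →L[ℝ] L2 Ω :=
  (restrictLin Ω).extendOfNorm (hlJet Ω s)

lemma norm_restrictLin_le (ψ : CylTests Ω) :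
    ‖restrictLin Ω ψ‖ ≤ √(4 + 1 / s) * ‖hlJet Ω s ψ‖ := by
  have h0 : 0 ≤ 4 + 1 / s := by have := hs.out.1; positivity
  refine le_of_sq_le_sq ?_ (by positivity)
  rw [mul_pow, Real.sq_sqrt h0]
  exact norm_restrictLin_sq_le ψ

lemma trL_hlJet (ψ : CylTests Ω) : trL Ω s (hlJet Ω s ψ) = restrictLin Ω ψ :=
  LinearMap.extendOfNorm_eq denseRange_hlJet ⟨_, norm_restrictLin_le⟩ ψ

lemma norm_trL_le (W : HL Ω s) : ‖trL Ω s W‖ ≤ √(4 + 1 / s) * ‖W‖ :=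
  LinearMap.norm_extendOfNorm_apply_le denseRange_hlJet _ norm_restrictLin_le W

/-- Every element of the energy space has a trace. -/
lemma isTrace_trL (W : HL Ω s) : IsTrace Ω s W (trL Ω s W) := by
  refine denseRange_hlJet.induction_on (p := fun W : HL Ω s => IsTrace Ω s W (trL Ω s W)) W ?_ ?_
  · exact isClosed_closure.preimage (f := fun W : HL Ω s => ((W : CylJet Ω s), trL Ω s W))
      (by fun_prop)
  · intro ψ
    refine subset_closure ⟨ψ.1, ψ.2, isJetOf_cylJet ψ, ?_⟩
    rw [trL_hlJet]
    exact coeFn_restrictLin ψ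

/-- Traces are unique, since `trL` is a bounded extension. -/
lemma IsTrace.eq_trL {W : HL Ω s} {t : L2 Ω} (h : IsTrace Ω s W t) : t = trL Ω s W := by
  obtain ⟨u, hu, hlim⟩ := mem_closure_iff_seq_limit.1 h
  choose ψ hψ h1 h2 using hu
  have e1 : ∀ n, (u n).1 = (hlJet Ω s ⟨ψ n, hψ n⟩ : CylJet Ω s) := fun n =>
    eq_cylJet (ψ := ⟨ψ n, hψ n⟩) (h1 n)
  have e2 : ∀ n, (u n).2 = trL Ω s (hlJet Ω s ⟨ψ n, hψ n⟩) := fun n => by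
    rw [trL_hlJet]
    exact Lp.ext ((h2 n).trans (coeFn_restrictLin ⟨ψ n, hψ n⟩).symm)
  have l1 : Filter.Tendsto (fun n => hlJet Ω s ⟨ψ n, hψ n⟩) Filter.atTop (nhds W) := by
    rw [tendsto_subtype_rng]
    simp only [← e1]
    exact (continuous_fst.tendsto _).comp hlim
  have l2 : Filter.Tendsto (fun n => (u n).2) Filter.atTop (nhds t) :=
    (continuous_snd.tendsto _).comp hlim
  simp only [e2] at l2
  exact tendsto_nhds_unique l2 (((trL Ω s).continuous.tendsto W).comp l1)

lemma tr_eq (W : HL Ω s) : tr Ω s W = trL Ω s W :=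
  IsTrace.eq_trL (Classical.epsilon_spec (p := IsTrace Ω s (W : CylJet Ω s)) ⟨_, isTrace_trL W⟩)

end

/-! ### Traces belong to the spectral space -/

section

variable {d : ℕ} {Ω : Set (Rd d)} {s : ℝ}

section Bessel

variable {A : Rd d → Matrix (Fin d) (Fin d) ℝ} {a₀ : ℝ} (hA : IsDiffusion Ω a₀ A)
    {q : L2 Ω} (hq : MemLp q ⊤ (volume.restrict Ω)) (hq0 : ∀ᵐ x ∂(volume.restrict Ω), 0 ≤ q x)

include hA hq hq0

lemma eigenvalue_pos (ha₀ : 0 < a₀) {R : ℝ} (hR0 : 0 < R)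
    (hR : Ω ⊆ Metric.closedBall 0 R) (i : Fin d) {lam : ℝ} {φ : L2 Ω}
    (h : IsEigenpair Ω A q lam φ) : 0 < lam := by
  obtain ⟨hφ, U, hU, rfl, heq⟩ := h
  have h1 := heq U hU
  rw [← omForm_apply hA hq, real_inner_self_eq_norm_sq] at h1
  have h2 := omForm_ge hA hq hq0 U
  have h3 := H01_poincare hR0.le hR i hU
  have h4 : 0 < ‖U.fst‖ := norm_pos_iff.2 hφ
  have h5 : 0 < ‖U.snd‖ := by
    by_contra hc
    have : ‖U.snd‖ = 0 := le_antisymm (not_lt.1 hc) (norm_nonneg _)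
    rw [this] at h3; linarith
  have h6 : 0 < lam * ‖U.fst‖ ^ 2 := by
    rw [← h1]; exact lt_of_lt_of_le (by positivity) h2
  exact pos_of_mul_pos_left h6 (by positivity)

/-- Bessel's inequality for an orthonormal family of eigenfunctions in the energy product. -/
lemma sum_eigenvalue_le {ha₀ : 0 < a₀} {n : ℕ} {lam : Fin n → ℝ} {φ : Fin n → L2 Ω}
    (hφ : Orthonormal ℝ φ) (h : ∀ i, IsEigenpair Ω A q (lam i) (φ i)) {V : Jet Ω}
    (hV : V ∈ H01 Ω) :
    ∑ i, lam i * (inner ℝ (φ i) V.fst : ℝ) ^ 2 ≤ omForm hA hq V V := by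
  choose hne U hU hUφ heq using h
  set B := omForm hA hq with hB
  have hBU : ∀ i, ∀ W ∈ H01 Ω, B (U i) W = lam i * inner ℝ (φ i) W.fst := fun i W hW => by
    rw [hB, omForm_apply, heq i W hW, hUφ]
  set c : Fin n → ℝ := fun i => inner ℝ (φ i) V.fst with hc
  set S := ∑ i, c i • U i with hS
  have hSm : S ∈ H01 Ω := Submodule.sum_mem _ fun i _ => Submodule.smul_mem _ _ (hU i)
  have hSW : ∀ W ∈ H01 Ω, B S W = ∑ i, c i * (lam i * inner ℝ (φ i) W.fst) := fun W hW => by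
    rw [hS, map_sum B, sum_apply]
    refine Finset.sum_congr rfl fun i _ => ?_
    rw [map_smul, smul_apply, hBU i W hW, smul_eq_mul]
  have hSV : B S V = ∑ i, lam i * c i ^ 2 := by
    rw [hSW V hV]
    refine Finset.sum_congr rfl fun i _ => ?_
    simp only [hc]; ring
  have hSS : B S S = ∑ i, lam i * c i ^ 2 := by
    rw [hSW S hSm]
    refine Finset.sum_congr rfl fun i _ => ?_
    have hfst : S.fst = ∑ j, c j • φ j := by
      have : (jFn Ω) S = ∑ j, c j • jFn Ω (U j) := by rw [hS, map_sum]; simp only [map_smul]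
      refine this.trans (Finset.sum_congr rfl fun j _ => ?_)
      rw [← hUφ j]; rfl
    rw [hfst, hφ.inner_right_fintype]
    ring
  have h0 : 0 ≤ B (V - S) (V - S) :=
    le_trans (by positivity) (omForm_ge hA hq hq0 (V - S))
  have hVS : B V S = B S V := omForm_comm hA hq V S
  rw [map_sub B, sub_apply, map_sub (B V), map_sub (B S), hVS, hSV, hSS] at h0
  linarith

end Bessel

/-- The Fourier coefficient `y ↦ (φ, ψ(·, y))` of the slices of a test function, and its
derivative. -/
lemma hasDerivAt_coeff [IsFiniteMeasure (volume.restrict Ω)] (φ : L2 Ω) {ψ : Rd d × ℝ → ℝ}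
    (hψ : IsCylTest Ω ψ) :
    (∀ y, HasDerivAt (fun y => ∫ x in Ω, φ x * ψ (x, y))
      (∫ x in Ω, φ x * fderiv ℝ ψ (x, y) (0, 1)) y) ∧
    Continuous (fun y => ∫ x in Ω, φ x * fderiv ℝ ψ (x, y) (0, 1)) ∧
    HasCompactSupport (fun y => ∫ x in Ω, φ x * ψ (x, y)) := by
  have hφ : Integrable φ (volume.restrict Ω) := (Lp.memLp φ).integrable (by norm_num)
  have hc : Continuous fun p => fderiv ℝ ψ p (0, 1) :=
    hψ.continuous_fderiv.clm_apply continuous_const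
  have hsl : ∀ y : ℝ, Continuous fun x : Rd d => (x, y) := fun y => by fun_prop
  obtain ⟨K, hK⟩ := hc.bounded_above_of_compact_support
    ((hψ.2.1.fderiv ℝ).comp_left (g := fun l : Rd d × ℝ →L[ℝ] ℝ => l (0, 1)) rfl)
  have hbd : ∀ x y, ‖φ x * fderiv ℝ ψ (x, y) (0, 1)‖ ≤ ‖φ x‖ * K := fun x y => by
    rw [norm_mul]; exact mul_le_mul_of_nonneg_left (hK _) (norm_nonneg _)
  refine ⟨fun y => ?_, ?_, ?_⟩
  · refine (hasDerivAt_integral_of_dominated_loc_of_deriv_le (s := univ)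
      (F := fun y x => φ x * ψ (x, y)) (bound := fun x => ‖φ x‖ * K)
      (F' := fun y x => φ x * fderiv ℝ ψ (x, y) (0, 1)) Filter.univ_mem ?_ ?_ ?_ ?_ ?_ ?_).2
    · exact Filter.Eventually.of_forall fun y =>
        hφ.1.mul (hψ.1.continuous.comp (hsl y)).aestronglyMeasurable
    · exact (Lp.memLp φ).integrable_mul (IsTest.memLp (CylTests.slice ⟨ψ, hψ⟩ y).2 2 _)
    · exact hφ.1.mul (hc.comp (hsl y)).aestronglyMeasurable
    · exact Filter.Eventually.of_forall fun x y _ => hbd x y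
    · exact hφ.norm.mul_const K
    · exact Filter.Eventually.of_forall fun x y _ => (hasDerivAt_vertical hψ x y).const_mul _
  · refine continuous_of_dominated (bound := fun x => ‖φ x‖ * K) ?_ ?_ (hφ.norm.mul_const K) ?_
    · exact fun y => hφ.1.mul (hc.comp (hsl y)).aestronglyMeasurable
    · exact fun y => Filter.Eventually.of_forall fun x => hbd x y
    · exact Filter.Eventually.of_forall fun x => continuous_const.mul (hc.comp (by fun_prop))
  · refine HasCompactSupport.of_support_subset_isCompact (hψ.2.1.image continuous_snd) fun y hy => ?_
    by_contra hn
    refine hy (integral_eq_zero_of_ae (Filter.Eventually.of_forall fun x => ?_))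
    have : ψ (x, y) = 0 := image_eq_zero_of_notMem_tsupport fun hm => hn ⟨_, hm, rfl⟩
    simp [this]

variable [hs : Fact (s ∈ Ioo (0 : ℝ) 1)]

section Energy

variable {A : Rd d → Matrix (Fin d) (Fin d) ℝ} {a₀ : ℝ} (hA : IsDiffusion Ω a₀ A)
    {q : L2 Ω} (hq : MemLp q ⊤ (volume.restrict Ω)) (hq0 : ∀ᵐ x ∂(volume.restrict Ω), 0 ≤ q x)

include hq0

/-- The spectral trace inequality for test functions: Bessel's inequality on the slices reduces it
to the trace inequality on the half-line for the Fourier coefficients. -/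
lemma sum_coeff_le_cylForm (ha₀ : 0 < a₀) {R : ℝ} (hR0 : 0 < R)
    (hR : Ω ⊆ Metric.closedBall 0 R) (i₀ : Fin d) {n : ℕ} {lam : Fin n → ℝ} {φ : Fin n → L2 Ω}
    (hφ : Orthonormal ℝ φ) (h : ∀ i, IsEigenpair Ω A q (lam i) (φ i)) (ψ : CylTests Ω) :
    ∑ i, lam i ^ s * (inner ℝ (φ i) (restrictLin Ω ψ) : ℝ) ^ 2 ≤
      (4 + 1 / s) * cylForm s hA hq (cylJet Ω s ψ) (cylJet Ω s ψ) := by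
  have hfin : IsFiniteMeasure (volume.restrict Ω) :=
    ⟨by rw [Measure.restrict_apply_univ]
        exact (measure_mono hR).trans_lt measure_closedBall_lt_top⟩
  have hpos := fun i => eigenvalue_pos hA hq hq0 ha₀ hR0 hR i₀ (h i)
  have hψ := ψ.2
  set w : Fin n → ℝ → ℝ := fun i y => ∫ x in Ω, φ i x * ψ.1 (x, y) with hw
  set w' : Fin n → ℝ → ℝ := fun i y => ∫ x in Ω, φ i x * fderiv ℝ ψ.1 (x, y) (0, 1) with hw'
  have hprop := fun i => hasDerivAt_coeff (φ i) hψ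
  have hw0 : ∀ i, (inner ℝ (φ i) (restrictLin Ω ψ) : ℝ) = w i 0 := fun i => by
    rw [inner_L2_eq]
    refine integral_congr_ae ?_
    filter_upwards [coeFn_restrictLin ψ] with x hx
    rw [hx]
  have h1D : ∀ i, lam i ^ s * w i 0 ^ 2 ≤
      (4 + 1 / s) * ∫ y, (w' i y ^ 2 + lam i * w i y ^ 2) ∂(wt s) := fun i =>
    trace_half_line (hprop i).1 (hprop i).2.1 (hprop i).2.2 (hpos i)
  have hcs' : ∀ i, HasCompactSupport (w' i) := fun i => by
    have : w' i = deriv (w i) := funext fun y => ((hprop i).1 y).deriv.symm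
    rw [this]; exact (hprop i).2.2.deriv
  have hwc : ∀ i, Continuous (w i) := fun i =>
    continuous_iff_continuousAt.2 fun y => ((hprop i).1 y).continuousAt
  have hint : ∀ i, Integrable (fun y => w' i y ^ 2 + lam i * w i y ^ 2) (wt s) := fun i =>
    ((hprop i).2.1.memLp_of_hasCompactSupport (p := 2) (hcs' i)).integrable_sq.add
      (((hwc i).memLp_of_hasCompactSupport (p := 2) (hprop i).2.2).integrable_sq.const_mul _)
  simp only [hw0]
  refine (Finset.sum_le_sum fun i _ => h1D i).trans ?_
  rw [← Finset.mul_sum, ← integral_finsetSum _ fun i _ => hint i]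
  refine mul_le_mul_of_nonneg_left ?_ (by have := hs.out.1; positivity)
  -- the integrand of the energy form on a test function
  set G : Rd d × ℝ → ℝ := fun p => matForm (A p.1) (extGrad ψ.1 p).fst (extGrad ψ.1 p).fst
    + (extGrad ψ.1 p).snd * (extGrad ψ.1 p).snd + q p.1 * ψ.1 p * ψ.1 p with hG
  have hGae : (fun p => matForm (A p.1) ((cylJet Ω s ψ).snd p).fst ((cylJet Ω s ψ).snd p).fst
      + ((cylJet Ω s ψ).snd p).snd * ((cylJet Ω s ψ).snd p).snd
      + q p.1 * (cylJet Ω s ψ).fst p * (cylJet Ω s ψ).fst p) =ᵐ[cylMeasure Ω s] G := by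
    filter_upwards [(isJetOf_cylJet (s := s) ψ).1, (isJetOf_cylJet (s := s) ψ).2] with p h1 h2
    rw [h1, h2]
  have hGint : Integrable G (cylMeasure Ω s) := by
    refine Integrable.congr ?_ hGae
    exact ((integrable_matForm_cyl hA _ _).add (integrable_dy_cyl _ _)).add
      (integrable_mul_mul (memLp_top_cyl hq) (Lp.memLp (cylJet Ω s ψ).fst)
        (Lp.memLp (cylJet Ω s ψ).fst))
  rw [cylForm_eq, integral_congr_ae hGae]
  have hFub : ∫ p, G p ∂(cylMeasure Ω s) = ∫ y, (∫ x in Ω, G (x, y)) ∂(wt s) :=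
    integral_prod_symm _ hGint
  rw [hFub]
  refine integral_mono (integrable_finsetSum _ fun i _ => hint i) hGint.integral_prod_right
    fun y => ?_
  set V := jet Ω (CylTests.slice ψ y) with hV
  have hVy : omForm hA hq V V = ∫ x in Ω, (matForm (A x) (extGrad ψ.1 (x, y)).fst
      (extGrad ψ.1 (x, y)).fst + q x * ψ.1 (x, y) * ψ.1 (x, y)) := by
    rw [omForm_apply, aOmega]
    refine integral_congr_ae ?_
    filter_upwards [jet_fst (CylTests.slice ψ y), jet_snd (CylTests.slice ψ y)] with x h1 h2
    rw [hV, h1, h2]; rfl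
  have hi1 : Integrable (fun x => matForm (A x) (extGrad ψ.1 (x, y)).fst
      (extGrad ψ.1 (x, y)).fst + q x * ψ.1 (x, y) * ψ.1 (x, y)) (volume.restrict Ω) := by
    refine ((integrable_matForm hA V V).add
      (integrable_mul_mul hq (Lp.memLp V.fst) (Lp.memLp V.fst))).congr ?_
    filter_upwards [jet_fst (CylTests.slice ψ y), jet_snd (CylTests.slice ψ y)] with x h1 h2
    simp only [Pi.add_apply]
    rw [hV, h1, h2]; rfl
  have hdy : MemLp (fun x => fderiv ℝ ψ.1 (x, y) (0, 1)) 2 (volume.restrict Ω) := by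
    refine Continuous.memLp_of_hasCompactSupport ?_ ?_
    · exact (IsCylTest.continuous_fderiv hψ).comp (by fun_prop : Continuous fun x : Rd d => (x, y))
        |>.clm_apply continuous_const
    · exact hasCompactSupport_slice (ψ := fun p => fderiv ℝ ψ.1 p (0, 1))
        ((hψ.2.1.fderiv ℝ).comp_left (g := fun l : Rd d × ℝ →L[ℝ] ℝ => l (0, 1)) rfl) y
  have hGy : ∫ x in Ω, G (x, y) =
      (∫ x in Ω, fderiv ℝ ψ.1 (x, y) (0, 1) ^ 2) + omForm hA hq V V := by
    rw [hVy, ← integral_add hdy.integrable_sq hi1]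
    refine integral_congr_ae (Filter.Eventually.of_forall fun x => ?_)
    simp only [hG, extGrad_snd (IsCylTest.diff hψ)]
    ring
  rw [hGy, Finset.sum_add_distrib]
  refine add_le_add ?_ ?_
  · have hB := hφ.sum_inner_products_le (hdy.toLp _) (s := Finset.univ)
    have e1 : ‖hdy.toLp _‖ ^ 2 = ∫ x in Ω, fderiv ℝ ψ.1 (x, y) (0, 1) ^ 2 := by
      rw [← real_inner_self_eq_norm_sq, inner_toLp]
      simp only [sq]
    have e2 : ∀ i, (inner ℝ (φ i) (hdy.toLp _) : ℝ) = w' i y := fun i => by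
      rw [inner_L2_eq]
      refine integral_congr_ae ?_
      filter_upwards [hdy.coeFn_toLp] with x hx
      rw [hx]
    rw [e1] at hB
    simpa only [e2, Real.norm_eq_abs, sq_abs] using hB
  · have hB := sum_eigenvalue_le hA hq hq0 (ha₀ := ha₀) hφ h (jet_mem (CylTests.slice ψ y))
    have e2 : ∀ i, (inner ℝ (φ i) V.fst : ℝ) = w i y := fun i => by
      rw [inner_L2_eq]
      refine integral_congr_ae ?_
      filter_upwards [jet_fst (CylTests.slice ψ y)] with x hx
      rw [hV, hx]; rfl
    simpa only [← hV, e2] using hB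

/-- The trace operator maps into `ℍ^s(Ω)`, with a bound by the energy that holds for all
coefficients with the same constant. -/
lemma hsEnergy_trL_le (ha₀ : 0 < a₀) {R : ℝ} (hR0 : 0 < R)
    (hR : Ω ⊆ Metric.closedBall 0 R) (i₀ : Fin d) (W : HL Ω s) :
    hsEnergy Ω A q s (trL Ω s W) ≤
      ENNReal.ofReal ((4 + 1 / s) * cylForm s hA hq (W : CylJet Ω s) W) := by
  refine iSup_le fun n => iSup_le fun lam => iSup_le fun φ => iSup_le fun h => ?_
  have hpos := fun i => eigenvalue_pos hA hq hq0 ha₀ hR0 hR i₀ (h.2 i)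
  simp only [← ENNReal.ofReal_mul (Real.rpow_nonneg (hpos _).le s)]
  rw [← ENNReal.ofReal_sum_of_nonneg fun i _ =>
    mul_nonneg (Real.rpow_nonneg (hpos i).le s) (sq_nonneg _)]
  refine ENNReal.ofReal_le_ofReal ?_
  refine denseRange_hlJet.induction_on (p := fun W : HL Ω s =>
    ∑ i, lam i ^ s * (inner ℝ (φ i) (trL Ω s W) : ℝ) ^ 2 ≤
      (4 + 1 / s) * cylForm s hA hq (W : CylJet Ω s) W) W (isClosed_le (by fun_prop) ?_) fun ψ => ?_
  · refine continuous_const.mul ?_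
    exact ((cylForm s hA hq).continuous.comp continuous_subtype_val).clm_apply
      continuous_subtype_val
  · rw [trL_hlJet]
    exact sum_coeff_le_cylForm hA hq hq0 ha₀ hR0 hR i₀ h.1 h.2 ψ

end Energy

end

/-! ### Well-posedness of the state and adjoint equations -/

section

variable {d : ℕ} {Ω : Set (Rd d)} {s : ℝ}

lemma isDiffusion_one : IsDiffusion Ω 1 (fun _ => (1 : Matrix (Fin d) (Fin d) ℝ)) where
  memLp i j := memLp_top_const _
  symm := Filter.Eventually.of_forall fun _ => Matrix.isSymm_one
  elliptic := Filter.Eventually.of_forall fun _ ξ => by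
    rw [EuclideanSpace.norm_sq_eq]
    simp [matForm, Matrix.one_apply, sq]

lemma memLp_top_zero : MemLp ((0 : L2 Ω) : Rd d → ℝ) ⊤ (volume.restrict Ω) :=
  (memLp_top_const (0 : ℝ)).ae_eq (Lp.coeFn_zero ℝ 2 (volume.restrict Ω)).symm

lemma zero_nonneg : ∀ᵐ x ∂(volume.restrict Ω), 0 ≤ ((0 : L2 Ω) : Rd d → ℝ) x := by
  filter_upwards [Lp.coeFn_zero ℝ 2 (volume.restrict Ω)] with x hx
  rw [hx]; simp

lemma Adm.memLp {qbar : ℝ} {q : L2 Ω} (h : q ∈ Adm Ω qbar) : MemLp q ⊤ (volume.restrict Ω) :=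
  memLp_top_of_bound (Lp.aestronglyMeasurable q) qbar (Filter.Eventually.mono (mem_ofPred.1 h)
    fun x hx => by rw [Real.norm_of_nonneg hx.1]; exact hx.2)

lemma Adm.nonneg {qbar : ℝ} {q : L2 Ω} (h : q ∈ Adm Ω qbar) :
    ∀ᵐ x ∂(volume.restrict Ω), 0 ≤ q x := Filter.Eventually.mono (mem_ofPred.1 h) fun _ hx => hx.1

variable [hs : Fact (s ∈ Ioo (0 : ℝ) 1)]

lemma ds_pos : 0 < ds s := by
  have h1 := Real.Gamma_pos_of_pos hs.out.1
  have h2 := Real.Gamma_pos_of_pos (sub_pos.2 hs.out.2)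
  unfold ds; positivity

/-- The constant of the trace inequalities. -/
def trConst (s : ℝ) : ℝ := 4 + 1 / s

lemma trConst_pos : 0 < trConst s := by
  have := hs.out.1; unfold trConst; positivity

/-- The coercivity constant of the energy form on a domain in the ball of radius `R`. -/
def coerConst (a₀ R : ℝ) : ℝ := min a₀ 1 / (1 + 4 * R ^ 2)

lemma coerConst_pos {a₀ R : ℝ} (ha₀ : 0 < a₀) : 0 < coerConst a₀ R := by
  have : 0 < min a₀ 1 := lt_min ha₀ one_pos
  unfold coerConst; positivity

/-- The energy form on the energy space. -/
def hlForm (s : ℝ) {A : Rd d → Matrix (Fin d) (Fin d) ℝ} {a₀ : ℝ} (hA : IsDiffusion Ω a₀ A)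
    {q : L2 Ω} (hq : MemLp q ⊤ (volume.restrict Ω)) : HL Ω s →L[ℝ] HL Ω s →L[ℝ] ℝ :=
  (cylForm s hA hq).bilinearComp (HL Ω s).subtypeL (HL Ω s).subtypeL

section

variable {A : Rd d → Matrix (Fin d) (Fin d) ℝ} {a₀ : ℝ} (hA : IsDiffusion Ω a₀ A)
    {q : L2 Ω} (hq : MemLp q ⊤ (volume.restrict Ω)) (hq0 : ∀ᵐ x ∂(volume.restrict Ω), 0 ≤ q x)

omit hs in
lemma hlForm_apply (W Φ : HL Ω s) : hlForm s hA hq W Φ = aCyl Ω s A q W Φ :=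
  cylForm_apply hA hq W Φ

variable (ha₀ : 0 < a₀) {R : ℝ} (hR0 : 0 < R) (hR : Ω ⊆ Metric.closedBall 0 R) (i₀ : Fin d)

include hq0 ha₀ hR0 hR i₀

lemma hlForm_coercive (W : HL Ω s) : coerConst a₀ R * ‖W‖ ^ 2 ≤ hlForm s hA hq W W := by
  refine le_trans ?_ (cylForm_ge hA hq hq0 (W : CylJet Ω s))
  have h1 := HL_poincare hR0.le hR i₀ W
  have h2 : ‖(W : CylJet Ω s).fst‖ ^ 2 ≤ (2 * R * ‖(W : CylJet Ω s).snd‖) ^ 2 :=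
    pow_le_pow_left₀ (norm_nonneg _) h1 2
  have h3 : ‖W‖ ^ 2 = ‖(W : CylJet Ω s).fst‖ ^ 2 + ‖(W : CylJet Ω s).snd‖ ^ 2 :=
    WithLp.prod_norm_sq_eq_of_L2 _
  have h4 : 0 < min a₀ 1 := lt_min ha₀ one_pos
  rw [h3, coerConst, div_mul_eq_mul_div, div_le_iff₀ (by positivity), mul_assoc]
  refine mul_le_mul_of_nonneg_left ?_ h4.le
  nlinarith

lemma norm_le_sqrt_hlForm (W : HL Ω s) :
    ‖W‖ ≤ (√(coerConst a₀ R))⁻¹ * √(hlForm s hA hq W W) := by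
  have h := hlForm_coercive hA hq hq0 ha₀ hR0 hR i₀ W
  have hk := coerConst_pos (R := R) ha₀
  rw [← Real.sqrt_inv, ← Real.sqrt_mul (by positivity)]
  refine Real.le_sqrt_of_sq_le ?_
  rw [inv_mul_eq_div, le_div_iff₀ hk, mul_comm]
  exact h

/-- The Lax–Milgram theorem for the energy form. -/
lemma exists_solution (l : HL Ω s →L[ℝ] ℝ) : ∃ U : HL Ω s, ∀ Φ, hlForm s hA hq U Φ = l Φ := by
  have hc : IsCoercive (hlForm s hA hq) := ⟨coerConst a₀ R, coerConst_pos ha₀, fun W => by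
    rw [mul_assoc, ← sq]; exact hlForm_coercive hA hq hq0 ha₀ hR0 hR i₀ W⟩
  refine ⟨hc.continuousLinearEquivOfBilin.symm ((InnerProductSpace.toDual ℝ _).symm l), fun Φ => ?_⟩
  rw [← hc.continuousLinearEquivOfBilin_apply]
  simp

lemma exists_adjoint_solution (l : HL Ω s →L[ℝ] ℝ) :
    ∃ P : HL Ω s, ∀ W, hlForm s hA hq W P = l W := by
  have hc : IsCoercive (hlForm s hA hq).flip := ⟨coerConst a₀ R, coerConst_pos ha₀, fun W => by
    rw [mul_assoc, ← sq]; exact hlForm_coercive hA hq hq0 ha₀ hR0 hR i₀ W⟩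
  refine ⟨hc.continuousLinearEquivOfBilin.symm ((InnerProductSpace.toDual ℝ _).symm l), fun Φ => ?_⟩
  rw [← ContinuousLinearMap.flip_apply, ← hc.continuousLinearEquivOfBilin_apply]
  simp

omit ha₀ hA hq hq0 in
lemma trL_mem_HsRef (W : HL Ω s) : trL Ω s W ∈ HsRef Ω s :=
  (hsEnergy_trL_le isDiffusion_one memLp_top_zero zero_nonneg one_pos hR0 hR i₀ W).trans_lt
    ENNReal.ofReal_lt_top

/-- The dual norm controls a functional on traces by the energy. -/
lemma abs_le_negNorm (g : HsRef Ω s →ₗ[ℝ] ℝ) (W : HL Ω s) (hW : trL Ω s W ∈ HsRef Ω s) :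
    ENNReal.ofReal |g ⟨trL Ω s W, hW⟩| ≤
      negNorm Ω A q s g * ENNReal.ofReal (√(trConst s) * √(hlForm s hA hq W W)) := by
  rcases eq_or_ne W 0 with rfl | hW0
  · have : (⟨trL Ω s 0, hW⟩ : HsRef Ω s) = 0 := Subtype.ext (map_zero (trL Ω s))
    rw [this]; simp
  have hk := coerConst_pos (R := R) ha₀
  have hB : 0 < hlForm s hA hq W W := by
    refine lt_of_lt_of_le ?_ (hlForm_coercive hA hq hq0 ha₀ hR0 hR i₀ W)
    have := norm_pos_iff.2 hW0
    positivity
  set b := √(trConst s) * √(hlForm s hA hq W W) with hb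
  have hbpos : 0 < b := mul_pos (Real.sqrt_pos.2 trConst_pos) (Real.sqrt_pos.2 hB)
  have hbsq : b ^ 2 = trConst s * hlForm s hA hq W W := by
    rw [hb, mul_pow, Real.sq_sqrt trConst_pos.le, Real.sq_sqrt hB.le]
  have hle : hsEnergy Ω A q s (b⁻¹ • trL Ω s W) ≤ 1 := by
    refine (hsEnergy_smul Ω A q s _ _).trans ((mul_le_mul_right
      (hsEnergy_trL_le hA hq hq0 ha₀ hR0 hR i₀ W) _).trans ?_)
    change _ * ENNReal.ofReal (trConst s * hlForm s hA hq W W) ≤ 1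
    rw [← hbsq, ← ENNReal.ofReal_mul (by positivity), inv_pow,
      inv_mul_cancel₀ (by positivity), ENNReal.ofReal_one]
  have h1 : ENNReal.ofReal |g (b⁻¹ • ⟨trL Ω s W, hW⟩)| ≤ negNorm Ω A q s g :=
    le_iSup₂_of_le (b⁻¹ • (⟨trL Ω s W, hW⟩ : HsRef Ω s)) hle le_rfl
  refine le_trans (le_of_eq ?_) (mul_le_mul_left h1 _)
  rw [← ENNReal.ofReal_mul (abs_nonneg _), map_smul, smul_eq_mul, abs_mul, abs_of_pos
    (inv_pos.2 hbpos)]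
  congr 1
  field_simp

omit hA hq hq0 ha₀ in
lemma pairing_eq (f : HsRef Ω s →ₗ[ℝ] ℝ) (W : HL Ω s) :
    pairing Ω s f (tr Ω s W) = f ⟨trL Ω s W, trL_mem_HsRef hR0 hR i₀ W⟩ := by
  have h : tr Ω s W ∈ HsRef Ω s := by rw [tr_eq]; exact trL_mem_HsRef hR0 hR i₀ W
  rw [pairing, dif_pos h]
  congr 2
  exact tr_eq W

omit hA hq hq0 ha₀ in
/-- The source term `Φ ↦ ⟨f, tr Φ⟩` is a bounded functional on the energy space. -/
lemma exists_source {f : HsRef Ω s →ₗ[ℝ] ℝ} (hf : negNorm Ω (fun _ => 1) 0 s f < ⊤) :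
    ∃ l : HL Ω s →L[ℝ] ℝ, ∀ Φ, l Φ = pairing Ω s f (tr Ω s Φ) := by
  set B := cylForm (Ω := Ω) s (isDiffusion_one (d := d)) memLp_top_zero with hBdef
  set T : HL Ω s →ₗ[ℝ] HsRef Ω s :=
    (trL Ω s : HL Ω s →ₗ[ℝ] L2 Ω).codRestrict _ (trL_mem_HsRef hR0 hR i₀) with hT
  refine ⟨(f ∘ₗ T).mkContinuous
    ((negNorm Ω (fun _ => 1) 0 s f).toReal * (√(trConst s) * √‖B‖)) fun W => ?_,
    fun Φ => (pairing_eq hR0 hR i₀ f Φ).symm⟩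
  have h := abs_le_negNorm isDiffusion_one memLp_top_zero zero_nonneg one_pos hR0 hR i₀ f W
    (trL_mem_HsRef hR0 hR i₀ W)
  have h1 : √(B W W) ≤ √‖B‖ * ‖W‖ := by
    rw [← Real.sqrt_sq (norm_nonneg W), ← Real.sqrt_mul (norm_nonneg B)]
    refine Real.sqrt_le_sqrt ((le_abs_self _).trans ?_)
    rw [sq, ← mul_assoc]
    exact B.le_opNorm₂ W W
  have h2 := ENNReal.toReal_mono (ENNReal.mul_ne_top hf.ne ENNReal.ofReal_ne_top) h
  rw [ENNReal.toReal_ofReal (abs_nonneg _), ENNReal.toReal_mul,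
    ENNReal.toReal_ofReal (by positivity)] at h2
  refine h2.trans ?_
  rw [mul_assoc, mul_assoc]
  gcongr
  exact h1

/-- The state `E(q)` is the weak solution, since a weak solution exists. -/
lemma E_spec {f : HsRef Ω s →ₗ[ℝ] ℝ} (hf : negNorm Ω (fun _ => 1) 0 s f < ⊤) (Φ : HL Ω s) :
    hlForm s hA hq (E Ω s A f q) Φ = ds s * pairing Ω s f (tr Ω s Φ) := by
  obtain ⟨l, hl⟩ := exists_source hR0 hR i₀ hf
  obtain ⟨U, hU⟩ := exists_solution hA hq hq0 ha₀ hR0 hR i₀ (ds s • l)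
  rw [hlForm_apply]
  refine Classical.epsilon_spec (p := fun U : HL Ω s => ∀ Φ : HL Ω s,
    aCyl Ω s A q U Φ = ds s * pairing Ω s f (tr Ω s Φ)) ⟨U, fun Φ => ?_⟩ Φ
  rw [← hlForm_apply hA hq, hU, ← hl]; rfl

/-- The adjoint state is the weak solution of the adjoint equation. -/
lemma adj_spec (f : HsRef Ω s →ₗ[ℝ] ℝ) (z : L2 Ω) (W : HL Ω s) :
    hlForm s hA hq W (adj Ω s A f z q) =
      ds s * inner ℝ (trL Ω s (E Ω s A f q) - z) (trL Ω s W) := by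
  obtain ⟨P, hP⟩ := exists_adjoint_solution hA hq hq0 ha₀ hR0 hR i₀
    (ds s • (innerSL ℝ (trL Ω s (E Ω s A f q) - z)).comp (trL Ω s))
  rw [hlForm_apply, ← tr_eq, ← tr_eq]
  refine Classical.epsilon_spec (p := fun P : HL Ω s => ∀ W : HL Ω s, aCyl Ω s A q W P =
    ds s * inner ℝ (tr Ω s (E Ω s A f q) - z) (tr Ω s W)) ⟨P, fun W => ?_⟩ W
  rw [← hlForm_apply hA hq, hP, tr_eq, tr_eq]; rfl

omit hs hA hq hq0 ha₀ hR0 hR i₀ in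
lemma ofReal_sqrt_le_of_le {b : ℝ} {K : ℝ≥0∞} (h : ENNReal.ofReal b ≤ K * ENNReal.ofReal √b) :
    ENNReal.ofReal √b ≤ K := by
  rcases le_or_gt b 0 with hb | hb
  · rw [Real.sqrt_eq_zero_of_nonpos hb]; simp
  · have h1 : 0 < √b := Real.sqrt_pos.2 hb
    rw [← Real.mul_self_sqrt hb.le, ENNReal.ofReal_mul h1.le, Real.sqrt_mul_self h1.le] at h
    exact (ENNReal.mul_le_mul_iff_left (by simpa using h1) ENNReal.ofReal_ne_top).1 h

/-- The energy estimate for the state. -/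
lemma energy_E_le {f : HsRef Ω s →ₗ[ℝ] ℝ} (hf : negNorm Ω (fun _ => 1) 0 s f < ⊤) :
    ENNReal.ofReal √(hlForm s hA hq (E Ω s A f q) (E Ω s A f q)) ≤
      ENNReal.ofReal (ds s * √(trConst s)) * negNorm Ω A q s f := by
  set U := E Ω s A f q with hU
  have hd := ds_pos (s := s)
  refine ofReal_sqrt_le_of_le ?_
  have h1 := abs_le_negNorm hA hq hq0 ha₀ hR0 hR i₀ f U (trL_mem_HsRef hR0 hR i₀ U)
  calc ENNReal.ofReal (hlForm s hA hq U U)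
      ≤ ENNReal.ofReal (ds s * |f ⟨trL Ω s U, trL_mem_HsRef hR0 hR i₀ U⟩|) := by
        refine ENNReal.ofReal_le_ofReal ?_
        rw [hU, E_spec hA hq hq0 ha₀ hR0 hR i₀ hf, pairing_eq hR0 hR i₀]
        exact mul_le_mul_of_nonneg_left (le_abs_self _) hd.le
    _ ≤ ENNReal.ofReal (ds s) * (negNorm Ω A q s f *
          ENNReal.ofReal (√(trConst s) * √(hlForm s hA hq U U))) := by
        rw [ENNReal.ofReal_mul hd.le]
        exact mul_le_mul_right h1 _
    _ = _ := by
        rw [ENNReal.ofReal_mul (by positivity), ENNReal.ofReal_mul hd.le]; ring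

/-- The energy estimate for the adjoint state. -/
lemma energy_adj_le (f : HsRef Ω s →ₗ[ℝ] ℝ) (z : L2 Ω) :
    ENNReal.ofReal √(hlForm s hA hq (adj Ω s A f z q) (adj Ω s A f z q)) ≤
      ENNReal.ofReal (ds s * √(trConst s)) * (ENNReal.ofReal (√(trConst s) / coerConst a₀ R) *
        ENNReal.ofReal √(hlForm s hA hq (E Ω s A f q) (E Ω s A f q)) +
        negNorm Ω A q s (l2Functional Ω s z)) := by
  set U := E Ω s A f q with hU
  set P := adj Ω s A f z q with hP
  have hd := ds_pos (s := s)
  have hk := coerConst_pos (R := R) ha₀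
  have htr : ∀ W : HL Ω s, ‖trL Ω s W‖ ≤
      √(trConst s) * ((√(coerConst a₀ R))⁻¹ * √(hlForm s hA hq W W)) := fun W =>
    (norm_trL_le W).trans (mul_le_mul_of_nonneg_left
      (norm_le_sqrt_hlForm hA hq hq0 ha₀ hR0 hR i₀ W) (by positivity))
  refine ofReal_sqrt_le_of_le ?_
  have h1 := abs_le_negNorm hA hq hq0 ha₀ hR0 hR i₀ (l2Functional Ω s z) P
    (trL_mem_HsRef hR0 hR i₀ P)
  set b := √(hlForm s hA hq P P) with hb
  set e := √(hlForm s hA hq U U) with he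
  have h2 : hlForm s hA hq P P ≤ ds s * (√(trConst s) * (√(trConst s) / coerConst a₀ R) * e * b +
      |l2Functional Ω s z ⟨trL Ω s P, trL_mem_HsRef hR0 hR i₀ P⟩|) := by
    have h3 : hlForm s hA hq P P = ds s * inner ℝ (trL Ω s U - z) (trL Ω s P) := by
      rw [hP, adj_spec hA hq hq0 ha₀ hR0 hR i₀]
    rw [h3, inner_sub_left]
    refine mul_le_mul_of_nonneg_left ?_ hd.le
    have h4 : inner ℝ (trL Ω s U) (trL Ω s P) ≤
        √(trConst s) * (√(trConst s) / coerConst a₀ R) * e * b := by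
      refine (real_inner_le_norm _ _).trans ((mul_le_mul (htr U) (htr P) (norm_nonneg _)
        (by positivity)).trans (le_of_eq ?_))
      have h5 : coerConst a₀ R = √(coerConst a₀ R) * √(coerConst a₀ R) :=
        (Real.mul_self_sqrt hk.le).symm
      have h6 : 0 < √(coerConst a₀ R) := Real.sqrt_pos.2 hk
      rw [← hb, ← he]
      conv_rhs => rw [h5]
      field_simp
    have h5 : -inner ℝ z (trL Ω s P) ≤
        |l2Functional Ω s z ⟨trL Ω s P, trL_mem_HsRef hR0 hR i₀ P⟩| :=
      (neg_le_abs (inner ℝ z (trL Ω s P)))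
    linarith
  calc ENNReal.ofReal (hlForm s hA hq P P)
      ≤ _ := ENNReal.ofReal_le_ofReal h2
    _ = ENNReal.ofReal (ds s) * (ENNReal.ofReal √(trConst s) *
          ENNReal.ofReal (√(trConst s) / coerConst a₀ R) * ENNReal.ofReal e * ENNReal.ofReal b +
          ENNReal.ofReal |l2Functional Ω s z ⟨trL Ω s P, trL_mem_HsRef hR0 hR i₀ P⟩|) := by
        rw [ENNReal.ofReal_mul hd.le, ENNReal.ofReal_add (by positivity) (abs_nonneg _),
          ENNReal.ofReal_mul (by positivity), ENNReal.ofReal_mul (by positivity),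
          ENNReal.ofReal_mul (by positivity)]
    _ ≤ ENNReal.ofReal (ds s) * (ENNReal.ofReal √(trConst s) *
          ENNReal.ofReal (√(trConst s) / coerConst a₀ R) * ENNReal.ofReal e * ENNReal.ofReal b +
          negNorm Ω A q s (l2Functional Ω s z) * ENNReal.ofReal (√(trConst s) * b)) := by
        gcongr
    _ = _ := by
        rw [ENNReal.ofReal_mul (by positivity), ENNReal.ofReal_mul hd.le]; ring

end

end

/-! ### Regularity of vertical averages of products -/

section

variable {d : ℕ} {Ω : Set (Rd d)} {s : ℝ}

lemma IsTest.mul {φ χ : Rd d → ℝ} (hφ : IsTest Ω φ) (hχ : IsTest Ω χ) :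
    IsTest Ω (fun x => φ x * χ x) :=
  ⟨hφ.1.mul hχ.1, hφ.2.1.mul_right, (tsupport_mul_subset_left).trans hφ.2.2⟩

lemma IsTest.fderiv_mul {φ χ : Rd d → ℝ} (hφ : IsTest Ω φ) (hχ : IsTest Ω χ) (x v : Rd d) :
    fderiv ℝ (fun x => φ x * χ x) x v = φ x * fderiv ℝ χ x v + fderiv ℝ φ x v * χ x := by
  rw [fderiv_fun_mul (hφ.diff x) (hχ.diff x)]
  simp [mul_comm]

section

variable [hs : Fact (s ∈ Ioo (0 : ℝ) 1)]

/-- Integration by parts in the horizontal variables against a test function on `Ω`. -/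
lemma mulForm_parts {φ : Rd d → ℝ} (hφ : IsTest Ω φ) (i : Fin d) (W V : HL Ω s) :
    mulForm (m := cylMeasure Ω s) _ (memLp_top_cyl (hφ.memLp_deriv (ei i) ⊤ _)) (cFn Ω s W)
        (cFn Ω s V) +
      mulForm _ (memLp_top_cyl (hφ.memLp ⊤ _)) (cDx Ω s i W) (cFn Ω s V) +
      mulForm _ (memLp_top_cyl (hφ.memLp ⊤ _)) (cFn Ω s W) (cDx Ω s i V) = 0 := by
  set M₁ := mulForm (m := cylMeasure Ω s) _ (memLp_top_cyl (hφ.memLp_deriv (ei i) ⊤ _)) with hM₁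
  set M₂ := mulForm (m := cylMeasure Ω s) _ (memLp_top_cyl (hφ.memLp ⊤ _)) with hM₂
  refine denseRange_hlJet.induction_on₂ (p := fun W V : HL Ω s => M₁ (cFn Ω s W) (cFn Ω s V) +
    M₂ (cDx Ω s i W) (cFn Ω s V) + M₂ (cFn Ω s W) (cDx Ω s i V) = 0)
    (isClosed_eq (by fun_prop) continuous_const) (fun ψ χ => ?_) W V
  change M₁ (cFn Ω s (cylJet Ω s ψ)) (cFn Ω s (cylJet Ω s χ)) +
    M₂ (cDx Ω s i (cylJet Ω s ψ)) (cFn Ω s (cylJet Ω s χ)) +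
    M₂ (cFn Ω s (cylJet Ω s ψ)) (cDx Ω s i (cylJet Ω s χ)) = 0
  have i1 := integrable_mul_mul (memLp_top_cyl (s := s) (hφ.memLp_deriv (ei i) ⊤ (volume.restrict Ω)))
    (Lp.memLp (cFn Ω s (cylJet Ω s ψ))) (Lp.memLp (cFn Ω s (cylJet Ω s χ)))
  have i2 := integrable_mul_mul (memLp_top_cyl (s := s) (hφ.memLp ⊤ (volume.restrict Ω)))
    (Lp.memLp (cDx Ω s i (cylJet Ω s ψ))) (Lp.memLp (cFn Ω s (cylJet Ω s χ)))
  have i3 := integrable_mul_mul (memLp_top_cyl (s := s) (hφ.memLp ⊤ (volume.restrict Ω)))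
    (Lp.memLp (cFn Ω s (cylJet Ω s ψ))) (Lp.memLp (cDx Ω s i (cylJet Ω s χ)))
  rw [hM₁, hM₂, mulForm_apply, mulForm_apply, mulForm_apply, ← integral_add i1 i2,
    ← integral_add (by exact i1.add i2) i3]
  set G : Rd d × ℝ → ℝ := fun p => fderiv ℝ (fun x => φ x * (ψ.1 (x, p.2) * χ.1 (x, p.2))) p.1
    (ei i) with hG
  have hae : (fun p => fderiv ℝ φ p.1 (ei i) * (cFn Ω s (cylJet Ω s ψ)) p *
        (cFn Ω s (cylJet Ω s χ)) p + φ p.1 * (cDx Ω s i (cylJet Ω s ψ)) p *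
        (cFn Ω s (cylJet Ω s χ)) p + φ p.1 * (cFn Ω s (cylJet Ω s ψ)) p *
        (cDx Ω s i (cylJet Ω s χ)) p) =ᵐ[cylMeasure Ω s] G := by
    filter_upwards [coeFn_cFn_jet (s := s) ψ, coeFn_cFn_jet (s := s) χ,
      coeFn_cDx_jet (s := s) ψ i, coeFn_cDx_jet (s := s) χ i] with p h1 h2 h3 h4
    have h5 := IsTest.fderiv_mul hφ
      (IsTest.mul (CylTests.slice ψ p.2).2 (CylTests.slice χ p.2).2) p.1 (ei i)
    have h6 := IsTest.fderiv_mul (CylTests.slice ψ p.2).2 (CylTests.slice χ p.2).2 p.1 (ei i)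
    rw [h6, fderiv_slice, fderiv_slice] at h5
    rw [h1, h2, h3, h4]
    refine Eq.trans ?_ h5.symm
    change _ = φ p.1 * (ψ.1 p * fderiv ℝ χ.1 p (ei i, 0) + fderiv ℝ ψ.1 p (ei i, 0) * χ.1 p) +
      fderiv ℝ φ p.1 (ei i) * (ψ.1 p * χ.1 p)
    ring
  have hGint : Integrable G (cylMeasure Ω s) := ((i1.add i2).add i3).congr hae
  rw [integral_congr_ae hae]
  have hFub : ∫ p, G p ∂(cylMeasure Ω s) = ∫ y, (∫ x in Ω, G (x, y)) ∂(wt s) :=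
    integral_prod_symm _ hGint
  rw [hFub]
  refine integral_eq_zero_of_ae (Filter.Eventually.of_forall fun y => ?_)
  exact (hφ.mul (IsTest.mul (CylTests.slice ψ y).2 (CylTests.slice χ y).2)).integral_fderiv (ei i)

end

lemma integral_mul_fiber_cyl {b : Rd d → ℝ} (hb : MemLp b ⊤ (volume.restrict Ω))
    (U V : Lp ℝ 2 (cylMeasure Ω s)) : ∫ x in Ω, b x * fiber (wt s) U V x =
      mulForm _ (memLp_top_cyl hb) U V :=
  integral_mul_fiber hb U V

/-- The gradient of the vertical average of `w v`. -/
def fiberGrad (W V : HL Ω s) (x : Rd d) : Rd d :=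
  WithLp.toLp 2 fun i => fiber (wt s) (cDx Ω s i W) (cFn Ω s V) x +
    fiber (wt s) (cDx Ω s i V) (cFn Ω s W) x

lemma fiber_comm {X Y : Type*} [MeasurableSpace Y] (ν : Measure Y) (U V : X × Y → ℝ) :
    fiber ν U V = fiber ν V U := by
  funext x; simp only [fiber, mul_comm]

lemma eLpNorm_euclidean_le {X : Type*} [MeasurableSpace X] {m : Measure X} {g : X → Rd d}
    (hg : ∀ i, AEStronglyMeasurable (fun x => g x i) m) :
    eLpNorm g 2 m ≤ ∑ i, eLpNorm (fun x => g x i) 2 m := by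
  have h1 : ∀ x, ‖g x‖ ≤ ‖∑ i, ‖g x i‖‖ := fun x => by
    rw [Real.norm_of_nonneg (Finset.sum_nonneg fun i _ => norm_nonneg _)]
    rw [EuclideanSpace.norm_eq]
    refine Real.sqrt_le_iff.2 ⟨Finset.sum_nonneg fun i _ => norm_nonneg _, ?_⟩
    exact Finset.sum_sq_le_sq_sum_of_nonneg fun i _ => norm_nonneg _
  refine (eLpNorm_mono h1).trans ?_
  have h2 : (fun x => ∑ i, ‖g x i‖) = ∑ i, fun x => ‖g x i‖ := by
    funext x; simp
  rw [h2]
  refine (eLpNorm_sum_le (fun i _ => (hg i).norm) (by norm_num)).trans (le_of_eq ?_)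
  exact Finset.sum_congr rfl fun i _ => eLpNorm_norm _

lemma aestronglyMeasurable_euclidean {X : Type*} [MeasurableSpace X] {m : Measure X} {g : X → Rd d}
    (hg : ∀ i, AEStronglyMeasurable (fun x => g x i) m) : AEStronglyMeasurable g m := by
  have : AEStronglyMeasurable (fun x => (WithLp.ofLp (g x) : Fin d → ℝ)) m :=
    (aemeasurable_pi_lambda _ fun i => (hg i).aemeasurable).aestronglyMeasurable
  exact ((EuclideanSpace.equiv (Fin d) ℝ).symm.continuous).comp_aestronglyMeasurable this

lemma enorm_cDx_le (i : Fin d) (U : CylJet Ω s) : ‖cDx Ω s i U‖ₑ ≤ ‖U‖ₑ := by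
  rw [enorm_le_iff_norm_le]
  exact (norm_cDx_le i U).trans (WithLp.norm_snd_le _ _)

lemma fiberGrad_comp_measurable (W V : HL Ω s) (i : Fin d) :
    AEStronglyMeasurable (fun x => fiberGrad W V x i) (volume.restrict Ω) :=
  ((fiber_integrable (Lp.memLp (cDx Ω s i W)) (Lp.memLp (cFn Ω s V))).1.add
    (fiber_integrable (Lp.memLp (cDx Ω s i V)) (Lp.memLp (cFn Ω s W))).1 :)

/-- Each product with a derivative is estimated by the Cauchy–Schwarz inequality in the fibres, with
the undifferentiated factor in `L^∞_x L^2_y`. -/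
lemma eLpNorm_fiberGrad_le (W V : HL Ω s) :
    eLpNorm (fiberGrad W V) 2 (volume.restrict Ω) ≤ d *
      (‖W‖ₑ * eLpNorm (fiber (wt s) (cFn Ω s V) (cFn Ω s V)) ⊤ (volume.restrict Ω) ^ (1 / 2 : ℝ) +
       ‖V‖ₑ * eLpNorm (fiber (wt s) (cFn Ω s W) (cFn Ω s W)) ⊤ (volume.restrict Ω) ^ (1 / 2 : ℝ))
      := by
  refine (eLpNorm_euclidean_le (fiberGrad_comp_measurable W V)).trans ?_
  suffices h : ∀ i, eLpNorm (fun x => fiberGrad W V x i) 2 (volume.restrict Ω) ≤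
      ‖W‖ₑ * eLpNorm (fiber (wt s) (cFn Ω s V) (cFn Ω s V)) ⊤ (volume.restrict Ω) ^ (1 / 2 : ℝ) +
      ‖V‖ₑ * eLpNorm (fiber (wt s) (cFn Ω s W) (cFn Ω s W)) ⊤ (volume.restrict Ω) ^ (1 / 2 : ℝ) by
    have := Finset.sum_le_card_nsmul Finset.univ _ _ fun i _ => h i
    rwa [Finset.card_univ, Fintype.card_fin, nsmul_eq_mul] at this
  intro i
  refine (eLpNorm_add_le (fiber_integrable (Lp.memLp (cDx Ω s i W)) (Lp.memLp (cFn Ω s V))).1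
    (fiber_integrable (Lp.memLp (cDx Ω s i V)) (Lp.memLp (cFn Ω s W))).1 (by norm_num)).trans ?_
  refine add_le_add ((eLpNorm_fiber_le _ _).trans ?_) ((eLpNorm_fiber_le _ _).trans ?_)
  · exact mul_le_mul_left (enorm_cDx_le i (W : CylJet Ω s)) _
  · exact mul_le_mul_left (enorm_cDx_le i (V : CylJet Ω s)) _

/-- Vertical averages of products of elements of the energy space are in `H¹(Ω)`, by the product rule
and integration by parts in the horizontal variables. -/
lemma isH1_fiber [hs : Fact (s ∈ Ioo (0 : ℝ) 1)] (W V : HL Ω s)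
    (hW : eLpNorm (fiber (wt s) (cFn Ω s W) (cFn Ω s W)) ⊤ (volume.restrict Ω) < ⊤)
    (hV : eLpNorm (fiber (wt s) (cFn Ω s V) (cFn Ω s V)) ⊤ (volume.restrict Ω) < ⊤) :
    IsH1 Ω (fiber (wt s) (cFn Ω s W) (cFn Ω s V)) (fiberGrad W V) := by
  have hWV := fiber_integrable (Lp.memLp (cFn Ω s W)) (Lp.memLp (cFn Ω s V))
  refine ⟨⟨hWV.1, (eLpNorm_fiber_le _ _).trans_lt (ENNReal.mul_lt_top enorm_lt_top
    (ENNReal.rpow_lt_top_of_nonneg (by norm_num) hV.ne))⟩,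
    ⟨aestronglyMeasurable_euclidean (fiberGrad_comp_measurable W V),
      (eLpNorm_fiberGrad_le W V).trans_lt (ENNReal.mul_lt_top (by simp) (ENNReal.add_lt_top.2
        ⟨ENNReal.mul_lt_top enorm_lt_top (ENNReal.rpow_lt_top_of_nonneg (by norm_num) hV.ne),
        ENNReal.mul_lt_top enorm_lt_top (ENNReal.rpow_lt_top_of_nonneg (by norm_num) hW.ne)⟩))⟩,
    fun φ hφ i => ?_⟩
  have h0 := mulForm_parts hφ i W V
  have i2 := (fiber_integrable (Lp.memLp (cDx Ω s i W)) (Lp.memLp (cFn Ω s V)))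
  have i3 := (fiber_integrable (Lp.memLp (cFn Ω s W)) (Lp.memLp (cDx Ω s i V)))
  have e1 := integral_mul_fiber_cyl (hφ.memLp_deriv (ei i) ⊤ (volume.restrict Ω)) (cFn Ω s W)
    (cFn Ω s V)
  have e2 := integral_mul_fiber_cyl (hφ.memLp ⊤ (volume.restrict Ω)) (cDx Ω s i W) (cFn Ω s V)
  have e3 := integral_mul_fiber_cyl (hφ.memLp ⊤ (volume.restrict Ω)) (cFn Ω s W) (cDx Ω s i V)
  have hmem := hφ.memLp ⊤ (volume.restrict Ω)
  have e4 : ∫ x in Ω, fiberGrad W V x i * φ x =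
      (∫ x in Ω, φ x * fiber (wt s) (cDx Ω s i W) (cFn Ω s V) x) +
        ∫ x in Ω, φ x * fiber (wt s) (cFn Ω s W) (cDx Ω s i V) x := by
    rw [← integral_add]
    · refine integral_congr_ae (Filter.Eventually.of_forall fun x => ?_)
      simp only [fiberGrad, fiber_comm (wt s) (cDx Ω s i V) (cFn Ω s W)]
      ring
    · exact i2.mul_of_top_right hmem
    · exact i3.mul_of_top_right hmem
  have e5 : ∫ x in Ω, fiber (wt s) (cFn Ω s W) (cFn Ω s V) x * (gradient φ x) i =
      ∫ x in Ω, fderiv ℝ φ x (ei i) * fiber (wt s) (cFn Ω s W) (cFn Ω s V) x :=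
    integral_congr_ae (Filter.Eventually.of_forall fun x => by
      simp only [gradient_apply]; ring)
  rw [e5, e4, e1, e2, e3]
  refine eq_neg_of_add_eq_zero_left ?_
  rw [← add_assoc]
  exact h0

end

/-! ### The first-order optimality condition -/

section

variable {d : ℕ} {Ω : Set (Rd d)} {s : ℝ}

lemma Adm.add_smul_sub {qbar : ℝ} {q h : L2 Ω} (hq : q ∈ Adm Ω qbar) (hh : h ∈ Adm Ω qbar) {t : ℝ}
    (ht0 : 0 ≤ t) (ht1 : t ≤ 1) : q + t • (h - q) ∈ Adm Ω qbar := by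
  have h1 : ∀ᵐ x ∂(volume.restrict Ω), 0 ≤ q x ∧ q x ≤ qbar := hq
  have h2 : ∀ᵐ x ∂(volume.restrict Ω), 0 ≤ h x ∧ h x ≤ qbar := hh
  change ∀ᵐ x ∂(volume.restrict Ω), _
  filter_upwards [h1, h2, Lp.coeFn_add q (t • (h - q)), Lp.coeFn_smul t (h - q),
    Lp.coeFn_sub h q] with x a b e1 e2 e3
  rw [e1, Pi.add_apply, e2, Pi.smul_apply, e3, Pi.sub_apply, smul_eq_mul]
  constructor <;> nlinarith

/-- The form `(W, Φ) ↦ ∫ y^α b W Φ` on the energy space. -/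
def potForm (s : ℝ) {b : L2 Ω} (hb : MemLp b ⊤ (volume.restrict Ω)) :
    HL Ω s →L[ℝ] HL Ω s →L[ℝ] ℝ :=
  (mulForm _ (memLp_top_cyl (s := s) hb)).bilinearComp ((cFn Ω s).comp (HL Ω s).subtypeL)
    ((cFn Ω s).comp (HL Ω s).subtypeL)

lemma exists_potForm_bound {b : L2 Ω} (hb : MemLp b ⊤ (volume.restrict Ω)) :
    ∃ c, 0 ≤ c ∧ ∀ W Φ : HL Ω s, |potForm s hb W Φ| ≤ c * ‖W‖ * ‖Φ‖ := by
  refine ⟨‖mulForm _ (memLp_top_cyl (s := s) hb)‖, ContinuousLinearMap.opNorm_nonneg _, fun W Φ => ?_⟩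
  refine ((mulForm _ (memLp_top_cyl (s := s) hb)).le_opNorm₂ (cFn Ω s W) (cFn Ω s Φ)).trans ?_
  have h : ∀ W : HL Ω s, ‖cFn Ω s W‖ ≤ ‖W‖ := fun W => WithLp.norm_fst_le _ (W : CylJet Ω s)
  gcongr
  · exact h W
  · exact h Φ

section

variable {A : Rd d → Matrix (Fin d) (Fin d) ℝ} {a₀ : ℝ} (hA : IsDiffusion Ω a₀ A)

lemma hlForm_add_smul {q b : L2 Ω} {t : ℝ} (hq : MemLp q ⊤ (volume.restrict Ω))
    (hb : MemLp b ⊤ (volume.restrict Ω)) (hqt : MemLp (q + t • b : L2 Ω) ⊤ (volume.restrict Ω))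
    (W Φ : HL Ω s) :
    hlForm s hA hqt W Φ = hlForm s hA hq W Φ + t * potForm s hb W Φ := by
  have key : mulForm _ (memLp_top_cyl hqt) (cFn Ω s W) (cFn Ω s Φ) =
      mulForm _ (memLp_top_cyl hq) (cFn Ω s W) (cFn Ω s Φ) +
        t * mulForm _ (memLp_top_cyl hb) (cFn Ω s W) (cFn Ω s Φ) := by
    rw [mulForm_apply, mulForm_apply, mulForm_apply, ← integral_const_mul, ← integral_add
      (integrable_mul_mul (memLp_top_cyl hq) (Lp.memLp _) (Lp.memLp _))
      ((integrable_mul_mul (memLp_top_cyl hb) (Lp.memLp _) (Lp.memLp _)).const_mul t)]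
    refine integral_congr_ae ?_
    filter_upwards [ae_cyl (Lp.coeFn_add q (t • b)), ae_cyl (Lp.coeFn_smul t b)] with p e1 e2
    rw [e1, Pi.add_apply, e2, Pi.smul_apply, smul_eq_mul]; ring
  change cylForm s hA hqt W Φ = cylForm s hA hq W Φ +
    t * mulForm _ (memLp_top_cyl hb) (cFn Ω s W) (cFn Ω s Φ)
  simp only [cylForm, add_apply, sum_apply, ContinuousLinearMap.bilinearComp_apply]
  rw [key]; ring

end

lemma nonneg_of_eventually {L K t₀ : ℝ} (ht₀ : 0 < t₀)
    (h : ∀ t, 0 < t → t < t₀ → 0 ≤ t * L + t ^ 2 * K) : 0 ≤ L := by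
  have hlim : Filter.Tendsto (fun t : ℝ => L + t * K) (nhdsWithin 0 (Ioi 0)) (nhds L) := by
    have : Filter.Tendsto (fun t : ℝ => L + t * K) (nhds 0) (nhds (L + 0 * K)) :=
      (by fun_prop : Continuous fun t : ℝ => L + t * K).tendsto 0
    rw [zero_mul, add_zero] at this
    exact this.mono_left nhdsWithin_le_nhds
  refine ge_of_tendsto hlim ?_
  filter_upwards [Ioo_mem_nhdsGT ht₀] with t ht
  have h1 := h t ht.1 ht.2
  have h2 : 0 ≤ t * (L + t * K) := by nlinarith
  exact nonneg_of_mul_nonneg_right h2 ht.1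

lemma norm_le_div_of_coercive {V : Type*} [SeminormedAddCommGroup V] {κ y v : ℝ} (hκ : 0 < κ)
    (hy : 0 ≤ y) {W : V} (h : κ * ‖W‖ ^ 2 ≤ v) (hv : v ≤ y * ‖W‖) : ‖W‖ ≤ y / κ := by
  rw [le_div_iff₀ hκ]
  rcases (norm_nonneg W).eq_or_lt with h0 | h0
  · rw [← h0]; simpa using hy
  · exact le_of_mul_le_mul_right (by nlinarith : ‖W‖ * κ * ‖W‖ ≤ y * ‖W‖) h0

/-- The first-order condition for the reduced quadratic functional
`½ ‖T U(t) - z‖² + (ρ/2) ‖w + t b‖²` along a curve of states `U(t)` that is Lipschitz at `t = 0`;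
`π` is the adjoint representation of the derivative of the states. -/
lemma first_order_condition {V H : Type*} [NormedAddCommGroup V] [NormedSpace ℝ V]
    [NormedAddCommGroup H] [InnerProductSpace ℝ H] (T : V →L[ℝ] H) (π : V →L[ℝ] ℝ)
    {κ N M δ ρ t₀ : ℝ} (hκ : 0 ≤ κ) (hN : 0 ≤ N) (hδ : 0 < δ) (ht₀ : 0 < t₀)
    (ht₀1 : t₀ ≤ 1) {U : ℝ → V} {U₀ : V} {z w b : H}
    (hT : ∀ D, ‖T D‖ ≤ κ * ‖D‖) (hπ : ∀ D, |π D| ≤ N * ‖D‖)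
    (hD : ∀ t, 0 ≤ t → t ≤ 1 → ‖U t - U₀‖ ≤ t * M)
    (hadj : ∀ t, 0 ≤ t → t ≤ 1 → δ * inner ℝ (T U₀ - z) (T (U t - U₀)) = -t * π (U t))
    (hmin : ∀ t, 0 < t → t < t₀ → 1 / 2 * ‖T U₀ - z‖ ^ 2 + ρ / 2 * ‖w‖ ^ 2 ≤
      1 / 2 * ‖T (U t) - z‖ ^ 2 + ρ / 2 * ‖w + t • b‖ ^ 2) :
    0 ≤ -(1 / δ) * π U₀ + ρ * inner ℝ w b := by
  refine nonneg_of_eventually (t₀ := t₀)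
    (K := (1 / δ) * (N * M) + 1 / 2 * (κ * M) ^ 2 + ρ / 2 * ‖b‖ ^ 2) ht₀ fun t ht htlt => ?_
  have ht1 : t ≤ 1 := htlt.le.trans ht₀1
  have hcost := hmin t ht htlt
  have h1 := hD t ht.le ht1
  have h2 := hadj t ht.le ht1
  obtain ⟨D, hUD⟩ : ∃ D, U t = U₀ + D := ⟨U t - U₀, by abel⟩
  rw [hUD, add_sub_cancel_left] at h1 h2
  rw [hUD] at hcost
  have e1 : ‖T (U₀ + D) - z‖ ^ 2 = ‖T U₀ - z‖ ^ 2 + 2 * inner ℝ (T U₀ - z) (T D) + ‖T D‖ ^ 2 := by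
    rw [map_add, add_sub_right_comm, norm_add_sq_real]
  have e2 : ‖w + t • b‖ ^ 2 = ‖w‖ ^ 2 + 2 * (t * inner ℝ w b) + t ^ 2 * ‖b‖ ^ 2 := by
    rw [norm_add_sq_real, inner_smul_right, norm_smul, mul_pow, Real.norm_eq_abs, sq_abs]
  have e3 : inner ℝ (T U₀ - z) (T D) = (1 / δ) * (-t * (π U₀ + π D)) := by
    rw [← map_add, ← h2]; field_simp
  have b1 : ‖T D‖ ≤ t * (κ * M) := by
    refine (hT D).trans ?_
    rw [mul_left_comm]
    exact mul_le_mul_of_nonneg_left h1 hκ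
  have b2 : ‖T D‖ ^ 2 ≤ (t * (κ * M)) ^ 2 := pow_le_pow_left₀ (norm_nonneg _) b1 2
  have b3 : -π D ≤ t * (N * M) := by
    refine (neg_le_abs _).trans ((hπ D).trans ?_)
    rw [mul_left_comm]
    exact mul_le_mul_of_nonneg_left h1 hN
  have b4 : (1 / δ) * (-t * π D) ≤ (1 / δ) * (t * (t * (N * M))) := by
    refine mul_le_mul_of_nonneg_left ?_ (by positivity)
    nlinarith
  rw [e1, e2, e3] at hcost
  nlinarith

section

variable [hs : Fact (s ∈ Ioo (0 : ℝ) 1)]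
  {A : Rd d → Matrix (Fin d) (Fin d) ℝ} {a₀ : ℝ} (hA : IsDiffusion Ω a₀ A) (ha₀ : 0 < a₀)
  {R : ℝ} (hR0 : 0 < R) (hR : Ω ⊆ Metric.closedBall 0 R) (i₀ : Fin d)

include ha₀ hR0 hR i₀

/-- The solutions with the same source for two coefficients `q` and `q + t b`: their difference
solves the equation with source `-t b U`, and it is of order `t`. -/
lemma norm_sub_le_of_solutions {q b : L2 Ω} {t c K : ℝ} (hq : MemLp q ⊤ (volume.restrict Ω))
    (hq0 : ∀ᵐ x ∂(volume.restrict Ω), 0 ≤ q x) (hb : MemLp b ⊤ (volume.restrict Ω))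
    (hqt : MemLp (q + t • b : L2 Ω) ⊤ (volume.restrict Ω))
    (hqt0 : ∀ᵐ x ∂(volume.restrict Ω), 0 ≤ (q + t • b : L2 Ω) x) (ht : 0 ≤ t) (hK : 0 ≤ K)
    (hc0 : 0 ≤ c) (hc : ∀ W Φ : HL Ω s, |potForm s hb W Φ| ≤ c * ‖W‖ * ‖Φ‖)
    {l : HL Ω s → ℝ} (hl : ∀ Φ, |l Φ| ≤ K * ‖Φ‖) {U U₀ : HL Ω s}
    (hU : ∀ Φ, hlForm s hA hqt U Φ = l Φ) (hU₀ : ∀ Φ, hlForm s hA hq U₀ Φ = l Φ) :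
    ‖U - U₀‖ ≤ t * (c * (K / coerConst a₀ R) / coerConst a₀ R) ∧
      ∀ Φ, hlForm s hA hq (U - U₀) Φ = -t * potForm s hb U Φ := by
  have hκ0 : 0 < coerConst a₀ R := coerConst_pos ha₀
  have hUn : ‖U‖ ≤ K / coerConst a₀ R := by
    refine norm_le_div_of_coercive hκ0 hK
      (hlForm_coercive hA hqt hqt0 ha₀ hR0 hR i₀ U) ?_
    rw [hU]
    exact (le_abs_self _).trans (hl _)
  have heq : ∀ Φ, hlForm s hA hq (U - U₀) Φ = -t * potForm s hb U Φ := fun Φ => by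
    have h1 := hU Φ
    rw [← hU₀ Φ, hlForm_add_smul hA hq hb] at h1
    rw [map_sub (hlForm s hA hq), sub_apply]
    linarith
  refine ⟨?_, heq⟩
  have h1 : ‖U - U₀‖ ≤ t * c * (K / coerConst a₀ R) / coerConst a₀ R := by
    refine norm_le_div_of_coercive hκ0 (by positivity)
      (hlForm_coercive hA hq hq0 ha₀ hR0 hR i₀ (U - U₀)) ?_
    rw [heq]
    have h2 := hc U (U - U₀)
    have h3 : -potForm s hb U (U - U₀) ≤ c * (K / coerConst a₀ R) * ‖U - U₀‖ :=
      (neg_le_abs _).trans (h2.trans (by gcongr))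
    have h4 := mul_le_mul_of_nonneg_left h3 ht
    linarith
  refine h1.trans (le_of_eq ?_)
  ring

variable {f : HsRef Ω s →ₗ[ℝ] ℝ} (hf : negNorm Ω (fun _ => 1) 0 s f < ⊤)

include hA hf

/-- The variational inequality satisfied by a local solution. -/
lemma variational_inequality {qbar ρ : ℝ} {z qstar q h : L2 Ω}
    (hloc : IsLocalSolution Ω s A f z qstar ρ qbar q) (hh : h ∈ Adm Ω qbar)
    (hb : MemLp (h - q : L2 Ω) ⊤ (volume.restrict Ω)) :
    0 ≤ -(1 / ds s) * potForm s hb (E Ω s A f q) (adj Ω s A f z q) +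
      ρ * inner ℝ (q - qstar) (h - q) := by
  obtain ⟨hq, ε, hε, hmin⟩ := hloc
  obtain ⟨c, hc0, hc⟩ := exists_potForm_bound (s := s) hb
  obtain ⟨l, hl⟩ := exists_source hR0 hR i₀ hf
  obtain ⟨K, hK0, hK⟩ := l.bound
  have hd := ds_pos (s := s)
  have hlK : ∀ Φ : HL Ω s, |ds s * pairing Ω s f (tr Ω s Φ)| ≤ ds s * K * ‖Φ‖ := fun Φ => by
    rw [← hl, abs_mul, abs_of_pos hd, mul_assoc]
    exact mul_le_mul_of_nonneg_left (hK Φ) hd.le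
  have hD := fun t (ht0 : 0 ≤ t) (ht1 : t ≤ 1) =>
    norm_sub_le_of_solutions hA ha₀ hR0 hR i₀ (Adm.memLp hq) (Adm.nonneg hq) hb
      (Adm.memLp (Adm.add_smul_sub hq hh ht0 ht1)) (Adm.nonneg (Adm.add_smul_sub hq hh ht0 ht1))
      ht0 (mul_nonneg hd.le hK0.le) hc0 hc hlK
      (E_spec hA (Adm.memLp (Adm.add_smul_sub hq hh ht0 ht1))
        (Adm.nonneg (Adm.add_smul_sub hq hh ht0 ht1)) ha₀ hR0 hR i₀ hf)
      (E_spec hA (Adm.memLp hq) (Adm.nonneg hq) ha₀ hR0 hR i₀ hf)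
  have hadj := adj_spec hA (Adm.memLp hq) (Adm.nonneg hq) ha₀ hR0 hR i₀ f z
  have hπ : ∀ D, |(potForm s hb).flip (adj Ω s A f z q) D| ≤ c * ‖adj Ω s A f z q‖ * ‖D‖ :=
    fun D => (hc D _).trans_eq (mul_right_comm _ _ _)
  have hres := first_order_condition (trL Ω s) ((potForm s hb).flip (adj Ω s A f z q))
    (κ := √(trConst s)) (N := c * ‖adj Ω s A f z q‖) (t₀ := min 1 (ε / (‖h - q‖ + 1)))
    (U := fun t => E Ω s A f (q + t • (h - q))) (U₀ := E Ω s A f q) (z := z) (δ := ds s) (ρ := ρ)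
    (w := q - qstar) (b := h - q) (M := c * (ds s * K / coerConst a₀ R) / coerConst a₀ R)
    (Real.sqrt_nonneg _) (by positivity) hd (lt_min one_pos (by positivity)) (min_le_left _ _)
    norm_trL_le hπ (fun t ht0 ht1 => (hD t ht0 ht1).1)
    (fun t ht0 ht1 => (hadj _).symm.trans ((hD t ht0 ht1).2 _))
  refine hres fun t ht htlt => ?_
  have ht1 : t ≤ 1 := (htlt.trans_le (min_le_left _ _)).le
  have ht2 : t * (‖h - q‖ + 1) < ε :=
    (lt_div_iff₀ (by positivity)).1 (htlt.trans_le (min_le_right _ _))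
  have hclose : ‖q + t • (h - q) - q‖ < ε := by
    rw [add_sub_cancel_left, norm_smul, Real.norm_of_nonneg ht.le]
    nlinarith
  have hcost := hmin _ (Adm.add_smul_sub hq hh ht.le ht1) hclose
  simp only [cost, tr_eq] at hcost
  rw [add_sub_right_comm] at hcost
  exact hcost

end

/-- The projection of `u` onto `[0, b]`. -/
def clip (b u : ℝ) : ℝ := max 0 (min u b)

lemma clip_nonneg (b u : ℝ) : 0 ≤ clip b u := le_max_left _ _

lemma clip_le {b : ℝ} (hb : 0 ≤ b) (u : ℝ) : clip b u ≤ b := max_le hb (min_le_right _ _)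

lemma abs_clip_sub_le (b u v : ℝ) : |clip b u - clip b v| ≤ |u - v| := by
  refine (abs_max_sub_max_le_max 0 (min u b) 0 (min v b)).trans (max_le (by simp) ?_)
  refine (abs_min_sub_min_le_max u b v b).trans (max_le le_rfl (by simp))

lemma clip_zero {b : ℝ} (hb : 0 ≤ b) : clip b 0 = 0 := by simp [clip, hb]

lemma continuous_clip (b : ℝ) : Continuous (clip b) := by unfold clip; fun_prop

/-- The variational characterization of the projection. -/
lemma clip_sub_mul_le {b : ℝ} (hb : 0 ≤ b) (u : ℝ) {q : ℝ} (h0 : 0 ≤ q) (h1 : q ≤ b) :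
    (clip b u - q) * (q - u) ≤ -(clip b u - q) ^ 2 := by
  unfold clip
  rcases le_total u b with hub | hub
  · rw [min_eq_left hub]
    rcases le_total 0 u with hu | hu
    · rw [max_eq_right hu]; nlinarith
    · rw [max_eq_left hu]; nlinarith
  · rw [min_eq_right hub, max_eq_right hb]; nlinarith

lemma memLp_clip {X : Type*} [MeasurableSpace X] {m : Measure X} {b : ℝ} (hb : 0 ≤ b) {u : X → ℝ}
    (hu : MemLp u 2 m) : MemLp (fun x => clip b (u x)) 2 m := by
  refine hu.of_le ((continuous_clip b).comp_aestronglyMeasurable hu.1)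
    (Filter.Eventually.of_forall fun x => ?_)
  have := abs_clip_sub_le b (u x) 0
  rwa [clip_zero hb, sub_zero, sub_zero] at this

/-- A coefficient that satisfies the variational inequality is the projection of the minimizer of
the unconstrained linearized problem. -/
lemma eq_clip_of_variational {qbar ρ : ℝ} (hqbar : 0 < qbar) (hρ : 0 < ρ) {q qstar : L2 Ω}
    {p : Rd d → ℝ} (hp : MemLp p 2 (volume.restrict Ω)) (hq : q ∈ Adm Ω qbar)
    (hvar : ∀ h ∈ Adm Ω qbar, 0 ≤ ∫ x in Ω, (h - q : L2 Ω) x * (p x + ρ * (q x - qstar x))) :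
    q =ᵐ[volume.restrict Ω] fun x => clip qbar (qstar x - ρ⁻¹ * p x) := by
  have hu : MemLp (fun x => qstar x - ρ⁻¹ * p x) 2 (volume.restrict Ω) :=
    (Lp.memLp qstar).sub (hp.const_mul _)
  have hcu := memLp_clip hqbar.le hu
  have hadm : hcu.toLp _ ∈ Adm Ω qbar := by
    change ∀ᵐ x ∂(volume.restrict Ω), _
    filter_upwards [hcu.coeFn_toLp] with x hx
    rw [hx]
    exact ⟨clip_nonneg _ _, clip_le hqbar.le _⟩
  have h0 := hvar _ hadm
  have hq' : ∀ᵐ x ∂(volume.restrict Ω), 0 ≤ q x ∧ q x ≤ qbar := hq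
  set w : L2 Ω := hcu.toLp _ - q with hw
  have hwx : ∀ᵐ x ∂(volume.restrict Ω), w x = clip qbar (qstar x - ρ⁻¹ * p x) - q x := by
    filter_upwards [hcu.coeFn_toLp, Lp.coeFn_sub (hcu.toLp _) q] with x h1 h2
    rw [hw, h2, Pi.sub_apply, h1]
  have hm2 : MemLp (fun x => p x + ρ * (q x - qstar x)) 2 (volume.restrict Ω) :=
    hp.add (((Lp.memLp q).sub (Lp.memLp qstar)).const_mul ρ)
  have hle : ∫ x in Ω, w x * (p x + ρ * (q x - qstar x)) ≤ ∫ x in Ω, -ρ * w x ^ 2 := by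
    refine integral_mono_ae ((Lp.memLp w).integrable_mul hm2)
      ((Lp.memLp w).integrable_sq.const_mul _) ?_
    filter_upwards [hwx, hq'] with x h1 h2
    have h3 := clip_sub_mul_le hqbar.le (qstar x - ρ⁻¹ * p x) h2.1 h2.2
    rw [← h1] at h3
    have h4 : p x + ρ * (q x - qstar x) = ρ * (q x - (qstar x - ρ⁻¹ * p x)) := by
      field_simp; ring
    simp only [h4]
    nlinarith
  rw [integral_const_mul, ← norm_sq_L2_eq] at hle
  have hw0 : w = 0 := by
    have : ‖w‖ ^ 2 ≤ 0 := by nlinarith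
    exact norm_eq_zero.1 (pow_eq_zero_iff (two_ne_zero) |>.1 (le_antisymm this (sq_nonneg _)))
  filter_upwards [hwx, (Lp.coeFn_zero ℝ 2 (volume.restrict Ω))] with x h1 h2
  rw [hw0, h2] at h1
  simp only [Pi.zero_apply] at h1
  linarith

end

/-! ### Contractions act on `H¹(Ω)` -/

section

variable {d : ℕ} {Ω : Set (Rd d)}

section Duality

variable {X : Type*} [MeasurableSpace X] {m : Measure X}

lemma integrable_mul_of_memLp {f g : X → ℝ} (hf : MemLp f 2 m) (hg : MemLp g 2 m) :
    Integrable (fun x => f x * g x) m := hf.integrable_mul hg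

lemma abs_integral_mul_le {f g : X → ℝ} (hf : MemLp f 2 m) (hg : MemLp g 2 m) :
    |∫ x, f x * g x ∂m| ≤ (eLpNorm f 2 m).toReal * (eLpNorm g 2 m).toReal := by
  have h := abs_real_inner_le_norm (hf.toLp f) (hg.toLp g)
  rw [Lp.norm_toLp, Lp.norm_toLp] at h
  rwa [inner_toLp] at h

/-- An `L²` function that is bounded in `L²` as a functional on `C_c^∞(ℝ^d)`. -/
lemma eLpNorm_le_of_abs_integral_mul_le {f : Rd d → ℝ} (hf : MemLp f 2 volume) {c : ℝ} (hc : 0 ≤ c)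
    (h : ∀ ψ : Rd d → ℝ, ContDiff ℝ ∞ ψ → HasCompactSupport ψ →
      |∫ x, f x * ψ x| ≤ c * (eLpNorm ψ 2 volume).toReal) :
    (eLpNorm f 2 volume).toReal ≤ c := by
  have key : ∀ G : Lp ℝ 2 (volume : Measure (Rd d)), |inner ℝ (hf.toLp f) G| ≤ c * ‖G‖ := by
    intro G
    refine (Lp.dense_hasCompactSupport_contDiff (F := ℝ) (p := 2) (μ := (volume : Measure (Rd d)))
      (by norm_num)).induction ?_ (isClosed_le (by fun_prop) (by fun_prop)) G
    rintro G ⟨ψ, hψ, hψc, hψs⟩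
    have hm : MemLp ψ 2 (volume : Measure (Rd d)) :=
      hψs.continuous.memLp_of_hasCompactSupport hψc
    have e : G = hm.toLp ψ := Lp.ext (hψ.trans hm.coeFn_toLp.symm)
    rw [e, inner_toLp, Lp.norm_toLp]
    exact h ψ hψs hψc
  rw [← Lp.norm_toLp f hf]
  have h1 := key (hf.toLp f)
  rw [real_inner_self_eq_norm_sq, abs_of_nonneg (sq_nonneg _), sq] at h1
  rcases (norm_nonneg (hf.toLp f)).eq_or_lt with h0 | h0
  · rwa [← h0]
  · exact le_of_mul_le_mul_right h1 h0

end Duality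

/-- A functional that is bounded with respect to the Hilbert norm of `e v` is represented by a
vector. -/
lemma exists_riesz_of_bound {V H : Type*} [AddCommGroup V] [Module ℝ V] [NormedAddCommGroup H]
    [InnerProductSpace ℝ H] [CompleteSpace H] (e : V →ₗ[ℝ] H) (l : V →ₗ[ℝ] ℝ) {c : ℝ}
    (hc : 0 ≤ c) (h : ∀ v, |l v| ≤ c * ‖e v‖) :
    ∃ G : H, ‖G‖ ≤ c ∧ ∀ v, l v = inner ℝ G (e v) := by
  set K := (LinearMap.range e).topologicalClosure with hK
  have hmem : ∀ v, e v ∈ K := fun v =>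
    Submodule.le_topologicalClosure _ (LinearMap.mem_range_self e v)
  set e' : V →ₗ[ℝ] K := e.codRestrict K hmem with he'
  have hdense : DenseRange e' := by
    rintro ⟨x, hx⟩
    rw [closure_subtype]
    have : (Subtype.val '' range e') = (LinearMap.range e : Set H) := by
      ext y; simp [he']
    rw [this]
    exact hx
  have h' : ∀ v, ‖l v‖ ≤ c * ‖e' v‖ := h
  have : CompleteSpace K := (Submodule.isClosed_topologicalClosure _).completeSpace_coe
  refine ⟨((InnerProductSpace.toDual ℝ K).symm (l.extendOfNorm e') : K), ?_, fun v => ?_⟩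
  · rw [← Submodule.coe_norm, LinearIsometryEquiv.norm_map]
    exact LinearMap.opNorm_extendOfNorm_le hdense hc h'
  · have h1 : inner ℝ ((InnerProductSpace.toDual ℝ K).symm (l.extendOfNorm e')) (e' v) = l v := by
      rw [InnerProductSpace.toDual_symm_apply, LinearMap.extendOfNorm_eq hdense ⟨c, h'⟩]
    exact h1.symm

lemma isTest_translate {K : Set (Rd d)} {δ : ℝ} (hK : Metric.cthickening δ K ⊆ Ω) {φ : Rd d → ℝ}
    (hφ : ContDiff ℝ ∞ φ) (hφc : HasCompactSupport φ) (hφK : tsupport φ ⊆ K) {a : Rd d}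
    (ha : ‖a‖ ≤ δ) : IsTest Ω fun x => φ (x - a) := by
  refine ⟨hφ.comp (contDiff_id.sub contDiff_const),
    hφc.comp_homeomorph (Homeomorph.subRight a), fun x hx => hK ?_⟩
  have h1 : x - a ∈ tsupport φ := by
    have := tsupport_comp_eq_preimage φ (Homeomorph.subRight a)
    change x ∈ tsupport (φ ∘ Homeomorph.subRight a) at hx
    rw [this] at hx
    exact hx
  refine Metric.mem_cthickening_of_dist_le x (x - a) δ K (hφK h1) ?_
  rwa [dist_eq_norm, sub_sub_cancel]

lemma integral_mul_translate (hΩ : MeasurableSet Ω) (u φ : Rd d → ℝ) (a : Rd d) :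
    ∫ x in Ω, u x * φ (x - a) = ∫ x, Ω.indicator u (x + a) * φ x := by
  rw [← integral_indicator hΩ, ← integral_add_right_eq_self _ a]
  refine integral_congr_ae (Filter.Eventually.of_forall fun x => ?_)
  by_cases h : x + a ∈ Ω <;> simp [h]

lemma memLp_indicator_translate (hΩ : MeasurableSet Ω) {u : Rd d → ℝ}
    (hu : MemLp u 2 (volume.restrict Ω)) (a : Rd d) :
    MemLp (fun x => Ω.indicator u (x + a)) 2 volume :=
  ((memLp_indicator_iff_restrict hΩ).2 hu).comp_measurePreserving
    (measurePreserving_add_right volume a)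

lemma hasDerivAt_integral_translate {u φ : Rd d → ℝ} (hu : Integrable u (volume.restrict Ω))
    (hφ : ContDiff ℝ ∞ φ) (hφc : HasCompactSupport φ) (v : Rd d) (t : ℝ) :
    HasDerivAt (fun t : ℝ => ∫ x in Ω, u x * φ (x - t • v))
      (∫ x in Ω, u x * -fderiv ℝ φ (x - t • v) v) t := by
  have hφ1 : Continuous (fderiv ℝ φ) := hφ.continuous_fderiv (by simp)
  obtain ⟨C, hC⟩ := (hφc.fderiv ℝ).exists_bound_of_continuous hφ1
  obtain ⟨C', hC'⟩ := hφc.exists_bound_of_continuous hφ.continuous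
  refine (hasDerivAt_integral_of_dominated_loc_of_deriv_le (bound := fun x => |u x| * (C * ‖v‖))
    (F' := fun t x => u x * -fderiv ℝ φ (x - t • v) v) Filter.univ_mem
    (Filter.Eventually.of_forall fun t => ?_) ?_ ?_
    (Filter.Eventually.of_forall fun x t _ => ?_) (hu.abs.mul_const _)
    (Filter.Eventually.of_forall fun x t _ => ?_)).2
  · exact hu.1.mul (hφ.continuous.comp (by fun_prop)).aestronglyMeasurable
  · refine hu.mul_bdd (c := C') (hφ.continuous.comp (by fun_prop)).aestronglyMeasurable
      (Filter.Eventually.of_forall fun x => hC' _)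
  · exact hu.1.mul ((hφ1.comp (by fun_prop)).clm_apply continuous_const).neg.aestronglyMeasurable
  · rw [norm_mul, norm_neg, Real.norm_eq_abs (u x)]
    gcongr
    exact (ContinuousLinearMap.le_opNorm _ _).trans (by gcongr; exact hC _)
  · refine HasDerivAt.const_mul _ ?_
    have h1 : HasDerivAt (fun t : ℝ => x - t • v) (-v) t := by
      simpa using ((hasDerivAt_id t).smul_const v).const_sub x
    have h2 := ((hφ.differentiable (by simp)) (x - t • v)).hasFDerivAt.comp_hasDerivAt t h1
    rwa [map_neg] at h2

section

variable {u : Rd d → ℝ} {g : Rd d → Rd d} {K : Set (Rd d)} {δ : ℝ}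

lemma memLp_comp_i {m : Measure (Rd d)} (hg : MemLp g 2 m) (i : Fin d) :
    MemLp (fun x => g x i) 2 m :=
  hg.of_le ((EuclideanSpace.proj (𝕜 := ℝ) i).continuous.comp_aestronglyMeasurable hg.1)
    (Filter.Eventually.of_forall fun x => PiLp.norm_apply_le (g x) i)

lemma eLpNorm_translate_le {φ : Rd d → ℝ} (hφ : MemLp φ 2 volume) (a : Rd d) :
    (eLpNorm (fun x => φ (x - a)) 2 (volume.restrict Ω)).toReal ≤ (eLpNorm φ 2 volume).toReal := by
  refine ENNReal.toReal_mono hφ.2.ne ((eLpNorm_mono_measure _ Measure.restrict_le_self).trans ?_)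
  exact (eLpNorm_comp_measurePreserving hφ.1 (measurePreserving_sub_right volume a)).le

/-- The weak form of the translation estimate `‖u(· + t e_i) - u‖ ≤ |t| ‖∂_i u‖`, for `u` extended by
zero and test functions `φ` whose translates stay inside `Ω`: the derivative in `t` of
`∫ u φ(· - t e_i)` is `∫ ∂_i u φ(· - t e_i)`. -/
lemma abs_integral_translate_sub_le [IsFiniteMeasure (volume.restrict Ω)] (hΩ : MeasurableSet Ω)
    (h : IsH1 Ω u g)
    (hK : Metric.cthickening δ K ⊆ Ω) {φ : Rd d → ℝ} (hφ : ContDiff ℝ ∞ φ)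
    (hφc : HasCompactSupport φ) (hφK : tsupport φ ⊆ K) (i : Fin d) {t : ℝ} (ht : |t| ≤ δ) :
    |∫ x, (Ω.indicator u (x + t • ei i) - Ω.indicator u x) * φ x| ≤
      |t| * (eLpNorm (fun x => g x i) 2 (volume.restrict Ω)).toReal *
        (eLpNorm φ 2 volume).toReal := by
  have hm : MemLp φ 2 (volume : Measure (Rd d)) := hφ.continuous.memLp_of_hasCompactSupport hφc
  set F : ℝ → ℝ := fun t => ∫ x in Ω, u x * φ (x - t • ei i) with hF
  have hFt : ∀ t, F t = ∫ x, Ω.indicator u (x + t • ei i) * φ x := fun t =>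
    integral_mul_translate hΩ u φ _
  have e1 : ∫ x, (Ω.indicator u (x + t • ei i) - Ω.indicator u x) * φ x = F t - F 0 := by
    rw [hFt, hFt, ← integral_sub (integrable_mul_of_memLp (memLp_indicator_translate hΩ h.1 _) hm)
      (integrable_mul_of_memLp (memLp_indicator_translate hΩ h.1 _) hm)]
    simp [sub_mul]
  have hder : ∀ τ, HasDerivAt F (∫ x in Ω, u x * -fderiv ℝ φ (x - τ • ei i) (ei i)) τ := fun τ =>
    hasDerivAt_integral_translate (h.1.integrable (by norm_num)) hφ hφc _ τ
  have hbd : ∀ τ ∈ Icc (-δ) δ, ‖∫ x in Ω, u x * -fderiv ℝ φ (x - τ • ei i) (ei i)‖ ≤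
      (eLpNorm (fun x => g x i) 2 (volume.restrict Ω)).toReal * (eLpNorm φ 2 volume).toReal := by
    intro τ hτ
    have hτ' : ‖τ • ei i‖ ≤ δ := by
      rw [norm_smul, PiLp.norm_single, norm_one, mul_one, Real.norm_eq_abs]
      exact abs_le.2 hτ
    have htest := isTest_translate hK hφ hφc hφK hτ'
    have e2 : ∫ x in Ω, u x * -fderiv ℝ φ (x - τ • ei i) (ei i) =
        ∫ x in Ω, g x i * φ (x - τ • ei i) := by
      have := h.2.2 _ htest i
      rw [eq_neg_iff_add_eq_zero, add_comm, ← eq_neg_iff_add_eq_zero] at this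
      rw [this, ← integral_neg]
      refine integral_congr_ae (Filter.Eventually.of_forall fun x => ?_)
      simp only [gradient_apply]
      rw [fderiv_comp_sub]
      ring
    rw [e2, Real.norm_eq_abs]
    refine (abs_integral_mul_le (memLp_comp_i h.2.1 i) (htest.memLp 2 _)).trans ?_
    exact mul_le_mul_of_nonneg_left (eLpNorm_translate_le hm _) ENNReal.toReal_nonneg
  rw [e1]
  have hδ : 0 ≤ δ := (abs_nonneg t).trans ht
  have := (convex_Icc (-δ) δ).norm_image_sub_le_of_norm_hasDerivWithin_le
    (fun τ _ => (hder τ).hasDerivWithinAt) hbd (x := 0) (y := t) ⟨by linarith, hδ⟩ (abs_le.1 ht)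
  rw [sub_zero, Real.norm_eq_abs, Real.norm_eq_abs] at this
  exact this.trans_eq (by ring)

/-- The strong form of the translation estimate, localized by a cut-off function. -/
lemma eLpNorm_mul_translate_sub_le [IsFiniteMeasure (volume.restrict Ω)] (hΩ : MeasurableSet Ω)
    (h : IsH1 Ω u g) (hK : Metric.cthickening δ K ⊆ Ω) {χ : Rd d → ℝ} (hχ : ContDiff ℝ ∞ χ)
    (hχc : HasCompactSupport χ) (hχK : tsupport χ ⊆ K) (hχ1 : ∀ x, |χ x| ≤ 1) (i : Fin d) {t : ℝ}
    (ht : |t| ≤ δ) :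
    (eLpNorm (fun x => (Ω.indicator u (x + t • ei i) - Ω.indicator u x) * χ x) 2 volume).toReal ≤
      |t| * (eLpNorm (fun x => g x i) 2 (volume.restrict Ω)).toReal := by
  have hw : MemLp (fun x => Ω.indicator u (x + t • ei i) - Ω.indicator u x) 2 volume :=
    (memLp_indicator_translate hΩ h.1 _).sub ((memLp_indicator_iff_restrict hΩ).2 h.1)
  have hwχ : MemLp (fun x => (Ω.indicator u (x + t • ei i) - Ω.indicator u x) * χ x) 2 volume :=
    hw.of_le (hw.1.mul hχ.continuous.aestronglyMeasurable) (Filter.Eventually.of_forall fun x => by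
      rw [norm_mul]
      exact mul_le_of_le_one_right (norm_nonneg _) (hχ1 x))
  refine eLpNorm_le_of_abs_integral_mul_le hwχ (by positivity) fun ψ hψ hψc => ?_
  have h1 := abs_integral_translate_sub_le hΩ h hK (φ := fun x => χ x * ψ x) (hχ.mul hψ)
    hχc.mul_right ((tsupport_mul_subset_left).trans hχK) i ht
  simp only [← mul_assoc] at h1
  refine h1.trans ?_
  have hm : MemLp ψ 2 (volume : Measure (Rd d)) := hψ.continuous.memLp_of_hasCompactSupport hψc
  refine mul_le_mul_of_nonneg_left (ENNReal.toReal_mono hm.2.ne (eLpNorm_mono fun x => ?_))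
    (by positivity)
  rw [norm_mul]
  exact mul_le_of_le_one_left (norm_nonneg _) (hχ1 _)

lemma exists_cutoff {S : Set (Rd d)} (hS : IsCompact S) {δ : ℝ} (hδ : 0 < δ) :
    ∃ χ : Rd d → ℝ, ContDiff ℝ ∞ χ ∧ HasCompactSupport χ ∧ tsupport χ ⊆ Metric.cthickening δ S ∧
      (∀ x, |χ x| ≤ 1) ∧ ∀ x ∈ S, χ x = 1 := by
  obtain ⟨χ, h1, h2, h3, h4⟩ := exists_contMDiff_support_eq_eq_one_iff (n := (⊤ : ℕ∞))
    (modelWithCornersSelf ℝ (Rd d)) (Metric.isOpen_thickening (δ := δ) (E := S)) hS.isClosed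
    (Metric.self_subset_thickening hδ S)
  have hsub : tsupport χ ⊆ Metric.cthickening δ S := by
    rw [tsupport, h3]
    exact Metric.closure_thickening_subset_cthickening _ _
  refine ⟨χ, h1.contDiff, hS.cthickening.of_isClosed_subset (isClosed_tsupport _) hsub, hsub,
    fun x => ?_, fun x hx => (h4 x).1 hx⟩
  have := h2 (mem_range_self x)
  rw [abs_of_nonneg this.1]
  exact this.2

/-- The distributional derivative of a contraction of `u` is bounded in `L²` by that of `u`. The
translation estimate passes from `u` to `c ∘ u` pointwise, and the left-hand side is the derivative
at `t = 0` of the translated integral of `c ∘ u`. -/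
lemma abs_integral_contraction_le [IsFiniteMeasure (volume.restrict Ω)] (hΩ : IsOpen Ω)
    (h : IsH1 Ω u g) {c : ℝ → ℝ} (hc : ∀ a b, |c a - c b| ≤ |a - b|) (hc0 : c 0 = 0)
    (hcu : MemLp (fun x => c (u x)) 2 (volume.restrict Ω)) {φ : Rd d → ℝ} (hφ : IsTest Ω φ)
    (i : Fin d) :
    |∫ x in Ω, c (u x) * fderiv ℝ φ x (ei i)| ≤
      (eLpNorm (fun x => g x i) 2 (volume.restrict Ω)).toReal * (eLpNorm φ 2 volume).toReal := by
  have hm : MemLp φ 2 (volume : Measure (Rd d)) := hφ.memLp 2 _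
  -- a cut-off `χ` with `χ = 1` on the support of `φ` leaves room for translations on both sides
  obtain ⟨r, hr, hrΩ⟩ := hφ.2.1.exists_cthickening_subset_open hΩ hφ.2.2
  have hr2 : 0 < r / 2 := by positivity
  have hK : Metric.cthickening (r / 2) (Metric.cthickening (r / 2) (tsupport φ)) ⊆ Ω := by
    refine (Metric.cthickening_cthickening_subset hr2.le hr2.le _).trans ?_
    rwa [add_halves]
  obtain ⟨χ, hχ, hχc, hχK, hχ1, hχS⟩ := exists_cutoff hφ.2.1 hr2
  set F : ℝ → ℝ := fun t => ∫ x in Ω, c (u x) * φ (x - t • ei i) with hF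
  have hder := hasDerivAt_integral_translate (hcu.integrable (by norm_num)) hφ.1 hφ.2.1 (ei i) 0
  have hlip : ∀ t, |t| ≤ r / 2 → |F t - F 0| ≤
      (eLpNorm (fun x => g x i) 2 (volume.restrict Ω)).toReal * (eLpNorm φ 2 volume).toReal *
        |t| := by
    intro t ht
    -- `c 0 = 0` makes the contraction commute with the extension by zero
    have hind : ∀ x, Ω.indicator (fun x => c (u x)) x = c (Ω.indicator u x) := fun x => by
      by_cases hx : x ∈ Ω <;> simp [hx, hc0]
    have hFt : ∀ t, F t = ∫ x, Ω.indicator (fun x => c (u x)) (x + t • ei i) * φ x := fun t =>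
      integral_mul_translate hΩ.measurableSet _ φ _
    have hw : MemLp (fun x => Ω.indicator u (x + t • ei i) - Ω.indicator u x) 2 volume :=
      (memLp_indicator_translate hΩ.measurableSet h.1 _).sub
        ((memLp_indicator_iff_restrict hΩ.measurableSet).2 h.1)
    have hwχ : MemLp (fun x => (Ω.indicator u (x + t • ei i) - Ω.indicator u x) * χ x) 2 volume :=
      hw.of_le (hw.1.mul hχ.continuous.aestronglyMeasurable)
        (Filter.Eventually.of_forall fun x => by
          rw [norm_mul]
          exact mul_le_of_le_one_right (norm_nonneg _) (hχ1 x))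
    rw [hFt, hFt, ← integral_sub
      (integrable_mul_of_memLp (memLp_indicator_translate hΩ.measurableSet hcu _) hm)
      (integrable_mul_of_memLp (memLp_indicator_translate hΩ.measurableSet hcu _) hm)]
    refine abs_integral_le_integral_abs.trans ?_
    have hle : ∀ x, |Ω.indicator (fun x => c (u x)) (x + t • ei i) * φ x -
        Ω.indicator (fun x => c (u x)) (x + (0 : ℝ) • ei i) * φ x| ≤
        ‖(Ω.indicator u (x + t • ei i) - Ω.indicator u x) * χ x‖ * ‖φ x‖ := fun x => by
      rw [← sub_mul, abs_mul, hind, hind, zero_smul, add_zero]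
      by_cases hx : x ∈ tsupport φ
      · rw [hχS x hx, mul_one]
        exact mul_le_mul_of_nonneg_right (hc _ _) (abs_nonneg _)
      · simp [image_eq_zero_of_notMem_tsupport hx]
    refine (integral_mono_of_nonneg (Filter.Eventually.of_forall fun x => abs_nonneg _)
      (hwχ.norm.integrable_mul hm.norm) (Filter.Eventually.of_forall hle)).trans ?_
    refine (le_abs_self _).trans ((abs_integral_mul_le hwχ.norm hm.norm).trans ?_)
    rw [eLpNorm_norm, eLpNorm_norm]
    have := eLpNorm_mul_translate_sub_le hΩ.measurableSet h hK hχ hχc hχK hχ1 i ht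
    calc _ ≤ |t| * (eLpNorm (fun x => g x i) 2 (volume.restrict Ω)).toReal *
          (eLpNorm φ 2 volume).toReal := by gcongr
      _ = _ := by ring
  have hfin := hder.le_of_lip' (C := (eLpNorm (fun x => g x i) 2 (volume.restrict Ω)).toReal *
    (eLpNorm φ 2 volume).toReal) (by positivity) (by
      filter_upwards [Metric.closedBall_mem_nhds (0 : ℝ) hr2] with t ht
      rw [sub_zero]
      exact hlip t (by simpa using ht))
  simpa [integral_neg] using hfin

/-- A contraction `c` with `c 0 = 0` maps `H¹(Ω)` to itself and does not increase the norms of the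
partial derivatives. -/
lemma IsH1.comp_contraction [IsFiniteMeasure (volume.restrict Ω)] (hΩ : IsOpen Ω)
    (h : IsH1 Ω u g) {c : ℝ → ℝ} (hc : ∀ a b, |c a - c b| ≤ |a - b|) (hc0 : c 0 = 0)
    (hcu : MemLp (fun x => c (u x)) 2 (volume.restrict Ω)) :
    ∃ G, IsH1 Ω (fun x => c (u x)) G ∧
      eLpNorm G 2 (volume.restrict Ω) ≤ d * eLpNorm g 2 (volume.restrict Ω) := by
  have key : ∀ i : Fin d, ∃ Gi : L2 Ω,
      ‖Gi‖ ≤ (eLpNorm (fun x => g x i) 2 (volume.restrict Ω)).toReal ∧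
      ∀ φ, IsTest Ω φ → -∫ x in Ω, c (u x) * fderiv ℝ φ x (ei i) = ∫ x in Ω, Gi x * φ x := by
    intro i
    let l : Tests Ω →ₗ[ℝ] ℝ :=
      { toFun := fun φ => -∫ x in Ω, c (u x) * fderiv ℝ (φ : Rd d → ℝ) x (ei i)
        map_add' := fun φ ψ => by
          rw [← neg_add, ← integral_add
            (integrable_mul_of_memLp hcu (IsTest.memLp_deriv φ.2 _ 2 _))
            (integrable_mul_of_memLp hcu (IsTest.memLp_deriv ψ.2 _ 2 _))]
          congr 1
          refine integral_congr_ae (Filter.Eventually.of_forall fun x => ?_)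
          change c (u x) * fderiv ℝ ((φ : Rd d → ℝ) + (ψ : Rd d → ℝ)) x (ei i) = _
          rw [fderiv_add (IsTest.diff φ.2 x) (IsTest.diff ψ.2 x), add_apply, mul_add]
        map_smul' := fun r φ => by
          rw [RingHom.id_apply, smul_eq_mul, mul_neg, ← integral_const_mul]
          congr 1
          refine integral_congr_ae (Filter.Eventually.of_forall fun x => ?_)
          change c (u x) * fderiv ℝ (r • (φ : Rd d → ℝ)) x (ei i) = _
          rw [fderiv_const_smul (IsTest.diff φ.2 x), smul_apply, smul_eq_mul]
          ring }
    obtain ⟨Gi, hGi, hGl⟩ := exists_riesz_of_bound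
      (toL2 (m := volume.restrict Ω) (Tests Ω).subtype fun φ => IsTest.memLp φ.2 2 _) l
      (c := (eLpNorm (fun x => g x i) 2 (volume.restrict Ω)).toReal) ENNReal.toReal_nonneg
      fun φ => by
        change |-_| ≤ _
        rw [abs_neg]
        refine (abs_integral_contraction_le hΩ h hc hc0 hcu φ.2 i).trans (le_of_eq ?_)
        change _ = _ * ‖MemLp.toLp (φ : Rd d → ℝ) (IsTest.memLp φ.2 2 (volume.restrict Ω))‖
        rw [Lp.norm_toLp, ← eLpNorm_indicator_eq_eLpNorm_restrict (f := (φ : Rd d → ℝ)) hΩ.measurableSet,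
          Set.indicator_eq_self.2 ((subset_tsupport _).trans φ.2.2.2)]
    refine ⟨Gi, hGi, fun φ hφ => (hGl ⟨φ, hφ⟩).trans ?_⟩
    rw [inner_L2_eq]
    refine integral_congr_ae ?_
    filter_upwards [coeFn_toL2 (m := volume.restrict Ω) (Tests Ω).subtype
      (fun φ => IsTest.memLp φ.2 2 _) ⟨φ, hφ⟩] with x hx
    rw [hx]; rfl
  choose G hG hGφ using key
  have hmeas : ∀ i, AEStronglyMeasurable (fun x => (WithLp.toLp 2 (fun j => G j x) : Rd d) i)
      (volume.restrict Ω) := fun i => (Lp.memLp (G i)).1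
  have hle : eLpNorm (fun x => (WithLp.toLp 2 (fun j => G j x) : Rd d)) 2 (volume.restrict Ω) ≤
      d * eLpNorm g 2 (volume.restrict Ω) := by
    refine (eLpNorm_euclidean_le hmeas).trans ?_
    have := Finset.sum_le_card_nsmul Finset.univ
      (fun i => eLpNorm (fun x => (WithLp.toLp 2 (fun j => G j x) : Rd d) i) 2 (volume.restrict Ω))
      (eLpNorm g 2 (volume.restrict Ω)) fun i _ => by
        have h1 := ENNReal.ofReal_le_ofReal (hG i)
        rw [ENNReal.ofReal_toReal (memLp_comp_i h.2.1 i).2.ne, Lp.norm_def,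
          ENNReal.ofReal_toReal (Lp.memLp (G i)).2.ne] at h1
        exact h1.trans (eLpNorm_mono fun x => PiLp.norm_apply_le (g x) i)
    rwa [Finset.card_univ, Fintype.card_fin, nsmul_eq_mul] at this
  refine ⟨_, ⟨hcu, ⟨aestronglyMeasurable_euclidean hmeas, hle.trans_lt
    (ENNReal.mul_lt_top (by simp) h.2.1.2)⟩, fun φ hφ i => ?_⟩, hle⟩
  rw [← hGφ i φ hφ, neg_neg]
  simp only [gradient_apply]

end

end

/-! ### The regularity estimate -/

section

variable {d : ℕ} {Ω : Set (Rd d)} {s : ℝ}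

lemma IsH1.const_mul {u : Rd d → ℝ} {g : Rd d → Rd d} (h : IsH1 Ω u g) (c : ℝ) :
    IsH1 Ω (fun x => c * u x) (fun x => c • g x) := by
  refine ⟨h.1.const_mul c, h.2.1.const_smul c, fun φ hφ i => ?_⟩
  simp only [PiLp.smul_apply, smul_eq_mul, mul_assoc]
  rw [integral_const_mul, integral_const_mul, h.2.2 φ hφ i, mul_neg]

lemma IsH1.sub {u v : Rd d → ℝ} {g k : Rd d → Rd d} (hu : IsH1 Ω u g) (hv : IsH1 Ω v k) :
    IsH1 Ω (fun x => u x - v x) (fun x => g x - k x) := by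
  refine ⟨hu.1.sub hv.1, hu.2.1.sub hv.2.1, fun φ hφ i => ?_⟩
  have m1 : MemLp (fun x => gradient φ x i) 2 (volume.restrict Ω) := by
    simp only [gradient_apply]
    exact hφ.memLp_deriv (ei i) 2 _
  have m2 := hφ.memLp 2 (volume.restrict Ω)
  simp only [PiLp.sub_apply, sub_mul]
  rw [integral_sub (integrable_mul_of_memLp hu.1 m1) (integrable_mul_of_memLp hv.1 m1),
    integral_sub (integrable_mul_of_memLp (memLp_comp_i hu.2.1 i) m2)
      (integrable_mul_of_memLp (memLp_comp_i hv.2.1 i) m2), hu.2.2 φ hφ i, hv.2.2 φ hφ i]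
  ring

lemma IsH1.congr {u v : Rd d → ℝ} {g : Rd d → Rd d} (h : IsH1 Ω u g)
    (huv : u =ᵐ[volume.restrict Ω] v) : IsH1 Ω v g := by
  refine ⟨h.1.ae_eq huv, h.2.1, fun φ hφ i => ?_⟩
  rw [← h.2.2 φ hφ i]
  refine integral_congr_ae ?_
  filter_upwards [huv] with x hx
  rw [hx]

section

variable (A : Rd d → Matrix (Fin d) (Fin d) ℝ) (f : HsRef Ω s →ₗ[ℝ] ℝ) (z q : L2 Ω)

lemma eFun_eq_fiber : eFun Ω s A f q =
    fiber (wt s) (cFn Ω s (E Ω s A f q)) (cFn Ω s (E Ω s A f q)) := by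
  funext x
  rw [fiber, integral_wt]
  simp only [← sq]
  rfl

lemma pFun_eq_fiber : pFun Ω s A f z q =
    fiber (wt s) (cFn Ω s (adj Ω s A f z q)) (cFn Ω s (adj Ω s A f z q)) := by
  funext x
  rw [fiber, integral_wt]
  simp only [← sq]
  rfl

lemma frakP_eq_fiber : frakP Ω s A f z q = fun x =>
    -(1 / ds s) * fiber (wt s) (cFn Ω s (E Ω s A f q)) (cFn Ω s (adj Ω s A f z q)) x := by
  funext x
  rw [fiber, integral_wt]
  simp only [← mul_assoc]
  rfl

end

section

variable [hs : Fact (s ∈ Ioo (0 : ℝ) 1)]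
  {A : Rd d → Matrix (Fin d) (Fin d) ℝ} {a₀ : ℝ} (hA : IsDiffusion Ω a₀ A) (ha₀ : 0 < a₀)
  {R : ℝ} (hR0 : 0 < R) (hR : Ω ⊆ Metric.closedBall 0 R) (i₀ : Fin d)
  {f : HsRef Ω s →ₗ[ℝ] ℝ} (hf : negNorm Ω (fun _ => 1) 0 s f < ⊤)

include hA ha₀ hR0 hR i₀ hf

/-- A local solution is the projection of `q* - ρ⁻¹ 𝔭` onto the admissible interval. -/
lemma localSolution_eq_clip {qbar ρ : ℝ} (hqbar : 0 < qbar) (hρ : 0 < ρ) {z qstar q : L2 Ω}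
    (hloc : IsLocalSolution Ω s A f z qstar ρ qbar q)
    (hp : MemLp (frakP Ω s A f z q) 2 (volume.restrict Ω)) :
    q =ᵐ[volume.restrict Ω] fun x => clip qbar (qstar x - ρ⁻¹ * frakP Ω s A f z q x) := by
  refine eq_clip_of_variational hqbar hρ hp hloc.1 fun h hh => ?_
  have hb : MemLp (h - q : L2 Ω) ⊤ (volume.restrict Ω) :=
    ((Adm.memLp hh).sub (Adm.memLp hloc.1)).ae_eq (Lp.coeFn_sub h q).symm
  have h0 := variational_inequality hA ha₀ hR0 hR i₀ hf hloc hh hb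
  have e1 : ∫ x in Ω, (h - q : L2 Ω) x *
      fiber (wt s) (cFn Ω s (E Ω s A f q)) (cFn Ω s (adj Ω s A f z q)) x =
      potForm s hb (E Ω s A f q) (adj Ω s A f z q) := integral_mul_fiber_cyl hb _ _
  rw [inner_L2_eq, ← e1, ← integral_const_mul, ← integral_const_mul, ← integral_add] at h0
  · refine h0.trans_eq (integral_congr_ae ?_)
    filter_upwards [Lp.coeFn_sub q qstar] with x hx
    rw [hx, frakP_eq_fiber, Pi.sub_apply]
    ring
  · have h1 := integrable_mul_of_memLp (Lp.memLp (h - q : L2 Ω)) hp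
    refine h1.congr (Filter.Eventually.of_forall fun x => ?_)
    simp only [frakP_eq_fiber]
    ring
  · exact (integrable_mul_of_memLp (Lp.memLp _) (Lp.memLp _)).const_mul ρ

end

/-- The constant in the energy bounds of the states. -/
def stateConst (s a₀ R : ℝ) : ℝ≥0 :=
  (√(coerConst a₀ R))⁻¹.toNNReal * (ds s * √(trConst s)).toNNReal *
    ((√(trConst s) / coerConst a₀ R).toNNReal * (ds s * √(trConst s)).toNNReal + 1)

section

variable [hs : Fact (s ∈ Ioo (0 : ℝ) 1)]
  {A : Rd d → Matrix (Fin d) (Fin d) ℝ} {a₀ : ℝ} (hA : IsDiffusion Ω a₀ A)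
  {q : L2 Ω} (hq : MemLp q ⊤ (volume.restrict Ω)) (hq0 : ∀ᵐ x ∂(volume.restrict Ω), 0 ≤ q x)
  (ha₀ : 0 < a₀) {R : ℝ} (hR0 : 0 < R) (hR : Ω ⊆ Metric.closedBall 0 R) (i₀ : Fin d)
  {f : HsRef Ω s →ₗ[ℝ] ℝ} (hf : negNorm Ω (fun _ => 1) 0 s f < ⊤)

include hA hq hq0 ha₀ hR0 hR i₀

lemma enorm_le_energy (W : HL Ω s) :
    ‖W‖ₑ ≤ ((√(coerConst a₀ R))⁻¹.toNNReal : ℝ≥0∞) * ENNReal.ofReal √(hlForm s hA hq W W) := by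
  rw [← ofReal_norm, ← ENNReal.ofReal, ← ENNReal.ofReal_mul (by positivity)]
  exact ENNReal.ofReal_le_ofReal (norm_le_sqrt_hlForm hA hq hq0 ha₀ hR0 hR i₀ W)

include hf

/-- The energy estimate for the state, in the norm of the energy space. -/
lemma enorm_E_le : ‖E Ω s A f q‖ₑ ≤ stateConst s a₀ R * negNorm Ω A q s f := by
  refine (enorm_le_energy hA hq hq0 ha₀ hR0 hR i₀ _).trans ((mul_le_mul_right
    (energy_E_le hA hq hq0 ha₀ hR0 hR i₀ hf) _).trans ?_)
  rw [← mul_assoc, stateConst, ENNReal.coe_mul, ENNReal.coe_mul, ENNReal.coe_add, ENNReal.coe_one]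
  refine mul_le_mul_left ?_ _
  exact le_mul_of_one_le_right' le_add_self

/-- The energy estimate for the adjoint state, in the norm of the energy space. -/
lemma enorm_adj_le (z : L2 Ω) : ‖adj Ω s A f z q‖ₑ ≤
    stateConst s a₀ R * (negNorm Ω A q s f + negNorm Ω A q s (l2Functional Ω s z)) := by
  refine (enorm_le_energy hA hq hq0 ha₀ hR0 hR i₀ _).trans ((mul_le_mul_right
    (energy_adj_le hA hq hq0 ha₀ hR0 hR i₀ f z) _).trans ((mul_le_mul_right (mul_le_mul_right
      (add_le_add_left (mul_le_mul_right (energy_E_le hA hq hq0 ha₀ hR0 hR i₀ hf) _) _) _) _).trans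
        ?_))
  rw [← mul_assoc, stateConst, ENNReal.coe_mul, ENNReal.coe_mul, ENNReal.coe_add, ENNReal.coe_one,
    ENNReal.coe_mul, mul_assoc (_ * _) (_ + 1) (_ + _)]
  refine mul_le_mul_right ?_ _
  rw [← mul_assoc, mul_add, add_mul, add_mul, one_mul, one_mul]
  gcongr
  · exact le_self_add
  · exact le_add_self

end

end

end FracIdent

end

open FracIdent in
theorem theorem3 (d : ℕ) (hd : d = 2 ∨ d = 3) (Ω : Set (EuclideanSpace ℝ (Fin d)))
    (hΩopen : IsOpen Ω) (hΩbdd : Bornology.IsBounded Ω) (hΩconv : Convex ℝ Ω)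
    (hΩne : Ω.Nonempty) (s : ℝ) (hs : s ∈ Set.Ioo (0 : ℝ) 1)
    (a₀ : ℝ) (ha₀ : 0 < a₀) (ρ : ℝ) (hρ : 0 < ρ) :
    ∃ C : ℝ≥0, ∀ (A : EuclideanSpace ℝ (Fin d) → Matrix (Fin d) (Fin d) ℝ),
      FracIdent.IsDiffusion Ω a₀ A →
      ∀ qbar : ℝ, 0 < qbar →
      ∀ f : FracIdent.HsRef Ω s →ₗ[ℝ] ℝ, FracIdent.negNorm Ω (fun _ => 1) 0 s f < ⊤ →
      ∀ (z qstar : FracIdent.L2 Ω)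
        (gstar : EuclideanSpace ℝ (Fin d) → EuclideanSpace ℝ (Fin d)),
      FracIdent.IsH1 Ω qstar gstar →
      ∀ q : FracIdent.L2 Ω, FracIdent.IsLocalSolution Ω s A f z qstar ρ qbar q →
      eLpNorm (FracIdent.eFun Ω s A f q) ⊤ (volume.restrict Ω) < ⊤ →
      eLpNorm (FracIdent.pFun Ω s A f z q) ⊤ (volume.restrict Ω) < ⊤ →
      ∃ gq gp : EuclideanSpace ℝ (Fin d) → EuclideanSpace ℝ (Fin d),
        FracIdent.IsH1 Ω q gq ∧ FracIdent.IsH1 Ω (FracIdent.frakP Ω s A f z q) gp ∧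
        eLpNorm gq 2 (volume.restrict Ω) + eLpNorm gp 2 (volume.restrict Ω) ≤
          C * (eLpNorm gstar 2 (volume.restrict Ω)
            + FracIdent.negNorm Ω A q s f
              * eLpNorm (FracIdent.pFun Ω s A f z q) ⊤ (volume.restrict Ω) ^ (1 / 2 : ℝ)
            + (FracIdent.negNorm Ω A q s f
                + FracIdent.negNorm Ω A q s (FracIdent.l2Functional Ω s z))
              * eLpNorm (FracIdent.eFun Ω s A f q) ⊤ (volume.restrict Ω) ^ (1 / 2 : ℝ)) := by
  obtain ⟨r, hr⟩ := hΩbdd.subset_closedBall 0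
  obtain ⟨R, hR0, hR⟩ : ∃ R : ℝ, 0 < R ∧ Ω ⊆ Metric.closedBall 0 R :=
    ⟨max r 1, by positivity, hr.trans (Metric.closedBall_subset_closedBall (le_max_left _ _))⟩
  have hd0 : 0 < d := by rcases hd with rfl | rfl <;> norm_num
  let i₀ : Fin d := ⟨0, hd0⟩
  have : Fact (s ∈ Set.Ioo (0 : ℝ) 1) := ⟨hs⟩
  have : IsFiniteMeasure (volume.restrict Ω) :=
    isFiniteMeasure_restrict.2 hΩbdd.measure_lt_top.ne
  have hds := ds_pos (s := s)
  obtain ⟨M, hM⟩ : ∃ M : ℝ≥0, M = (1 / ds s).toNNReal * (d * stateConst s a₀ R) := ⟨_, rfl⟩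
  refine ⟨d + (d * ρ⁻¹.toNNReal + 1) * M, fun A hA qbar hqbar f hf z qstar gstar hgstar q hloc
    he hp => ?_⟩
  have hq := Adm.memLp hloc.1
  have hq0 := Adm.nonneg hloc.1
  have hfib := isH1_fiber (E Ω s A f q) (adj Ω s A f z q) (eFun_eq_fiber A f q ▸ he)
    (pFun_eq_fiber A f z q ▸ hp)
  have hgp0 := eLpNorm_fiberGrad_le (E Ω s A f q) (adj Ω s A f z q)
  rw [← eFun_eq_fiber, ← pFun_eq_fiber] at hgp0
  set k := fiberGrad (E Ω s A f q) (adj Ω s A f z q) with hk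
  have hP : IsH1 Ω (frakP Ω s A f z q) fun x => -(1 / ds s) • k x := by
    rw [frakP_eq_fiber]
    exact hfib.const_mul _
  obtain ⟨gq, hgq, hgq_le⟩ := (hgstar.sub (hP.const_mul ρ⁻¹)).comp_contraction hΩopen
    (abs_clip_sub_le qbar) (clip_zero hqbar.le) (memLp_clip hqbar.le
      (hgstar.sub (hP.const_mul ρ⁻¹)).1)
  refine ⟨gq, _, hgq.congr (localSolution_eq_clip hA ha₀ hR0 hR i₀ hf hqbar hρ hloc hP.1).symm,
    hP, ?_⟩
  set G := eLpNorm gstar 2 (volume.restrict Ω) with hG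
  set nf := negNorm Ω A q s f with hnf
  set nz := negNorm Ω A q s (l2Functional Ω s z) with hnz
  set Ne := eLpNorm (eFun Ω s A f q) ⊤ (volume.restrict Ω) ^ (1 / 2 : ℝ) with hNe
  set Np := eLpNorm (pFun Ω s A f z q) ⊤ (volume.restrict Ω) ^ (1 / 2 : ℝ) with hNp
  have hgp : eLpNorm (fun x => -(1 / ds s) • k x) 2 (volume.restrict Ω) ≤
      M * (nf * Np + (nf + nz) * Ne) := by
    change eLpNorm (-(1 / ds s) • k) 2 (volume.restrict Ω) ≤ _
    rw [eLpNorm_const_smul, enorm_neg, Real.enorm_of_nonneg (by positivity), hM, ENNReal.coe_mul,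
      ENNReal.coe_mul, ENNReal.coe_natCast, mul_assoc, ← ENNReal.ofReal]
    refine mul_le_mul_right (hgp0.trans ?_) _
    rw [mul_assoc]
    refine mul_le_mul_right ?_ _
    rw [mul_add, ← mul_assoc, ← mul_assoc]
    gcongr
    · exact enorm_E_le hA hq hq0 ha₀ hR0 hR i₀ hf
    · exact enorm_adj_le hA hq hq0 ha₀ hR0 hR i₀ hf z
  have hgq' : eLpNorm gq 2 (volume.restrict Ω) ≤
      d * (G + ρ⁻¹.toNNReal * (M * (nf * Np + (nf + nz) * Ne))) := by
    refine hgq_le.trans (mul_le_mul_right ?_ _)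
    refine (eLpNorm_sub_le hgstar.2.1.1 (hP.const_mul ρ⁻¹).2.1.1 (by norm_num)).trans
      (add_le_add_right ?_ _)
    change eLpNorm (ρ⁻¹ • fun x => -(1 / ds s) • k x) 2 (volume.restrict Ω) ≤ _
    rw [eLpNorm_const_smul, Real.enorm_of_nonneg (by positivity)]
    exact mul_le_mul_right hgp _
  refine (add_le_add hgq' hgp).trans ?_
  rw [ENNReal.coe_add, ENNReal.coe_mul, ENNReal.coe_add, ENNReal.coe_mul, ENNReal.coe_natCast,
    ENNReal.coe_one, add_assoc G]
  set S := nf * Np + (nf + nz) * Ne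
  calc (d : ℝ≥0∞) * (G + ρ⁻¹.toNNReal * (M * S)) + M * S
      = d * G + (d * ρ⁻¹.toNNReal + 1) * M * S := by ring
    _ ≤ (d + (d * ρ⁻¹.toNNReal + 1) * M) * G + (d + (d * ρ⁻¹.toNNReal + 1) * M) * S := by
        gcongr
        · exact le_self_add
        · exact le_add_self
    _ = _ := by ring
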